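/- A finite set $s\subseteq\mathbb N$ is *exactly large* if it is nonempty and $\mathrm{card}(s)=\min(s)+1$. Let $\mathrm{RT}(!\omega)$ be the statement: for every infinite set $M\subseteq\mathbb N$ and every coloring $C$ of the exactly large finite subsets of $\mathbb N$ in two colors, there is an infinite set $L\subseteq M$ all of whose exactly large subsets get the same color. Write $\{e\}^X(x)=y$ if the program with index $e$ and oracle $X$ outputs $y$ on input $x$; let $X'=\{e:\{e\}^X(0)\text{ halts}\}$, $X^{(0)}=X$, $X^{(n+1)}=(X^{(n)})'$ and $X^{(\omega)}=\{(i,j): j\in X^{(i)}\}$. All these notions are formalized in the language of second order arithmetic. Theorem. (1) Over $\mathrm{RCA}_0$, the axiom $\forall X\,\exists Y\,(Y=X^{(\omega)})$ implies $\mathrm{RT}(!\omega)$; that is, every (possibly nonstandard) model of $\mathrm{RCA}_0$ in which the axiom holds is a model of $\mathrm{RT}(!\omega)$. (2) There is a program $p\in\mathbb N$ such that the following holds in every model of $\mathrm{RCA}_0+\forall X\,\exists Y\,(Y=X^{(\omega)})$: for every $a\ge 1$, the program $p$ (without oracle) on input $a$ outputs an index $e$ such that for every infinite set $U$ and every coloring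 $C:[U]^a\to 2$, the set $(C\oplus U)^{(2a)}$ exists and $e$ with oracle $(C\oplus U)^{(2a)}$ computes the characteristic function of an infinite $C$-homogeneous subset of $U$. -/

import Mathlib

universe u

/-- A structure for the two-sorted language of second order arithmetic. The number sort is an
arbitrary (possibly nonstandard) type with `0`, `1`, `+`, `·`, `<`; the set sort is a nonempty
collection of subsets of the number sort. -/
structure L2Structure where
  Num : Type u
  [instZero : Zero Num]
  [instOne : One Num]
  [instAdd : Add Num]
  [instMul : Mul Num]
  [instLT : LT Num]
  Sets : Set (Set Num)
  sets_nonempty : Sets.Nonempty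

attribute [instance] L2Structure.instZero L2Structure.instOne L2Structure.instAdd
  L2Structure.instMul L2Structure.instLT

/-- Number terms; number variables are de Bruijn indices. -/
inductive L2Term : Type
  | var (i : ℕ) : L2Term
  | zero : L2Term
  | one : L2Term
  | add (s t : L2Term) : L2Term
  | mul (s t : L2Term) : L2Term

/-- Formulas all of whose quantifiers are bounded number quantifiers, with free number variables
and free set variables. In `ball t φ`, which is `∀ x < t, φ`, the bound variable is the index `0`
of `φ`, while `t` lives outside the scope of the quantifier. -/
inductive L2Bounded : Type
  | eq (s t : L2Term) : L2Bounded
  | lt (s t : L2Term) : L2Bounded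
  | mem (t : L2Term) (X : ℕ) : L2Bounded
  | neg (φ : L2Bounded) : L2Bounded
  | and (φ ψ : L2Bounded) : L2Bounded
  | ball (t : L2Term) (φ : L2Bounded) : L2Bounded

/-- The assignment that sends the variable `0` to `a` and shifts `v` by one. -/
def pushVar {α : Type u} (a : α) (v : ℕ → α) : ℕ → α
  | 0 => a
  | i + 1 => v i

def L2Term.eval (A : L2Structure.{u}) (v : ℕ → A.Num) : L2Term → A.Num
  | .var i => v i
  | .zero => 0
  | .one => 1
  | .add s t => s.eval A v + t.eval A v
  | .mul s t => s.eval A v * t.eval A v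

def L2Bounded.Holds (A : L2Structure.{u}) (V : ℕ → Set A.Num) : L2Bounded → (ℕ → A.Num) → Prop
  | .eq s t, v => s.eval A v = t.eval A v
  | .lt s t, v => s.eval A v < t.eval A v
  | .mem t X, v => t.eval A v ∈ V X
  | .neg φ, v => ¬ φ.Holds A V v
  | .and φ ψ, v => φ.Holds A V v ∧ ψ.Holds A V v
  | .ball t φ, v => ∀ x : A.Num, x < t.eval A v → φ.Holds A V (pushVar x v)

namespace L2Structure

/-- `A` is a model of `RCA₀`: the basic axioms, `Σ⁰₁` induction and `Δ⁰₁` comprehension, both with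
arbitrary number and set parameters. -/
structure ModelsRCA0 (A : L2Structure.{u}) : Prop where
  add_one_ne_zero : ∀ m : A.Num, m + 1 ≠ 0
  add_one_inj : ∀ m n : A.Num, m + 1 = n + 1 → m = n
  add_zero : ∀ m : A.Num, m + 0 = m
  add_add_one : ∀ m n : A.Num, m + (n + 1) = (m + n) + 1
  mul_zero : ∀ m : A.Num, m * 0 = 0
  mul_add_one : ∀ m n : A.Num, m * (n + 1) = m * n + m
  not_lt_zero : ∀ m : A.Num, ¬ m < 0
  lt_add_one_iff : ∀ m n : A.Num, m < n + 1 ↔ m < n ∨ m = n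
  sigma_induction : ∀ (θ : L2Bounded) (v : ℕ → A.Num) (V : ℕ → Set A.Num), (∀ i, V i ∈ A.Sets) →
    (∃ x, θ.Holds A V (pushVar x (pushVar 0 v))) →
    (∀ n, (∃ x, θ.Holds A V (pushVar x (pushVar n v))) →
      ∃ x, θ.Holds A V (pushVar x (pushVar (n + 1) v))) →
    ∀ n, ∃ x, θ.Holds A V (pushVar x (pushVar n v))
  delta_comprehension : ∀ (θ ψ : L2Bounded) (v : ℕ → A.Num) (V : ℕ → Set A.Num),
    (∀ i, V i ∈ A.Sets) →
    (∀ n, (∃ x, θ.Holds A V (pushVar x (pushVar n v))) ↔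
      ∀ x, ψ.Holds A V (pushVar x (pushVar n v))) →
    ∃ X ∈ A.Sets, ∀ n, n ∈ X ↔ ∃ x, θ.Holds A V (pushVar x (pushVar n v))

/-! All notions below are evaluated inside `A`: their number quantifiers range over `A.Num` and
their set quantifiers over `A.Sets`, so each of them is the value in `A` of a formula of second
order arithmetic. -/

/-- The numeral of a standard natural number. -/
def numeral (A : L2Structure.{u}) : ℕ → A.Num
  | 0 => 0
  | n + 1 => A.numeral n + 1

/-- The pairing function `(i, j) = (i + j)² + i`. -/
def pair (A : L2Structure.{u}) (i j : A.Num) : A.Num := (i + j) * (i + j) + i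

/-- The number `i` belongs to the finite set `D_c` with code `c`, where
`D_(k,(m,n)) = {i < k : m (i + 1) + 1 divides n}`. -/
def FinMem (A : L2Structure.{u}) (i c : A.Num) : Prop :=
  ∃ k m n : A.Num, c = A.pair k (A.pair m n) ∧ i < k ∧ ∃ q, n = (m * (i + 1) + 1) * q

/-- `c` is the canonical, i.e. the least, code of the finite set `D_c`. -/
def IsFinCode (A : L2Structure.{u}) (c : A.Num) : Prop :=
  ∀ c' : A.Num, c' < c → ¬ ∀ i, A.FinMem i c' ↔ A.FinMem i c

/-- The finite set `D_c` has exactly `m` elements: some finite set of pairs is (the graph of) a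
bijection from `{i : i < m}` onto `D_c`. -/
def HasCard (A : L2Structure.{u}) (c m : A.Num) : Prop :=
  ∃ f : A.Num,
    (∀ i j, A.FinMem (A.pair i j) f → i < m ∧ A.FinMem j c) ∧
    (∀ i, i < m → ∃! j, A.FinMem (A.pair i j) f) ∧
    (∀ j, A.FinMem j c → ∃! i, A.FinMem (A.pair i j) f)

/-- `D_c` is exactly large: it is nonempty and `card D_c = min D_c + 1`. -/
def ExactlyLarge (A : L2Structure.{u}) (c : A.Num) : Prop :=
  ∃ a, A.FinMem a c ∧ (∀ b, A.FinMem b c → a < b ∨ a = b) ∧ A.HasCard c (a + 1)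

/-- `X` is infinite, i.e. unbounded. -/
def IsInfinite (A : L2Structure.{u}) (X : Set A.Num) : Prop :=
  ∀ n, ∃ m ∈ X, n < m

/-- All finite subsets of `H` with property `P` get the same color. A coloring of finite sets in
two colors is given by the set `C` of the canonical codes of the finite sets of the first color. -/
def IsHomogeneous (A : L2Structure.{u}) (P : A.Num → Prop) (C H : Set A.Num) : Prop :=
  (∀ c, A.IsFinCode c → P c → (∀ i, A.FinMem i c → i ∈ H) → c ∈ C) ∨
  (∀ c, A.IsFinCode c → P c → (∀ i, A.FinMem i c → i ∈ H) → c ∉ C)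

/-- Ramsey's theorem for colorings of exactly large sets in two colors, in `A`. -/
def RTExactlyLarge (A : L2Structure.{u}) : Prop :=
  ∀ M ∈ A.Sets, ∀ C ∈ A.Sets, A.IsInfinite M →
    ∃ L ∈ A.Sets, L ⊆ M ∧ A.IsInfinite L ∧ A.IsHomogeneous A.ExactlyLarge C L

/-- The finite set `D_d` contains, with some rank below `r`, the claim "program `e` on input `x`
outputs `y`". -/
def ClaimBelow (A : L2Structure.{u}) (d r e x y : A.Num) : Prop :=
  ∃ r', r' < r ∧ A.FinMem (A.pair r' (A.pair e (A.pair x y))) d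

/-- The claim "program `e` with oracle `X` outputs `y` on input `x`" follows in one step from the
claims in `D_d` of rank below `r`. Programs are the indices of the functions partial recursive in
`X`: constants, identity, successor, the two projections of pairs, the oracle, pairing,
composition, primitive recursion and minimization. -/
def Justified (A : L2Structure.{u}) (X : Set A.Num) (d r e x y : A.Num) : Prop :=
  (∃ c, e = A.pair (A.numeral 0) c ∧ y = c) ∨
  (e = A.pair (A.numeral 1) 0 ∧ y = x) ∨
  (e = A.pair (A.numeral 2) 0 ∧ y = x + 1) ∨
  (e = A.pair (A.numeral 3) 0 ∧ ∃ b, x = A.pair y b) ∨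
  (e = A.pair (A.numeral 4) 0 ∧ ∃ b, x = A.pair b y) ∨
  (e = A.pair (A.numeral 5) 0 ∧ ((x ∈ X ∧ y = 1) ∨ (x ∉ X ∧ y = 0))) ∨
  (∃ f g, e = A.pair (A.numeral 6) (A.pair f g) ∧
    ∃ p q, A.ClaimBelow d r f x p ∧ A.ClaimBelow d r g x q ∧ y = A.pair p q) ∨
  (∃ f g, e = A.pair (A.numeral 7) (A.pair f g) ∧
    ∃ p, A.ClaimBelow d r g x p ∧ A.ClaimBelow d r f p y) ∨
  (∃ f g, e = A.pair (A.numeral 8) (A.pair f g) ∧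
    ((∃ b, x = A.pair b 0 ∧ A.ClaimBelow d r f b y) ∨
      ∃ b n p, x = A.pair b (n + 1) ∧ A.ClaimBelow d r e (A.pair b n) p ∧
        A.ClaimBelow d r g (A.pair b (A.pair n p)) y)) ∨
  (∃ f, e = A.pair (A.numeral 9) f ∧ A.ClaimBelow d r f (A.pair x y) 0 ∧
    ∀ z, z < y → ∃ p, p ≠ 0 ∧ A.ClaimBelow d r f (A.pair x z) p)

/-- `{e}^X_s(x) = y`: some computation with code below `s`, that is, a finite set of ranked claims
each of which follows from claims of lower rank, shows that program `e` with oracle `X` outputs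
`y` on input `x`. All numbers used in such a computation are below `s`. -/
def RunsTo (A : L2Structure.{u}) (X : Set A.Num) (s e x y : A.Num) : Prop :=
  ∃ d, d < s ∧
    (∀ r e' x' y', A.FinMem (A.pair r (A.pair e' (A.pair x' y'))) d →
      A.Justified X d r e' x' y') ∧
    ∃ r, A.FinMem (A.pair r (A.pair e (A.pair x y))) d

/-- `{e}^X(x) = y`. -/
def Computes (A : L2Structure.{u}) (X : Set A.Num) (e x y : A.Num) : Prop :=
  ∃ s, A.RunsTo X s e x y

/-- `Y = X'`, where `X' = {e : {e}^X(0) halts}`. -/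
def IsJump (A : L2Structure.{u}) (X Y : Set A.Num) : Prop :=
  ∀ e, e ∈ Y ↔ ∃ y, A.Computes X e 0 y

/-- The `i`-th section of `Z`. -/
def sect (A : L2Structure.{u}) (Z : Set A.Num) (i : A.Num) : Set A.Num :=
  {j | A.pair i j ∈ Z}

/-- `Y = X^(n)`, for a number `n` of `A`: there is a sequence of sets of length `n + 1` that
starts with `X`, ends with `Y`, and in which each next set is the jump of the previous one. -/
def IsIterJump (A : L2Structure.{u}) (X : Set A.Num) (n : A.Num) (Y : Set A.Num) : Prop :=
  ∃ Z ∈ A.Sets, A.sect Z 0 = X ∧ (∀ i, i < n → A.IsJump (A.sect Z i) (A.sect Z (i + 1))) ∧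
    A.sect Z n = Y

/-- `Y = X^(ω) = {(i, j) : j ∈ X^(i)}`. -/
def IsOmegaJump (A : L2Structure.{u}) (X Y : Set A.Num) : Prop :=
  (∀ z ∈ Y, ∃ i j, z = A.pair i j) ∧ ∀ n, A.IsIterJump X n (A.sect Y n)

/-- For every set `X` there is a set `Y` with `Y = X^(ω)`, in `A`. -/
def OmegaJumpClosed (A : L2Structure.{u}) : Prop :=
  ∀ X ∈ A.Sets, ∃ Y ∈ A.Sets, A.IsOmegaJump X Y

/-- The join `X ⊕ Y`. -/
def join (A : L2Structure.{u}) (X Y : Set A.Num) : Set A.Num :=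
  {z | (∃ x ∈ X, z = x + x) ∨ ∃ y ∈ Y, z = y + y + 1}

/-- Program `e` with oracle `J` computes (the characteristic function of) the set `H`. -/
def ComputesSet (A : L2Structure.{u}) (J : Set A.Num) (e : A.Num) (H : Set A.Num) : Prop :=
  ∀ x, (x ∈ H → A.Computes J e x 1) ∧ (x ∉ H → A.Computes J e x 0)

/-- In `A`, the program `p` (without oracle) computes from each `a ≥ 1` a program `e` such that,
for every infinite `U` and every coloring `C` of the `a`-element subsets of `U` in two colors,
`e` with oracle `(C ⊕ U)^(2a)` computes an infinite homogeneous subset of `U`. -/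
def UniformHomogeneous (A : L2Structure.{u}) (p : A.Num) : Prop :=
  ∀ a : A.Num, a ≠ 0 → ∃ e, A.Computes ∅ p a e ∧
    ∀ U ∈ A.Sets, ∀ C ∈ A.Sets, A.IsInfinite U →
      ∃ J ∈ A.Sets, A.IsIterJump (A.join C U) (a + a) J ∧
        ∃ H ∈ A.Sets, H ⊆ U ∧ A.IsInfinite H ∧
          A.IsHomogeneous (fun c => A.HasCard c a) C H ∧ A.ComputesSet J e H

end L2Structure

/-!
Both parts follow from an analysis of one construction inside the model `A`, which turns a
coloring of finite sets into a simpler one, uniformly in two jumps.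

*The construction.* Colorings of exactly large sets and of `a`-element sets are treated alike, as
sets `C` of codes of arbitrary finite sets. From `C` and an infinite domain `U`, let the limit
color of `D_s` be the color that `D_s ∪ {t}` has for infinitely many `t ∈ U` that respect the
limit colors of all codes below `s` (`limitColor`), and thin `U` to an infinite set on which, for
every finite `D_s` bounded by some element of the set below `t`, the set `D_s ∪ {t}` has the limit
color of `D_s` (`thinSet`). The new pair (`step`) consists of the limit coloring and the thin set.
Along the iterates `(C_j, U_j)`, a maximum `t ∈ U_{j+1}` can thus be removed from a finite set at
the price of passing from `C_j` to `C_{j+1}` (`IsStepSeq.mem_colorOf_iff`).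

*Sets of `a` elements.* After `a` removals, the color of an `a`-element subset of `U_a` is the
color of the empty set in `C_a`, so that `U_a` is homogeneous (`IsStepSeq.isHomogeneous_card`).

*Exactly large sets.* A diagonal set (`IsStepSeq.exists_diagonal`) consists of numbers `t` that
can be removed in this way from the subsets of which they are the maximum, for all `j` up to any
smaller element; it is infinite because large elements of late domains qualify. If `a` is the
minimum of an exactly large subset, then all other elements can be removed within `a` steps, and
the color is that of `{a}` in `C_a`. It remains to thin out the diagonal set such that this color
does not depend on `a`.

*Uniformity.* The number of iterations may be nonstandard, so the sequence cannot be obtained by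
composing sets in the metatheory. Instead, one fixed program template `t` turns a program that
computes a set `Z` from any `K` into a program that computes `step Z` from the second jump of `K`
(`UOp.step`). The iterates `e_i` of the template are computable numbers (`exists_iterate`), `e_i`
computes `(C_i, U_i)` from `(C ⊕ U)^(2i)` by arithmetical induction, and hence the whole sequence
is a set of `A`, arithmetical in `(C ⊕ U)^(ω)` (`exists_isStepSeq`). The program `e_i` does not
depend on the coloring, which gives the uniformity in the second part.

*Preliminaries.* In a model of `RCA₀` in which `ω`-jumps exist, projections of sets exist
(`projection_mem`), so that arithmetical comprehension and induction are available; the classes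
`D0` and `Ar` let instance resolution recognize bounded and arithmetical definitions. Programs are
verified inside `A`, where halting computations may have nonstandard length, through closure rules
for `Computes` (`computes_of_justified`, `computes_unique`).
-/

set_option linter.unusedVariables false
set_option linter.unusedSectionVars false
set_option synthInstance.maxSize 100000
set_option synthInstance.maxHeartbeats 400000

namespace L2Structure

section

/-! ### Uniformly bounded predicates -/

/-- The predicate `P`, given in all structures at once, is defined by one formula with bounded
quantifiers only, in all models of `RCA₀`. Instance resolution finds the formula, so that induction
and comprehension can be applied to predicates written in the usual way; bounded quantifiers have
the form `∀ x, x < t → …` and `∃ x, x < t ∧ …`. -/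
class D0 (P : ∀ A : L2Structure.{u}, (ℕ → Set A.Num) → (ℕ → A.Num) → Prop) : Prop where
  out : ∃ θ : L2Bounded, ∀ (A : L2Structure.{u}) [Fact A.ModelsRCA0], ∀ V v, P A V v ↔ θ.Holds A V v

/-- The function `f`, given in all structures at once, is the value of one term. -/
class T0 (f : ∀ A : L2Structure.{u}, (ℕ → A.Num) → A.Num) : Prop where
  out : ∃ t : L2Term, ∀ A : L2Structure.{u}, ∀ v, f A v = t.eval A v

variable {P Q : ∀ A : L2Structure.{u}, (ℕ → Set A.Num) → (ℕ → A.Num) → Prop}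
  {f g : ∀ A : L2Structure.{u}, (ℕ → A.Num) → A.Num}

instance T0.var (i : ℕ) : T0.{u} (fun A v => v i) := ⟨.var i, fun _ _ => rfl⟩

instance T0.zero : T0.{u} (fun A v => (0 : A.Num)) := ⟨.zero, fun _ _ => rfl⟩

instance T0.one : T0.{u} (fun A v => (1 : A.Num)) := ⟨.one, fun _ _ => rfl⟩

instance T0.add [hf : T0 f] [hg : T0 g] : T0.{u} (fun A v => f A v + g A v) := by
  obtain ⟨s, hs⟩ := hf
  obtain ⟨t, ht⟩ := hg
  exact ⟨.add s t, fun A v => by simp [L2Term.eval, hs, ht]⟩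

instance T0.mul [hf : T0 f] [hg : T0 g] : T0.{u} (fun A v => f A v * g A v) := by
  obtain ⟨s, hs⟩ := hf
  obtain ⟨t, ht⟩ := hg
  exact ⟨.mul s t, fun A v => by simp [L2Term.eval, hs, ht]⟩

instance T0.pair [hf : T0 f] [hg : T0 g] : T0.{u} (fun A v => A.pair (f A v) (g A v)) := by
  unfold L2Structure.pair; infer_instance

instance D0.lt [hf : T0 f] [hg : T0 g] : D0.{u} (fun A V v => f A v < g A v) := by
  obtain ⟨s, hs⟩ := hf
  obtain ⟨t, ht⟩ := hg
  exact ⟨.lt s t, fun A _ V v => by simp [L2Bounded.Holds, hs, ht]⟩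

instance D0.eq [hf : T0 f] [hg : T0 g] : D0.{u} (fun A V v => f A v = g A v) := by
  obtain ⟨s, hs⟩ := hf
  obtain ⟨t, ht⟩ := hg
  exact ⟨.eq s t, fun A _ V v => by simp [L2Bounded.Holds, hs, ht]⟩

instance D0.mem (i) [hf : T0 f] : D0.{u} (fun A V v => f A v ∈ V i) := by
  obtain ⟨s, hs⟩ := hf
  exact ⟨.mem s i, fun A _ V v => by simp [L2Bounded.Holds, hs]⟩

instance D0.not [hP : D0 P] : D0.{u} (fun A V v => ¬ P A V v) := by
  obtain ⟨s, hs⟩ := hP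
  exact ⟨.neg s, fun A h V v => by simp [L2Bounded.Holds, hs A]⟩

instance D0.and [hP : D0 P] [hQ : D0 Q] : D0.{u} (fun A V v => P A V v ∧ Q A V v) := by
  obtain ⟨s, hs⟩ := hP
  obtain ⟨t, ht⟩ := hQ
  exact ⟨.and s t, fun A h V v => by simp [L2Bounded.Holds, hs A, ht A]⟩

theorem D0.congr (h : ∀ (A : L2Structure.{u}) [Fact A.ModelsRCA0], ∀ V v, P A V v ↔ Q A V v)
    [hQ : D0 Q] : D0 P := by
  obtain ⟨t, ht⟩ := hQ
  exact ⟨t, fun A hA V v => (h A V v).trans (ht A V v)⟩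

instance D0.imp [hP : D0 P] [hQ : D0 Q] : D0.{u} (fun A V v => P A V v → Q A V v) :=
  D0.congr (Q := fun A V v => ¬ (P A V v ∧ ¬ Q A V v)) (by intros; tauto)

instance D0.or [hP : D0 P] [hQ : D0 Q] : D0.{u} (fun A V v => P A V v ∨ Q A V v) :=
  D0.congr (Q := fun A V v => ¬ (¬ P A V v ∧ ¬ Q A V v)) (by intros; tauto)

instance D0.iff [hP : D0 P] [hQ : D0 Q] : D0.{u} (fun A V v => (P A V v ↔ Q A V v)) :=
  D0.congr (Q := fun A V v => (P A V v → Q A V v) ∧ (Q A V v → P A V v)) (by intros; tauto)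

instance D0.ball {P : ∀ A : L2Structure.{u}, (ℕ → Set A.Num) → (ℕ → A.Num) → A.Num → Prop}
    [hf : T0 f] [hP : D0 (fun A V v => P A V (fun i => v (i + 1)) (v 0))] :
    D0.{u} (fun A V v => ∀ x, x < f A v → P A V v x) := by
  obtain ⟨s, hs⟩ := hf
  obtain ⟨t, ht⟩ := hP
  exact ⟨.ball s t, fun A h V v => by
    simp only [L2Bounded.Holds, hs]
    refine forall₂_congr fun x _ => ?_
    exact ht A V (pushVar x v)⟩

instance D0.bex {P : ∀ A : L2Structure.{u}, (ℕ → Set A.Num) → (ℕ → A.Num) → A.Num → Prop}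
    [hf : T0 f] [hP : D0 (fun A V v => P A V (fun i => v (i + 1)) (v 0))] :
    D0.{u} (fun A V v => ∃ x, x < f A v ∧ P A V v x) :=
  D0.congr (Q := fun A V v => ¬ ∀ x, x < f A v → ¬ P A V v x) (by intros; push Not; rfl)

/-! ### Arithmetic -/

section Bootstrap

variable {A : L2Structure.{u}} [hA : Fact A.ModelsRCA0]

theorem sigma_induction
    (P : ∀ A : L2Structure.{u}, (ℕ → Set A.Num) → (ℕ → A.Num) → A.Num → A.Num → Prop)
    [hP : D0 (fun A V v => P A V (fun i => v (i + 2)) (v 1) (v 0))]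
    {V : ℕ → Set A.Num} (hV : ∀ i, V i ∈ A.Sets) (w : ℕ → A.Num)
    (h0 : ∃ x, P A V w 0 x) (hs : ∀ n, (∃ x, P A V w n x) → ∃ x, P A V w (n + 1) x) (n : A.Num) :
    ∃ x, P A V w n x := by
  obtain ⟨θ, hθ⟩ := hP
  have key : ∀ n x, P A V w n x ↔ θ.Holds A V (pushVar x (pushVar n w)) :=
    fun n x => hθ A V (pushVar x (pushVar n w))
  simp only [key] at *
  exact hA.out.sigma_induction θ w V hV h0 hs n

theorem delta_induction (P : ∀ A : L2Structure.{u}, (ℕ → Set A.Num) → (ℕ → A.Num) → A.Num → Prop)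
    [hP : D0 (fun A V v => P A V (fun i => v (i + 2)) (v 1))]
    {V : ℕ → Set A.Num} (hV : ∀ i, V i ∈ A.Sets) (w : ℕ → A.Num)
    (h0 : P A V w 0) (hs : ∀ n, P A V w n → P A V w (n + 1)) (n : A.Num) :
    P A V w n :=
  (sigma_induction (fun A V w n _ => P A V w n) hV w ⟨0, h0⟩
    (fun n ⟨_, h⟩ => ⟨0, hs n h⟩) n).elim fun _ h => h

theorem exists_sets (A : L2Structure.{u}) : ∃ V : ℕ → Set A.Num, ∀ i, V i ∈ A.Sets :=
  let ⟨X, hX⟩ := A.sets_nonempty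
  ⟨fun _ => X, fun _ => hX⟩

/-- `Σ⁰₁` induction for formulas without set parameters and with two number parameters. -/
theorem sigma_induction₂ (P : ∀ A : L2Structure.{u}, A.Num → A.Num → A.Num → A.Num → Prop)
    [hP : D0 (fun A _ v => P A (v 2) (v 3) (v 1) (v 0))] (a b : A.Num)
    (h0 : ∃ x, P A a b 0 x) (hs : ∀ n, (∃ x, P A a b n x) → ∃ x, P A a b (n + 1) x) (n : A.Num) :
    ∃ x, P A a b n x :=
  let ⟨_, hV⟩ := A.exists_sets
  sigma_induction (fun A _ w n x => P A (w 0) (w 1) n x) hV (pushVar a (fun _ => b)) h0 hs n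

theorem delta_induction₂ (P : ∀ A : L2Structure.{u}, A.Num → A.Num → A.Num → Prop)
    [hP : D0 (fun A _ v => P A (v 2) (v 3) (v 1))] (a b : A.Num)
    (h0 : P A a b 0) (hs : ∀ n, P A a b n → P A a b (n + 1)) (n : A.Num) :
    P A a b n :=
  (sigma_induction₂ (fun A a b n _ => P A a b n) a b ⟨0, h0⟩
    (fun n ⟨_, h⟩ => ⟨0, hs n h⟩) n).elim fun _ h => h

theorem num_zero_add (n : A.Num) : 0 + n = n :=
  delta_induction₂ (fun A _ _ n => 0 + n = n) 0 0 (hA.out.add_zero 0)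
    (fun n h => by rw [hA.out.add_add_one, h]) n

theorem num_succ_add (m n : A.Num) : (m + 1) + n = (m + n) + 1 :=
  delta_induction₂ (fun A m _ n => (m + 1) + n = (m + n) + 1) m 0
    (by rw [hA.out.add_zero, hA.out.add_zero])
    (fun n h => by rw [hA.out.add_add_one, h, hA.out.add_add_one]) n

theorem num_add_comm (m n : A.Num) : m + n = n + m :=
  delta_induction₂ (fun A m _ n => m + n = n + m) m 0
    (by rw [hA.out.add_zero, num_zero_add])
    (fun n h => by rw [hA.out.add_add_one, h, num_succ_add]) n

theorem num_add_assoc (a b n : A.Num) : a + b + n = a + (b + n) :=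
  delta_induction₂ (fun A a b n => a + b + n = a + (b + n)) a b
    (by rw [hA.out.add_zero, hA.out.add_zero])
    (fun n h => by rw [hA.out.add_add_one, h, hA.out.add_add_one, hA.out.add_add_one]) n

theorem num_zero_mul (n : A.Num) : 0 * n = 0 :=
  delta_induction₂ (fun A _ _ n => 0 * n = 0) 0 0 (hA.out.mul_zero 0)
    (fun n h => by rw [hA.out.mul_add_one, h, hA.out.add_zero]) n

theorem num_succ_mul (m n : A.Num) : (m + 1) * n = m * n + n :=
  delta_induction₂ (fun A m _ n => (m + 1) * n = m * n + n) m 0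
    (by rw [hA.out.mul_zero, hA.out.mul_zero, hA.out.add_zero])
    (fun n h => by
      rw [hA.out.mul_add_one, h, hA.out.mul_add_one, num_add_assoc, num_add_assoc,
        num_add_comm n (m + 1), num_add_comm m (n + 1), num_succ_add, num_succ_add, num_add_comm n m]) n

theorem num_mul_comm (m n : A.Num) : m * n = n * m :=
  delta_induction₂ (fun A m _ n => m * n = n * m) m 0
    (by rw [hA.out.mul_zero, num_zero_mul])
    (fun n h => by rw [hA.out.mul_add_one, h, num_succ_mul]) n

theorem num_mul_add (a b n : A.Num) : a * (b + n) = a * b + a * n :=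
  delta_induction₂ (fun A a b n => a * (b + n) = a * b + a * n) a b
    (by rw [hA.out.add_zero, hA.out.mul_zero, hA.out.add_zero])
    (fun n h => by
      rw [hA.out.add_add_one, hA.out.mul_add_one, h, hA.out.mul_add_one, num_add_assoc]) n

theorem num_mul_assoc (a b n : A.Num) : a * b * n = a * (b * n) :=
  delta_induction₂ (fun A a b n => a * b * n = a * (b * n)) a b
    (by rw [hA.out.mul_zero, hA.out.mul_zero, hA.out.mul_zero])
    (fun n h => by rw [hA.out.mul_add_one, h, hA.out.mul_add_one, num_mul_add]) n

theorem num_one_mul (n : A.Num) : 1 * n = n := by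
  have := num_succ_mul 0 n
  rwa [num_zero_add, num_zero_mul, num_zero_add] at this

theorem num_add_cancel {m n : A.Num} (k : A.Num) : m + k = n + k → m = n :=
  delta_induction₂ (fun A m n k => m + k = n + k → m = n) m n
    (by rw [hA.out.add_zero, hA.out.add_zero]; exact id)
    (fun k h e => h (hA.out.add_one_inj _ _ (by
      rwa [hA.out.add_add_one, hA.out.add_add_one] at e))) k

theorem eq_zero_or_succ (n : A.Num) : n = 0 ∨ ∃ m, n = m + 1 := by
  obtain ⟨x, h⟩ := sigma_induction₂ (A := A) (fun A _ _ n x => n = 0 ∨ n = x + 1) 0 0 ⟨0, .inl rfl⟩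
    (fun n _ => ⟨n, .inr rfl⟩) n
  exact h.imp id fun h => ⟨x, h⟩

theorem num_lt_add_succ (m k : A.Num) : m < m + k + 1 :=
  delta_induction₂ (fun A m _ k => m < m + k + 1) m 0
    (by rw [hA.out.add_zero]; exact (hA.out.lt_add_one_iff _ _).2 (.inr rfl))
    (fun k h => by rw [hA.out.add_add_one]; exact (hA.out.lt_add_one_iff _ _).2 (.inl h)) k

theorem num_lt_iff {m n : A.Num} : m < n ↔ ∃ k, n = m + k + 1 := by
  constructor
  · intro h
    obtain ⟨x, hx⟩ := sigma_induction₂ (A := A) (fun A m _ n x => m < n → n = m + x + 1) m 0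
      ⟨0, fun h => (hA.out.not_lt_zero _ h).elim⟩ (fun n ⟨x, hx⟩ => by
        by_cases h : m < n
        · refine ⟨x + 1, fun _ => ?_⟩
          rw [hA.out.add_add_one, ← hx h]
        · refine ⟨0, fun h' => ?_⟩
          obtain h' | rfl := (hA.out.lt_add_one_iff _ _).1 h'
          · exact (h h').elim
          · rw [hA.out.add_zero]) n
    exact ⟨x, hx h⟩
  · rintro ⟨k, rfl⟩
    exact num_lt_add_succ m k

theorem num_total (m n : A.Num) : ∃ k, n = m + k ∨ m = n + k :=
  sigma_induction₂ (A := A) (fun A m _ n k => n = m + k ∨ m = n + k) m 0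
    ⟨m, .inr (num_zero_add m).symm⟩ (fun n => by
      rintro ⟨k, rfl | rfl⟩
      · exact ⟨k + 1, .inl (hA.out.add_add_one _ _).symm⟩
      · obtain rfl | ⟨j, rfl⟩ := eq_zero_or_succ k
        · exact ⟨1, .inl (by rw [hA.out.add_zero])⟩
        · exact ⟨j, .inr (by rw [hA.out.add_add_one, num_succ_add])⟩) n

theorem num_not_eq_add_succ {m k : A.Num} : m ≠ m + k + 1 := by
  intro h
  have : 0 + m = (k + 1) + m := by
    rwa [num_zero_add, num_add_comm (k + 1), hA.out.add_add_one]
  exact hA.out.add_one_ne_zero _ (num_add_cancel m this).symm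

/-- The operations are those of the structure `A`. -/
instance : CommSemiring A.Num where
  toAdd := A.instAdd
  toMul := A.instMul
  toZero := A.instZero
  toOne := A.instOne
  add_assoc := num_add_assoc
  zero_add := num_zero_add
  add_zero := hA.out.add_zero
  add_comm := num_add_comm
  left_distrib := num_mul_add
  right_distrib a b c := by
    rw [num_mul_comm, num_mul_add, num_mul_comm a, num_mul_comm b]
  zero_mul := num_zero_mul
  mul_zero := hA.out.mul_zero
  mul_assoc := num_mul_assoc
  one_mul := num_one_mul
  mul_one a := by rw [num_mul_comm, num_one_mul]
  mul_comm := num_mul_comm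
  nsmul := nsmulRec

/-- The strict order is that of the structure `A`. -/
noncomputable instance : LinearOrder A.Num where
  toLT := A.instLT
  le a b := a < b ∨ a = b
  le_refl a := .inr rfl
  le_trans a b c := by
    rintro (h | rfl) (h' | rfl)
    · obtain ⟨k, rfl⟩ := num_lt_iff.1 h
      obtain ⟨l, rfl⟩ := num_lt_iff.1 h'
      exact .inl (num_lt_iff.2 ⟨k + l + 1, by ring⟩)
    all_goals tauto
  lt_iff_le_not_ge a b := by
    constructor
    · refine fun h => ⟨.inl h, ?_⟩
      obtain ⟨k, rfl⟩ := num_lt_iff.1 h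
      rintro (h | h)
      · obtain ⟨l, e⟩ := num_lt_iff.1 h
        exact num_not_eq_add_succ (k := k + l + 1) (e.trans (by ring))
      · exact num_not_eq_add_succ h.symm
    · tauto
  le_antisymm a b := by
    rintro (h | rfl) (h' | h')
    · obtain ⟨k, rfl⟩ := num_lt_iff.1 h
      obtain ⟨l, e⟩ := num_lt_iff.1 h'
      exact (num_not_eq_add_succ (k := k + l + 1) (e.trans (by ring))).elim
    all_goals simp_all
  le_total a b := by
    obtain ⟨k, rfl | rfl⟩ := num_total a b
    · obtain rfl | ⟨j, rfl⟩ := eq_zero_or_succ k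
      · simp
      · exact .inl (.inl (num_lt_iff.2 ⟨j, by ring⟩))
    · obtain rfl | ⟨j, rfl⟩ := eq_zero_or_succ k
      · simp
      · exact .inr (.inl (num_lt_iff.2 ⟨j, by ring⟩))
  toDecidableLE := Classical.decRel _

theorem num_le_iff {m n : A.Num} : m ≤ n ↔ ∃ k, n = m + k := by
  constructor
  · rintro (h | rfl)
    · obtain ⟨k, rfl⟩ := num_lt_iff.1 h
      exact ⟨k + 1, by ring⟩
    · exact ⟨0, (add_zero _).symm⟩
  · rintro ⟨k, rfl⟩
    obtain rfl | ⟨j, rfl⟩ := eq_zero_or_succ k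
    · simp
    · exact .inl (num_lt_iff.2 ⟨j, by ring⟩)

instance : CanonicallyOrderedAdd A.Num where
  exists_add_of_le h := num_le_iff.1 h
  le_add_self a b := num_le_iff.2 ⟨b, add_comm _ _⟩
  le_self_add a b := num_le_iff.2 ⟨b, rfl⟩

instance : IsOrderedAddMonoid A.Num where
  add_le_add_left a b h c := by
    obtain ⟨k, rfl⟩ := num_le_iff.1 h
    exact num_le_iff.2 ⟨k, by ring⟩

theorem num_lt_succ {m n : A.Num} : m < n + 1 ↔ m ≤ n := hA.out.lt_add_one_iff m n

theorem num_succ_le {m n : A.Num} : m + 1 ≤ n ↔ m < n := by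
  rw [num_lt_iff, num_le_iff]
  exact exists_congr fun k => by rw [add_right_comm]

instance : IsStrictOrderedRing A.Num :=
  { (inferInstance : IsOrderedAddMonoid A.Num) with
    le_of_add_le_add_left := fun a b c h => by
      obtain ⟨k, e⟩ := num_le_iff.1 h
      exact num_le_iff.2 ⟨k, num_add_cancel a (by rw [add_comm c, e]; ring)⟩
    zero_le_one := zero_le
    exists_pair_ne := ⟨0, 1, fun h => hA.out.add_one_ne_zero 0 (by rw [zero_add, ← h])⟩
    mul_lt_mul_of_pos_left := fun a ha b c h => by
      obtain ⟨k, rfl⟩ := num_lt_iff.1 h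
      obtain ⟨l, rfl⟩ := num_lt_iff.1 ha
      exact num_lt_iff.2 ⟨l * k + l + k, by ring⟩
    mul_lt_mul_of_pos_right := fun a ha b c h => by
      obtain ⟨k, rfl⟩ := num_lt_iff.1 h
      obtain ⟨l, rfl⟩ := num_lt_iff.1 ha
      exact num_lt_iff.2 ⟨l * k + l + k, by ring⟩ }

end Bootstrap

end

section

variable {A : L2Structure.{u}} [hA : Fact A.ModelsRCA0]

/-! ### Pairs and numerals -/

theorem le_mul_self' (n : A.Num) : n ≤ n * n := by
  obtain rfl | ⟨m, rfl⟩ := eq_zero_or_succ n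
  · simp
  · exact num_le_iff.2 ⟨m * m + m, by ring⟩

theorem le_pair_left (i j : A.Num) : i ≤ A.pair i j := num_le_iff.2 ⟨_, add_comm _ _⟩

theorem le_pair_right (i j : A.Num) : j ≤ A.pair i j :=
  calc j ≤ i + j := num_le_iff.2 ⟨i, add_comm _ _⟩
    _ ≤ (i + j) * (i + j) := le_mul_self' _
    _ ≤ _ := num_le_iff.2 ⟨_, rfl⟩

theorem pair_lt_of_add_lt {i j k l : A.Num} (h : i + j < k + l) : A.pair i j < A.pair k l := by
  obtain ⟨m, hm⟩ := num_lt_iff.1 h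
  refine num_lt_iff.2 ⟨m * m + (2 * m + 1) * (i + j) + j + k + m + m, ?_⟩
  unfold pair
  rw [hm]
  ring

@[simp] theorem pair_inj {i j k l : A.Num} : A.pair i j = A.pair k l ↔ i = k ∧ j = l := by
  refine ⟨fun h => ?_, by rintro ⟨rfl, rfl⟩; rfl⟩
  have e : i + j = k + l := by
    by_contra hne
    obtain h' | h' := lt_or_gt_of_ne hne
    · exact (pair_lt_of_add_lt h').ne h
    · exact (pair_lt_of_add_lt h').ne' h
  unfold pair at h
  rw [e] at h
  obtain rfl := add_left_cancel h
  exact ⟨rfl, add_left_cancel e⟩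

theorem pair_le_pair {i j k l : A.Num} (h : i ≤ k) (h' : j ≤ l) : A.pair i j ≤ A.pair k l := by
  unfold pair
  gcongr

theorem numeral_eq_cast (k : ℕ) : A.numeral k = (k : A.Num) := by
  induction k with
  | zero => simp [numeral]
  | succ k ih => simp [numeral, ih]

@[simp] theorem numeral_inj {k l : ℕ} : A.numeral k = A.numeral l ↔ k = l := by
  simp [numeral_eq_cast]

/-! ### Comprehension -/

/-- Comprehension for bounded formulas. -/
theorem comprehension (P : ∀ A : L2Structure.{u}, (ℕ → Set A.Num) → (ℕ → A.Num) → A.Num → Prop)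
    [hP : D0 (fun A V v => P A V (fun i => v (i + 2)) (v 1))]
    {V : ℕ → Set A.Num} (hV : ∀ i, V i ∈ A.Sets) (w : ℕ → A.Num) :
    {n | P A V w n} ∈ A.Sets := by
  obtain ⟨θ, hθ⟩ := hP
  have key : ∀ n x, P A V w n ↔ θ.Holds A V (pushVar x (pushVar n w)) :=
    fun n x => hθ A V (pushVar x (pushVar n w))
  obtain ⟨X, hX, h⟩ := hA.out.delta_comprehension θ θ w V hV
    (fun n => by simp only [← key, exists_const, forall_const])
  simp only [← key, exists_const] at h
  convert hX using 1
  ext n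
  exact (h n).symm

theorem comprehension₁ (P : ∀ A : L2Structure.{u}, Set A.Num → A.Num → A.Num → Prop)
    [hP : D0 (fun A V v => P A (V 0) (v 2) (v 1))]
    {X : Set A.Num} (hX : X ∈ A.Sets) (a : A.Num) :
    {n | P A X a n} ∈ A.Sets :=
  comprehension (fun A V w n => P A (V 0) (w 0) n) (V := fun _ => X) (fun _ => hX) (fun _ => a)

theorem comprehension₂ (P : ∀ A : L2Structure.{u}, Set A.Num → Set A.Num → A.Num → Prop)
    [hP : D0 (fun A V v => P A (V 0) (V 1) (v 1))]
    {X Y : Set A.Num} (hX : X ∈ A.Sets) (hY : Y ∈ A.Sets) :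
    {n | P A X Y n} ∈ A.Sets :=
  comprehension (fun A V w n => P A (V 0) (V 1) n) (V := pushVar X (fun _ => Y))
    (by rintro (_ | _); exacts [hX, hY]) (fun _ => 0)

theorem set_induction {X : Set A.Num} (hX : X ∈ A.Sets) (h0 : 0 ∈ X)
    (hs : ∀ n, n ∈ X → n + 1 ∈ X) (n : A.Num) : n ∈ X :=
  delta_induction (fun A V w n => n ∈ V 0) (V := fun _ => X) (fun _ => hX) (fun _ => 0) h0 hs n

/-! ### Codes of finite sets -/

/-- `b` is invertible modulo `a`. This existential form of coprimality avoids subtraction. -/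
def UnitMod (a b : A.Num) : Prop := ∃ v u, b * v = a * u + 1

theorem UnitMod.mul {a b c : A.Num} (hb : UnitMod a b) (hc : UnitMod a c) : UnitMod a (b * c) := by
  obtain ⟨v, u, h⟩ := hb
  obtain ⟨v', u', h'⟩ := hc
  refine ⟨v * v', a * u * u' + u + u', ?_⟩
  calc b * c * (v * v') = (b * v) * (c * v') := by ring
    _ = _ := by rw [h, h']; ring

theorem not_dvd_of_unitMod {a b : A.Num} (ha : 1 < a) (hb : UnitMod a b) : ¬ a ∣ b := by
  rintro ⟨q, rfl⟩
  obtain ⟨v, u, h⟩ := hb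
  obtain ⟨k, hk | hk⟩ := num_total (q * v) u
  · rw [hk] at h
    have : a * q * v < a * (q * v + k) + 1 := num_lt_iff.2 ⟨a * k, by ring⟩
    exact this.ne h
  · have h1 : a * u + a * k = a * u + 1 := by rw [← h, mul_assoc, hk]; ring
    have h2 := add_left_cancel h1
    obtain rfl | ⟨l, rfl⟩ := eq_zero_or_succ k
    · simp at h2
    · have : a ≤ a * (l + 1) := num_le_iff.2 ⟨a * l, by ring⟩
      exact (ha.trans_le (h2 ▸ this)).ne rfl

theorem unitMod_of_neg {a b v u : A.Num} (ha : 1 < a) (h : b * v + 1 = a * u) : UnitMod a b := by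
  obtain e | ⟨w, hw⟩ := eq_zero_or_succ (b * v)
  · rw [e, zero_add] at h
    exact (not_dvd_of_unitMod ha ⟨1, 0, by simp⟩ ⟨u, h⟩).elim
  · refine ⟨v * (b * v), u * w, ?_⟩
    calc b * (v * (b * v)) = (b * v + 1) * w + 1 := by rw [hw, ← mul_assoc, hw]; ring
      _ = _ := by rw [h]; ring

/-- The moduli `m * (i + 1) + 1` and `m * (j + 1) + 1` are coprime if `j - i` divides `m`. -/
theorem unitMod_aux {a b m d t i : A.Num} (hm : m ≠ 0) (ha : a = m * (i + 1) + 1)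
    (hd : m = d * t) (h : b = a + m * d ∨ a = b + m * d) : UnitMod a b := by
  obtain ⟨f, hf⟩ : ∃ f, m * (i + 1) = f + 1 :=
    (eq_zero_or_succ _).resolve_left (mul_ne_zero hm (hA.out.add_one_ne_zero i))
  have ha1 : 1 < a := num_lt_iff.2 ⟨f, by rw [ha, hf]; ring⟩
  have key : m * d * (t * ((i + 1) * (i + 1))) = a * f + 1 := by
    calc m * d * (t * ((i + 1) * (i + 1))) = (m * (i + 1)) * ((d * t) * (i + 1)) := by ring
      _ = _ := by rw [← hd, ha, hf]; ring
  obtain h | h := h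
  · refine ⟨t * ((i + 1) * (i + 1)), t * ((i + 1) * (i + 1)) + f, ?_⟩
    rw [h, add_mul, key]
    ring
  · have e : a * (t * ((i + 1) * (i + 1))) = b * (t * ((i + 1) * (i + 1))) + (a * f + 1) := by
      rw [← key, ← add_mul, ← h]
    obtain ⟨z, hz⟩ : ∃ z, t * ((i + 1) * (i + 1)) = f + z := by
      refine num_le_iff.1 (le_of_mul_le_mul_left (a := a) ?_ (zero_lt_one.trans ha1))
      rw [e]
      exact num_le_iff.2 ⟨b * (t * ((i + 1) * (i + 1))) + 1, by ring⟩
    refine unitMod_of_neg (v := t * ((i + 1) * (i + 1))) (u := z) ha1 ?_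
    refine add_left_cancel (a := a * f) ?_
    calc _ = a * (t * ((i + 1) * (i + 1))) := by rw [e]; ring
      _ = _ := by rw [hz]; ring

/-- A common multiple of the numbers up to `k`, in place of the factorial. -/
theorem exists_multiple (k : A.Num) : ∃ m : A.Num, m ≠ 0 ∧ ∀ d, d < k → d + 1 ∣ m := by
  obtain ⟨m, hm⟩ := sigma_induction₂ (A := A) (fun A _ _ k m => m ≠ 0 ∧
    ∀ d, d < k → ∃ q, q < m + 1 ∧ m = (d + 1) * q) 0 0
    ⟨1, hA.out.add_one_ne_zero 0 ∘ by simp, fun d h => (hA.out.not_lt_zero d h).elim⟩ (by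
      rintro n ⟨m, h0, h⟩
      refine ⟨m * (n + 1), mul_ne_zero h0 (hA.out.add_one_ne_zero _), fun d hd => ?_⟩
      obtain hd | rfl := (hA.out.lt_add_one_iff _ _).1 hd
      · obtain ⟨q, -, e⟩ := h d hd
        refine ⟨q * (n + 1), num_lt_succ.2 (num_le_iff.2 ⟨d * (q * (n + 1)), ?_⟩), ?_⟩ <;>
        · rw [e]; ring
      · exact ⟨m, num_lt_succ.2 (num_le_iff.2 ⟨m * d, by ring⟩), mul_comm _ _⟩) k
  exact ⟨m, hm.1, fun d hd => let ⟨q, _, e⟩ := hm.2 d hd; ⟨q, e⟩⟩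

theorem exists_div_mod (a b : A.Num) (ha : 0 < a) : ∃ q r, r < a ∧ b = a * q + r := by
  obtain ⟨q, r, h, e⟩ := sigma_induction₂ (A := A) (fun A a _ b q => ∃ r, r < a ∧ b = a * q + r) a 0
    ⟨0, 0, ha, by simp⟩ (by
      rintro n ⟨q, r, h, e⟩
      obtain h' | h' := (num_succ_le.2 h).lt_or_eq
      · exact ⟨q, r + 1, h', by rw [e]; ring⟩
      · exact ⟨q + 1, 0, ha, by rw [e]; linear_combination h'⟩) b
  exact ⟨q, r, h, e⟩

/-- The witnesses can be bounded, so that coprimality is a bounded formula. -/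
theorem UnitMod.bounded {a b : A.Num} (ha : 1 < a) (h : UnitMod a b) :
    ∃ v, v < a ∧ ∃ u, u < b * a + 1 ∧ b * v = a * u + 1 := by
  obtain ⟨v, u, h⟩ := h
  have ha0 := zero_lt_one.trans ha
  obtain ⟨q, r, hr, rfl⟩ := exists_div_mod a v ha0
  have h1 : a * (b * q) ≤ a * u := by
    by_contra! hlt
    obtain ⟨k, hk⟩ := num_lt_iff.1 (lt_of_mul_lt_mul_left hlt (zero_le))
    have : a * u + 1 < b * (a * q + r) := by
      calc a * u + 1 < a * u + a := by gcongr
        _ ≤ _ := num_le_iff.2 ⟨a * k + b * r, by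
          calc b * (a * q + r) = a * (b * q) + b * r := by ring
            _ = _ := by rw [hk]; ring⟩
    exact this.ne' h
  obtain ⟨u', rfl⟩ := num_le_iff.1 (le_of_mul_le_mul_left h1 ha0)
  have e : b * r = a * u' + 1 := by
    refine add_left_cancel (a := a * (b * q)) ?_
    calc _ = b * (a * q + r) := by ring
      _ = _ := by rw [h]; ring
  refine ⟨r, hr, u', num_lt_succ.2 ?_, e⟩
  calc u' ≤ a * u' + 1 := by
        obtain ⟨k, rfl⟩ := num_lt_iff.1 ha0
        exact num_le_iff.2 ⟨k * u' + 1, by ring⟩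
    _ = b * r := e.symm
    _ ≤ b * a := by gcongr

/-- Every bounded part of a set of `A` has a code. The code is built by `Σ⁰₁` induction on `j`: the
number `n` at stage `j` is divisible by the moduli of the elements below `j` and coprime to all
other moduli. -/
theorem exists_code {S : Set A.Num} (hS : S ∈ A.Sets) (k : A.Num) :
    ∃ c, ∀ i, A.FinMem i c ↔ i < k ∧ i ∈ S := by
  obtain ⟨m, hm0, hm⟩ := exists_multiple k
  have h1 : ∀ i : A.Num, 1 < m * (i + 1) + 1 := by
    intro i
    obtain ⟨f, hf⟩ := (eq_zero_or_succ _).resolve_left (mul_ne_zero hm0 (hA.out.add_one_ne_zero i))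
    rw [hf]
    exact num_lt_iff.2 ⟨f, by ring⟩
  have hu : ∀ i j, i < k → j < k → i ≠ j → UnitMod (m * (i + 1) + 1) (m * (j + 1) + 1) := by
    intro i j hi hj hij
    obtain h | h := lt_or_gt_of_ne hij
    · obtain ⟨d, rfl⟩ := num_lt_iff.1 h
      obtain ⟨t, ht⟩ := hm d (lt_of_le_of_lt (num_le_iff.2 ⟨i + 1, by ring⟩) hj)
      exact unitMod_aux hm0 rfl ht (.inl (by ring))
    · obtain ⟨d, rfl⟩ := num_lt_iff.1 h
      obtain ⟨t, ht⟩ := hm d (lt_of_le_of_lt (num_le_iff.2 ⟨j + 1, by ring⟩) hi)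
      exact unitMod_aux hm0 rfl ht (.inr (by ring))
  obtain ⟨n, hn⟩ := sigma_induction (A := A) (fun A V w j n => ∀ i, i < w 0 →
      (i < j ∧ i ∈ V 0 → ∃ q, q < n + 1 ∧ n = (w 1 * (i + 1) + 1) * q) ∧
      (¬ (i < j ∧ i ∈ V 0) → ∃ v, v < w 1 * (i + 1) + 1 ∧ ∃ u, u < n * (w 1 * (i + 1) + 1) + 1 ∧
        n * v = (w 1 * (i + 1) + 1) * u + 1)) (V := fun _ => S) (fun _ => hS)
      (pushVar k (fun _ => m)) ⟨1, fun i hi => ⟨fun h => (hA.out.not_lt_zero _ h.1).elim, fun _ =>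
        UnitMod.bounded (h1 i) ⟨1, 0, by simp⟩⟩⟩ (by
      rintro j ⟨n, hn⟩
      change ∀ i, i < k → (i < j ∧ i ∈ S → _) ∧ (¬ (i < j ∧ i ∈ S) → _) at hn
      by_cases hj : j ∈ S ∧ j < k
      · refine ⟨n * (m * (j + 1) + 1), fun i hi => ⟨?_, ?_⟩⟩
        · rintro ⟨hij, hiS⟩
          obtain ⟨q, e⟩ : (m * (i + 1) + 1) ∣ n * (m * (j + 1) + 1) := by
            obtain hij | rfl := (hA.out.lt_add_one_iff _ _).1 hij
            · obtain ⟨q, -, e⟩ := (hn i hi).1 ⟨hij, hiS⟩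
              exact (Dvd.intro q e.symm).mul_right _
            · exact dvd_mul_left _ _
          refine ⟨q, num_lt_succ.2 ?_, e⟩
          rw [e]
          exact num_le_iff.2 ⟨m * (i + 1) * q, by ring⟩
        · intro hi'
          have hne : i ≠ j := fun e => hi' ⟨e ▸ (hA.out.lt_add_one_iff _ _).2 (.inr rfl), e ▸ hj.1⟩
          obtain ⟨v, -, u, -, e⟩ := (hn i hi).2 fun h =>
            hi' ⟨(hA.out.lt_add_one_iff _ _).2 (.inl h.1), h.2⟩
          exact UnitMod.bounded (h1 i) (UnitMod.mul ⟨v, u, e⟩ (hu i j hi hj.2 hne))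
      · refine ⟨n, fun i hi => ?_⟩
        have : (i < j + 1 ∧ i ∈ S) ↔ (i < j ∧ i ∈ S) := by
          refine and_congr_left fun hiS => ⟨fun h => ?_, fun h => (hA.out.lt_add_one_iff _ _).2 (.inl h)⟩
          obtain h | rfl := (hA.out.lt_add_one_iff _ _).1 h
          exacts [h, (hj ⟨hiS, hi⟩).elim]
        have := hn i hi
        simpa only [pushVar, this, ‹(i < j + 1 ∧ i ∈ S) ↔ _›] using this) k
  change ∀ i, i < k → (i < k ∧ i ∈ S → _) ∧ (¬ (i < k ∧ i ∈ S) → _) at hn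
  refine ⟨A.pair k (A.pair m n), fun i => ⟨?_, ?_⟩⟩
  · rintro ⟨k', m', n', e, hi, hd⟩
    obtain ⟨rfl, rfl, rfl⟩ : k = k' ∧ m = m' ∧ n = n' := by simpa using e
    refine ⟨hi, by_contra fun hiS => ?_⟩
    obtain ⟨v, -, u, -, e⟩ := (hn i hi).2 fun h => hiS h.2
    exact not_dvd_of_unitMod (h1 i) ⟨v, u, e⟩ hd
  · rintro ⟨hi, hiS⟩
    obtain ⟨q, -, e⟩ := (hn i hi).1 ⟨hi, hiS⟩
    exact ⟨k, m, n, rfl, hi, q, e⟩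

theorem FinMem.lt {i c : A.Num} (h : A.FinMem i c) : i < c := by
  obtain ⟨k, m, n, rfl, h, -⟩ := h
  exact h.trans_le (le_pair_left _ _)

end

section

/-! ### Program constructors -/

/-- The program with constant output `c`. -/
def cst (A : L2Structure.{u}) (c : A.Num) : A.Num := A.pair (A.numeral 0) c
/-- The identity program. -/
def idp (A : L2Structure.{u}) : A.Num := A.pair (A.numeral 1) 0
/-- The successor program. -/
def sucp (A : L2Structure.{u}) : A.Num := A.pair (A.numeral 2) 0
/-- The first projection of pairs. -/
def fstp (A : L2Structure.{u}) : A.Num := A.pair (A.numeral 3) 0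
/-- The second projection of pairs. -/
def sndp (A : L2Structure.{u}) : A.Num := A.pair (A.numeral 4) 0
/-- The oracle program. -/
def orc (A : L2Structure.{u}) : A.Num := A.pair (A.numeral 5) 0
/-- The program whose output is the pair of the outputs of `f` and `g`. -/
def prp (A : L2Structure.{u}) (f g : A.Num) : A.Num := A.pair (A.numeral 6) (A.pair f g)
/-- The composition `f ∘ g`. -/
def cmp (A : L2Structure.{u}) (f g : A.Num) : A.Num := A.pair (A.numeral 7) (A.pair f g)
/-- Primitive recursion with initial value `f` and step `g`. -/
def prc (A : L2Structure.{u}) (f g : A.Num) : A.Num := A.pair (A.numeral 8) (A.pair f g)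
/-- Minimization of `f`. -/
def mup (A : L2Structure.{u}) (f : A.Num) : A.Num := A.pair (A.numeral 9) f

variable {A : L2Structure.{u}} [hA : Fact A.ModelsRCA0]

section Justified

variable {X : Set A.Num} {d r c x y f g : A.Num}

theorem justified_cst : A.Justified X d r (A.cst c) x y ↔ y = c := by
  simp [Justified, cst, eq_comm]

theorem justified_idp : A.Justified X d r A.idp x y ↔ y = x := by
  simp [Justified, idp]

theorem justified_sucp : A.Justified X d r A.sucp x y ↔ y = x + 1 := by
  simp [Justified, sucp]

theorem justified_fstp : A.Justified X d r A.fstp x y ↔ ∃ b, x = A.pair y b := by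
  simp [Justified, fstp]

theorem justified_sndp : A.Justified X d r A.sndp x y ↔ ∃ b, x = A.pair b y := by
  simp [Justified, sndp]

theorem justified_orc :
    A.Justified X d r A.orc x y ↔ (x ∈ X ∧ y = 1) ∨ (x ∉ X ∧ y = 0) := by
  simp [Justified, orc]

theorem justified_prp : A.Justified X d r (A.prp f g) x y ↔
    ∃ p q, A.ClaimBelow d r f x p ∧ A.ClaimBelow d r g x q ∧ y = A.pair p q := by
  simp [Justified, prp]

theorem justified_cmp : A.Justified X d r (A.cmp f g) x y ↔
    ∃ p, A.ClaimBelow d r g x p ∧ A.ClaimBelow d r f p y := by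
  simp [Justified, cmp]

theorem justified_prc : A.Justified X d r (A.prc f g) x y ↔
    (∃ b, x = A.pair b 0 ∧ A.ClaimBelow d r f b y) ∨
      ∃ b n p, x = A.pair b (n + 1) ∧ A.ClaimBelow d r (A.prc f g) (A.pair b n) p ∧
        A.ClaimBelow d r g (A.pair b (A.pair n p)) y := by
  simp [Justified, prc]

theorem justified_mup : A.Justified X d r (A.mup f) x y ↔
    A.ClaimBelow d r f (A.pair x y) 0 ∧
      ∀ z, z < y → ∃ p, p ≠ 0 ∧ A.ClaimBelow d r f (A.pair x z) p := by
  simp [Justified, mup]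

end Justified

/-- The finite set `D_d` of ranked claims is a computation with oracle `X`. -/
def Valid (A : L2Structure.{u}) (X : Set A.Num) (d : A.Num) : Prop :=
  ∀ r e x y, A.FinMem (A.pair r (A.pair e (A.pair x y))) d → A.Justified X d r e x y

theorem computes_iff {X : Set A.Num} {e x y : A.Num} :
    A.Computes X e x y ↔ ∃ d, A.Valid X d ∧ ∃ r, A.ClaimBelow d r e x y := by
  constructor
  · rintro ⟨s, d, -, hd, r, h⟩
    exact ⟨d, hd, r + 1, r, (hA.out.lt_add_one_iff _ _).2 (.inr rfl), h⟩
  · rintro ⟨d, hd, r, r', -, h⟩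
    exact ⟨d + 1, d, (hA.out.lt_add_one_iff _ _).2 (.inr rfl), hd, r', h⟩

theorem Valid.justified {X : Set A.Num} {d r e x y : A.Num} (hd : A.Valid X d)
    (h : A.ClaimBelow d r e x y) : ∃ r, A.Justified X d r e x y :=
  let ⟨r', _, h⟩ := h
  ⟨r', hd _ _ _ _ h⟩

/-- The program that searches, on any input, for some `z` with `(n, z) ∉ X`. -/
def searchp (A : L2Structure.{u}) (n : A.Num) : A.Num := A.cmp (A.mup A.orc) (A.cst n)

/-- The computation is written down explicitly, which needs no induction beyond `Σ⁰₁`. -/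
theorem searchp_halts_iff {X : Set A.Num} (hX : X ∈ A.Sets) (n x : A.Num) :
    (∃ y, A.Computes X (A.searchp n) x y) ↔ ∃ z, A.pair n z ∉ X := by
  constructor
  · rintro ⟨y, h⟩
    obtain ⟨d, hd, r, h⟩ := computes_iff.1 h
    obtain ⟨_, h₁⟩ := hd.justified h
    obtain ⟨p, h₂, h₃⟩ := justified_cmp.1 h₁
    obtain ⟨_, h₄⟩ := hd.justified h₂
    obtain rfl := justified_cst.1 h₄
    obtain ⟨_, h₅⟩ := hd.justified h₃
    obtain ⟨_, h₆⟩ := hd.justified (justified_mup.1 h₅).1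
    exact ⟨y, by simpa using justified_orc.1 h₆⟩
  · rintro ⟨z, hz⟩
    -- the least such `z`
    obtain ⟨y, hy, hmin⟩ : ∃ y, A.pair n y ∉ X ∧ ∀ z, z < y → A.pair n z ∈ X := by
      by_contra! hcon
      have := delta_induction (A := A) (fun A V w k => ∀ z, z < k → A.pair (w 0) z ∈ V 0)
        (V := fun _ => X) (fun _ => hX) (fun _ => n) (fun z h => (hA.out.not_lt_zero _ h).elim)
        (fun k ih z hzk => by
          obtain h | rfl := (hA.out.lt_add_one_iff _ _).1 hzk
          · exact ih z h
          · by_contra hz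
            obtain ⟨z', h1, h2⟩ := hcon z hz
            exact h2 (ih z' h1)) (z + 1)
      exact hz (this z (num_lt_succ.2 le_rfl))
    -- the claims of the computation, of ranks `0`, `1` and `2`
    have hS := comprehension (A := A) (fun A V w i =>
      (∃ z, z < w 1 ∧ i = A.pair 0 (A.pair (w 3) (A.pair (A.pair (w 0) z) 1))) ∨
      i = A.pair 0 (A.pair (w 3) (A.pair (A.pair (w 0) (w 1)) 0)) ∨
      i = A.pair 0 (A.pair (w 4) (A.pair (w 2) (w 0))) ∨
      i = A.pair 1 (A.pair (w 5) (A.pair (w 0) (w 1))) ∨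
      i = A.pair (1 + 1) (A.pair (w 6) (A.pair (w 2) (w 1)))) (V := fun _ => X) (fun _ => hX)
      (pushVar n (pushVar y (pushVar x (pushVar A.orc (pushVar (A.cst n)
        (pushVar (A.mup A.orc) (fun _ => A.searchp n)))))))
    simp only [pushVar] at hS
    obtain ⟨d, hc⟩ := exists_code hS
      (A.pair 0 (A.pair A.orc (A.pair (A.pair n y) 1)) + A.pair 0 (A.pair A.orc (A.pair (A.pair n y) 0))
        + A.pair 0 (A.pair (A.cst n) (A.pair x n)) + A.pair 1 (A.pair (A.mup A.orc) (A.pair n y))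
        + A.pair (1 + 1) (A.pair (A.searchp n) (A.pair x y)) + 1)
    have hd : ∀ i, A.FinMem i d ↔
        (∃ z, z < y ∧ i = A.pair 0 (A.pair A.orc (A.pair (A.pair n z) 1))) ∨
        i = A.pair 0 (A.pair A.orc (A.pair (A.pair n y) 0)) ∨
        i = A.pair 0 (A.pair (A.cst n) (A.pair x n)) ∨
        i = A.pair 1 (A.pair (A.mup A.orc) (A.pair n y)) ∨
        i = A.pair (1 + 1) (A.pair (A.searchp n) (A.pair x y)) := by
      refine fun i => (hc i).trans (and_iff_right_of_imp fun h => num_lt_succ.2 ?_)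
      obtain ⟨z, hz, rfl⟩ | rfl | rfl | rfl | rfl := h
      · have := pair_le_pair (le_refl (0 : A.Num)) (pair_le_pair (le_refl A.orc)
          (pair_le_pair (pair_le_pair (le_refl n) hz.le) (le_refl 1)))
        exact le_add_right (le_add_right (le_add_right (le_add_right this)))
      · exact le_add_right (le_add_right (le_add_right le_add_self))
      · exact le_add_right (le_add_right le_add_self)
      · exact le_add_right le_add_self
      · exact le_add_self
    have c0 : ∀ z, z < y → A.ClaimBelow d 1 A.orc (A.pair n z) 1 := fun z hz =>
      ⟨0, zero_lt_one, (hd _).2 (.inl ⟨z, hz, rfl⟩)⟩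
    have c1 : A.ClaimBelow d 1 A.orc (A.pair n y) 0 :=
      ⟨0, zero_lt_one, (hd _).2 (.inr (.inl rfl))⟩
    have c2 : A.ClaimBelow d (1 + 1) (A.cst n) x n :=
      ⟨0, num_lt_succ.2 (zero_le), (hd _).2 (.inr (.inr (.inl rfl)))⟩
    have c3 : A.ClaimBelow d (1 + 1) (A.mup A.orc) n y :=
      ⟨1, num_lt_succ.2 le_rfl, (hd _).2 (.inr (.inr (.inr (.inl rfl))))⟩
    refine ⟨y, computes_iff.2 ⟨d, fun r e' x' y' h => ?_, 1 + 1 + 1, 1 + 1, num_lt_succ.2 le_rfl,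
      (hd _).2 (.inr (.inr (.inr (.inr rfl))))⟩⟩
    obtain ⟨z, hz, h⟩ | h | h | h | h := (hd _).1 h <;> simp only [pair_inj] at h <;>
      obtain ⟨rfl, rfl, rfl, rfl⟩ := h
    · exact justified_orc.2 (.inl ⟨hmin z hz, rfl⟩)
    · exact justified_orc.2 (.inr ⟨hy, rfl⟩)
    · exact justified_cst.2 rfl
    · exact justified_mup.2 ⟨c1, fun z hz => ⟨1, one_ne_zero, c0 z hz⟩⟩
    · exact justified_cmp.2 ⟨n, c2, c3⟩

/-! ### Arithmetical comprehension -/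

variable [hJ : Fact A.OmegaJumpClosed]

theorem sect_mem {Z : Set A.Num} (hZ : Z ∈ A.Sets) (i : A.Num) : A.sect Z i ∈ A.Sets :=
  comprehension₁ (fun A Z i j => A.pair i j ∈ Z) hZ i

theorem exists_jump {X : Set A.Num} (hX : X ∈ A.Sets) : ∃ Y ∈ A.Sets, A.IsJump X Y := by
  obtain ⟨Y, hY, -, h⟩ := hJ.out X hX
  obtain ⟨Z, hZ, rfl, hs, -⟩ := h 1
  exact ⟨_, sect_mem hZ _, hs 0 zero_lt_one⟩

/-- Projections exist: `∃ x, (n, x) ∈ X` holds if and only if the search for such an `x` halts, and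
the program for this search is a polynomial in `n`. -/
theorem projection_mem {X : Set A.Num} (hX : X ∈ A.Sets) : {n | ∃ x, A.pair n x ∈ X} ∈ A.Sets := by
  have hc := comprehension₁ (fun A X _ n => n ∉ X) hX 0
  obtain ⟨Y, hY, h⟩ := exists_jump hc
  have := comprehension (A := A) (fun A V w n => A.pair (w 0) (A.pair (A.pair (w 1) (w 2))
    (A.pair (w 3) n)) ∈ V 0) (V := fun _ => Y) (fun _ => hY)
    (pushVar (A.numeral 7) (pushVar (A.numeral 9) (pushVar A.orc (fun _ => A.numeral 0))))
  convert this using 1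
  ext n
  refine Iff.trans ?_ (h (A.searchp n)).symm
  rw [searchp_halts_iff hc]
  simp

theorem sigma_comprehension (P : ∀ A : L2Structure.{u}, (ℕ → Set A.Num) → A.Num → A.Num → Prop)
    [hP : D0 (fun A V v => P A V (v 1) (v 0))]
    {V : ℕ → Set A.Num} (hV : ∀ i, V i ∈ A.Sets) :
    {n | ∃ x, P A V n x} ∈ A.Sets := by
  obtain ⟨θ, hθ⟩ := hP
  have : D0.{u} (fun A V v => P A V (v 1) (v 0)) := ⟨θ, hθ⟩
  have key := comprehension (A := A) (fun A V _ z => ∃ n, n < z + 1 ∧ ∃ x, x < z + 1 ∧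
    z = A.pair n x ∧ P A V n x) hV (fun _ => 0)
  convert projection_mem key using 1
  ext n
  refine exists_congr fun x => ⟨fun h => ⟨n, ?_, x, ?_, rfl, h⟩, ?_⟩
  · exact num_lt_succ.2 (le_pair_left _ _)
  · exact num_lt_succ.2 (le_pair_right _ _)
  · rintro ⟨n', -, x', -, e, h⟩
    obtain ⟨rfl, rfl⟩ := pair_inj.1 e
    exact h

end

section

/-! ### Arithmetical predicates -/

/-- Types (in practice: iterated products of the number sort) whose elements are coded by numbers
of `A`, in such a way that the codes form a set of `A`. -/
class Coded (A : L2Structure.{u}) (α : Type u) where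
  code : α → A.Num
  inj : Function.Injective code
  range_mem : Set.range code ∈ A.Sets

/-- `P` is arithmetical with parameters in `A`: the codes of the elements with property `P` form a
set of `A`. -/
class Ar (A : L2Structure.{u}) {α : Type u} [Coded A α] (P : α → Prop) : Prop where
  out : {z | ∃ a, z = Coded.code (A := A) a ∧ P a} ∈ A.Sets

/-- The function `f` has an arithmetical graph, with parameters in `A`. -/
class ArF (A : L2Structure.{u}) {α β : Type u} [Coded A α] [Coded A β] (f : α → β) : Prop where
  out : {z | ∃ a, z = A.pair (Coded.code a) (Coded.code (f a))} ∈ A.Sets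

variable {A : L2Structure.{u}} [hA : Fact A.ModelsRCA0]

open Coded

instance : Coded A A.Num where
  code := id
  inj := Function.injective_id
  range_mem := by
    obtain ⟨X, hX⟩ := A.sets_nonempty
    convert comprehension₁ (fun A X _ n => n = n) hX 0 using 1
    simp

instance {α β : Type u} [Coded A α] [Coded A β] : Coded A (α × β) where
  code p := A.pair (code p.1) (code p.2)
  inj p q h := by
    obtain ⟨h₁, h₂⟩ := pair_inj.1 h
    exact Prod.ext (Coded.inj h₁) (Coded.inj h₂)
  range_mem := by
    convert comprehension₂ (fun A X Y n => ∃ x, x < n + 1 ∧ ∃ y, y < n + 1 ∧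
      n = A.pair x y ∧ x ∈ X ∧ y ∈ Y) (Coded.range_mem (A := A) (α := α))
      (Coded.range_mem (A := A) (α := β)) using 1
    ext n
    constructor
    · rintro ⟨⟨a, b⟩, rfl⟩
      exact ⟨_, num_lt_succ.2 (le_pair_left _ _), _, num_lt_succ.2 (le_pair_right _ _), rfl,
        ⟨a, rfl⟩, ⟨b, rfl⟩⟩
    · rintro ⟨_, -, _, -, rfl, ⟨a, rfl⟩, ⟨b, rfl⟩⟩
      exact ⟨(a, b), rfl⟩

@[simp] theorem code_inj {α : Type u} [Coded A α] {a b : α} :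
    code (A := A) a = code (A := A) b ↔ a = b := Coded.inj.eq_iff

variable {α β γ : Type u} [Coded A α] [Coded A β] [Coded A γ] {P Q : α → Prop}

/-! The instances below find the proof that a predicate written in the usual way is arithmetical. -/

theorem Ar.congr (h : ∀ a, P a ↔ Q a) [hQ : Ar A Q] : Ar A P := by
  rwa [show P = Q from funext fun a => propext (h a)]

theorem ar_of_mem {X : Set A.Num} (hX : X ∈ A.Sets) (h : ∀ a, P a ↔ code a ∈ X) : Ar A P := by
  refine ⟨?_⟩
  convert comprehension₂ (fun A X Y n => n ∈ X ∧ n ∈ Y) hX (range_mem (A := A) (α := α)) using 1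
  ext n
  constructor
  · rintro ⟨a, rfl, ha⟩
    exact ⟨(h a).1 ha, a, rfl⟩
  · rintro ⟨ha, a, rfl⟩
    exact ⟨a, rfl, (h a).2 ha⟩

theorem Ar.exists_mem (P : α → Prop) [hP : Ar A P] : ∃ X ∈ A.Sets, ∀ a, P a ↔ code a ∈ X :=
  ⟨_, hP.out, fun a => ⟨fun h => ⟨a, rfl, h⟩, fun ⟨_, e, h⟩ => code_inj.1 e ▸ h⟩⟩

theorem Ar.setOf_mem (P : A.Num → Prop) [hP : Ar A P] : {n | P n} ∈ A.Sets := by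
  obtain ⟨X, hX, h⟩ := hP.exists_mem
  rwa [show {n | P n} = X from Set.ext h]

theorem Ar.mem_set {X : Set A.Num} (hX : X ∈ A.Sets) : Ar A (fun n => n ∈ X) :=
  ar_of_mem hX fun _ => Iff.rfl

instance Ar.not [hP : Ar A P] : Ar A (fun a => ¬ P a) := by
  obtain ⟨X, hX, h⟩ := hP.exists_mem
  exact ar_of_mem (comprehension₁ (fun A X _ n => n ∉ X) hX 0) fun a => not_congr (h a)

instance Ar.and [hP : Ar A P] [hQ : Ar A Q] : Ar A (fun a => P a ∧ Q a) := by
  obtain ⟨X, hX, h⟩ := hP.exists_mem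
  obtain ⟨Y, hY, h'⟩ := hQ.exists_mem
  exact ar_of_mem (comprehension₂ (fun A X Y n => n ∈ X ∧ n ∈ Y) hX hY)
    fun a => and_congr (h a) (h' a)

instance Ar.imp [hP : Ar A P] [hQ : Ar A Q] : Ar A (fun a => P a → Q a) :=
  Ar.congr (Q := fun a => ¬ (P a ∧ ¬ Q a)) (by intros; tauto)

instance Ar.or [hP : Ar A P] [hQ : Ar A Q] : Ar A (fun a => P a ∨ Q a) :=
  Ar.congr (Q := fun a => ¬ (¬ P a ∧ ¬ Q a)) (by intros; tauto)

instance Ar.iff [hP : Ar A P] [hQ : Ar A Q] : Ar A (fun a => (P a ↔ Q a)) :=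
  Ar.congr (Q := fun a => (P a → Q a) ∧ (Q a → P a)) (by intros; tauto)

instance ArF.id : ArF A (fun a : α => a) := by
  refine ⟨?_⟩
  convert comprehension₁ (fun A X _ n => ∃ x, x < n + 1 ∧ n = A.pair x x ∧ x ∈ X)
    (range_mem (A := A) (α := α)) 0 using 1
  ext n
  constructor
  · rintro ⟨a, rfl⟩
    exact ⟨_, num_lt_succ.2 (le_pair_left _ _), rfl, a, rfl⟩
  · rintro ⟨_, -, rfl, a, rfl⟩
    exact ⟨a, rfl⟩

theorem ArF.const (b : β) : ArF A (fun _ : α => b) := by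
  refine ⟨?_⟩
  convert comprehension₁ (fun A X b n => ∃ x, x < n + 1 ∧ n = A.pair x b ∧ x ∈ X)
    (range_mem (A := A) (α := α)) (code b) using 1
  ext n
  constructor
  · rintro ⟨a, rfl⟩
    exact ⟨_, num_lt_succ.2 (le_pair_left _ _), rfl, a, rfl⟩
  · rintro ⟨_, -, rfl, a, rfl⟩
    exact ⟨a, rfl⟩

instance ArF.const_num (b : A.Num) : ArF A (fun _ : α => b) := .const b

theorem ArF.prodMk {f : α → β} {g : α → γ} [hf : ArF A f] [hg : ArF A g] :
    ArF A (fun a => (f a, g a)) := by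
  refine ⟨?_⟩
  convert comprehension₂ (fun A X Y n => ∃ x, x < n + 1 ∧ ∃ y, y < n + 1 ∧ ∃ z, z < n + 1 ∧
    n = A.pair x (A.pair y z) ∧ A.pair x y ∈ X ∧ A.pair x z ∈ Y) hf.out hg.out using 1
  ext n
  constructor
  · rintro ⟨a, rfl⟩
    exact ⟨_, num_lt_succ.2 (le_pair_left _ _),
      _, num_lt_succ.2 ((le_pair_left _ _).trans (le_pair_right _ _)),
      _, num_lt_succ.2 ((le_pair_right _ _).trans (le_pair_right _ _)), rfl, ⟨a, rfl⟩, ⟨a, rfl⟩⟩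
  · rintro ⟨_, -, _, -, _, -, rfl, ⟨a, e⟩, ⟨b, e'⟩⟩
    obtain ⟨rfl, rfl⟩ := pair_inj.1 e
    obtain ⟨h, rfl⟩ := pair_inj.1 e'
    obtain rfl := code_inj.1 h
    exact ⟨a, rfl⟩

instance ArF.fst' : ArF A (Prod.fst : α × β → α) := by
  refine ⟨?_⟩
  convert comprehension₁ (fun A X _ n => ∃ x, x < n + 1 ∧ ∃ y, y < n + 1 ∧
    n = A.pair (A.pair x y) x ∧ A.pair x y ∈ X) (range_mem (A := A) (α := α × β)) 0 using 1
  ext n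
  constructor
  · rintro ⟨a, rfl⟩
    exact ⟨_, num_lt_succ.2 ((le_pair_left _ _).trans (le_pair_left _ _)),
      _, num_lt_succ.2 ((le_pair_right _ _).trans (le_pair_left _ _)), rfl, a, rfl⟩
  · rintro ⟨_, -, _, -, rfl, a, e⟩
    obtain ⟨rfl, rfl⟩ := pair_inj.1 e
    exact ⟨a, rfl⟩

instance ArF.snd' : ArF A (Prod.snd : α × β → β) := by
  refine ⟨?_⟩
  convert comprehension₁ (fun A X _ n => ∃ x, x < n + 1 ∧ ∃ y, y < n + 1 ∧
    n = A.pair (A.pair x y) y ∧ A.pair x y ∈ X) (range_mem (A := A) (α := α × β)) 0 using 1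
  ext n
  constructor
  · rintro ⟨a, rfl⟩
    exact ⟨_, num_lt_succ.2 ((le_pair_left _ _).trans (le_pair_left _ _)),
      _, num_lt_succ.2 ((le_pair_right _ _).trans (le_pair_left _ _)), rfl, a, rfl⟩
  · rintro ⟨_, -, _, -, rfl, a, e⟩
    obtain ⟨rfl, rfl⟩ := pair_inj.1 e
    exact ⟨a, rfl⟩

variable [hJ : Fact A.OmegaJumpClosed]

instance Ar.ex {P : α → A.Num → Prop} [hP : Ar A (fun q : α × A.Num => P q.1 q.2)] :
    Ar A (fun a => ∃ x, P a x) := by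
  obtain ⟨X, hX, h⟩ := hP.exists_mem
  exact ar_of_mem (projection_mem hX) fun a => exists_congr fun x => h (a, x)

instance Ar.all {P : α → A.Num → Prop} [hP : Ar A (fun q : α × A.Num => P q.1 q.2)] :
    Ar A (fun a => ∀ x, P a x) :=
  Ar.congr (Q := fun a => ¬ ∃ x, ¬ P a x) (by intros; push Not; rfl)

theorem ArF.comp' (g : β → γ) (f : α → β) [hg : ArF A g] [hf : ArF A f] :
    ArF A (fun a => g (f a)) := by
  refine ⟨?_⟩
  convert sigma_comprehension (A := A) (fun A V n y => ∃ x, x < n + 1 ∧ ∃ z, z < n + 1 ∧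
    n = A.pair x z ∧ A.pair x y ∈ V 0 ∧ A.pair y z ∈ V 1)
    (V := pushVar _ (fun _ => _)) (by rintro (_ | _); exacts [hf.out, hg.out]) using 1
  ext n
  constructor
  · rintro ⟨a, rfl⟩
    exact ⟨_, _, num_lt_succ.2 (le_pair_left _ _), _, num_lt_succ.2 (le_pair_right _ _), rfl,
      ⟨a, rfl⟩, ⟨f a, rfl⟩⟩
  · rintro ⟨_, _, -, _, -, rfl, ⟨a, e⟩, ⟨b, e'⟩⟩
    obtain ⟨rfl, rfl⟩ := pair_inj.1 e
    obtain ⟨h, rfl⟩ := pair_inj.1 e'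
    obtain rfl := code_inj.1 h
    exact ⟨a, rfl⟩

theorem Ar.comp (P : β → Prop) (f : α → β) [hP : Ar A P] [hf : ArF A f] :
    Ar A (fun a => P (f a)) := by
  obtain ⟨X, hX, h⟩ := hP.exists_mem
  refine ar_of_mem (sigma_comprehension (A := A) (fun A V x y => A.pair x y ∈ V 0 ∧ y ∈ V 1)
    (V := pushVar _ (fun _ => X)) (by rintro (_ | _); exacts [hf.out, hX])) fun a => ?_
  rw [h]
  constructor
  · exact fun h => ⟨_, ⟨a, rfl⟩, h⟩
  · rintro ⟨_, ⟨b, e⟩, h⟩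
    obtain ⟨h', rfl⟩ := pair_inj.1 e
    obtain rfl := code_inj.1 h'
    exact h

theorem Ar.comp₂ (P : β → γ → Prop) (f : α → β) (g : α → γ)
    [hP : Ar A (fun p : β × γ => P p.1 p.2)] [hf : ArF A f] [hg : ArF A g] :
    Ar A (fun a => P (f a) (g a)) :=
  have := hf.prodMk (hg := hg)
  Ar.comp (fun p : β × γ => P p.1 p.2) (fun a => (f a, g a))

instance ArF.fst {f : α → β × γ} [hf : ArF A f] : ArF A (fun a => (f a).1) :=
  ArF.comp' Prod.fst f

instance ArF.snd {f : α → β × γ} [hf : ArF A f] : ArF A (fun a => (f a).2) :=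
  ArF.comp' Prod.snd f

theorem ArF.of_graph {f : α → A.Num} (h : Ar A (fun q : α × A.Num => q.2 = f q.1)) : ArF A f := by
  refine ⟨?_⟩
  convert h.out using 1
  ext n
  constructor
  · rintro ⟨a, rfl⟩
    exact ⟨(a, f a), rfl, rfl⟩
  · rintro ⟨⟨a, b⟩, rfl, rfl : b = f a⟩
    exact ⟨a, rfl⟩

/-- Relations between two numbers given by a bounded formula are arithmetical. -/
theorem ar_of_d0 (P : ∀ A : L2Structure.{u}, A.Num → A.Num → Prop)
    [D0 (fun A V v => P A (v 0) (v (0 + 1)))] {f g : α → A.Num} [ArF A f] [ArF A g] :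
    Ar A (fun a => P A (f a) (g a)) := by
  obtain ⟨X, hX⟩ := A.sets_nonempty
  have : Ar A (fun p : A.Num × A.Num => P A p.1 p.2) := by
    refine ar_of_mem (comprehension₁ (fun A _ _ n => ∃ y, y < n + 1 ∧ ∃ x, x < n + 1 ∧
      n = A.pair x y ∧ P A x y) hX 0) fun p => ?_
    constructor
    · exact fun h => ⟨_, num_lt_succ.2 (le_pair_right _ _), _, num_lt_succ.2 (le_pair_left _ _),
        rfl, h⟩
    · rintro ⟨_, -, _, -, e, h⟩
      obtain ⟨rfl, rfl⟩ := pair_inj.1 e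
      exact h
  exact Ar.comp₂ (fun x y => P A x y) f g

section Num
variable {f g : α → A.Num} [hf : ArF A f] [hg : ArF A g]

instance Ar.lt : Ar A (fun a => f a < g a) := ar_of_d0 (fun A x y => x < y)

instance Ar.eq : Ar A (fun a => f a = g a) := ar_of_d0 (fun A x y => x = y)

instance Ar.le : Ar A (fun a => f a ≤ g a) :=
  Ar.congr (Q := fun a => f a < g a ∨ f a = g a) fun _ => le_iff_lt_or_eq

instance Ar.mem (X : Set A.Num) [hX : Fact (X ∈ A.Sets)] : Ar A (fun a => f a ∈ X) :=
  have := Ar.mem_set hX.out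
  Ar.comp (fun n => n ∈ X) f

theorem arF_of_d0 (F : ∀ A : L2Structure.{u}, A.Num → A.Num → A.Num)
    [D0 (fun A V v => v 0 = F A (v (0 + 1)) (v (0 + 1 + 1)))] :
    ArF A (fun a => F A (f a) (g a)) := by
  obtain ⟨X, hX⟩ := A.sets_nonempty
  have : ArF A (fun p : A.Num × A.Num => F A p.1 p.2) := by
    refine .of_graph (ar_of_mem (comprehension₁ (fun A _ _ n => ∃ y, y < n + 1 ∧ ∃ x, x < n + 1 ∧
      ∃ z, z < n + 1 ∧ n = A.pair (A.pair x y) z ∧ z = F A x y) hX 0) fun p => ?_)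
    constructor
    · exact fun h => ⟨_, num_lt_succ.2 ((le_pair_right _ _).trans (le_pair_left _ _)),
        _, num_lt_succ.2 ((le_pair_left _ _).trans (le_pair_left _ _)),
        _, num_lt_succ.2 (le_pair_right _ _), rfl, h⟩
    · rintro ⟨_, -, _, -, _, -, e, h⟩
      obtain ⟨e₁, rfl⟩ := pair_inj.1 e
      obtain ⟨rfl, rfl⟩ := pair_inj.1 e₁
      exact h
  have := hf.prodMk (hg := hg)
  exact ArF.comp' (fun p : A.Num × A.Num => F A p.1 p.2) (fun a => (f a, g a))

instance ArF.add : ArF A (fun a => f a + g a) := arF_of_d0 (fun A x y => x + y)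

instance ArF.mul : ArF A (fun a => f a * g a) := arF_of_d0 (fun A x y => x * y)

instance ArF.pair : ArF A (fun a => A.pair (f a) (g a)) := arF_of_d0 (fun A x y => A.pair x y)

/- The following instances serve the eta-reduced forms of `fun y => x + y` and the like. -/
instance ArF.add_left (x : A.Num) : ArF A (HAdd.hAdd x : A.Num → A.Num) :=
  ArF.add (f := fun _ => x) (g := fun y => y)
instance ArF.mul_left (x : A.Num) : ArF A (HMul.hMul x : A.Num → A.Num) :=
  ArF.mul (f := fun _ => x) (g := fun y => y)
instance ArF.pair_left (x : A.Num) : ArF A (A.pair x) :=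
  ArF.pair (f := fun _ => x) (g := fun y => y)

instance Ar.mem_left (X : Set A.Num) [Fact (X ∈ A.Sets)] : Ar A (Membership.mem X) :=
  Ar.mem (f := fun y => y) X


instance Ar.finMem : Ar A (fun a => A.FinMem (f a) (g a)) := by
  have : Ar A (fun p : A.Num × A.Num => A.FinMem p.1 p.2) := by
    unfold FinMem; infer_instance
  exact Ar.comp₂ (fun x y => A.FinMem x y) f g

instance Ar.isFinCode : Ar A (fun a => A.IsFinCode (f a)) := by
  have : Ar A (fun p : A.Num => A.IsFinCode p) := by
    unfold IsFinCode; infer_instance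
  exact Ar.comp (fun p : A.Num => A.IsFinCode p) f

instance Ar.hasCard : Ar A (fun a => A.HasCard (f a) (g a)) := by
  have : Ar A (fun p : A.Num × A.Num => A.HasCard p.1 p.2) := by
    unfold HasCard ExistsUnique; infer_instance
  exact Ar.comp₂ (fun x y => A.HasCard x y) f g

end Num

/-! ### Induction, minimization and bounding -/

theorem ar_induction (P : A.Num → Prop) [Ar A P] (h0 : P 0) (hs : ∀ n, P n → P (n + 1)) (n : A.Num) :
    P n :=
  set_induction (Ar.setOf_mem P) h0 hs n

theorem ar_strong_induction (P : A.Num → Prop) [Ar A P] (h : ∀ n, (∀ m, m < n → P m) → P n)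
    (n : A.Num) : P n :=
  have := fun {β : Type u} [Coded A β] (f : β → A.Num) [hf : ArF A f] => Ar.comp (A := A) P f
  h n (ar_induction (fun n => ∀ m, m < n → P m) (fun m h => (hA.out.not_lt_zero _ h).elim)
    (fun n ih m hm => (num_lt_succ.1 hm).lt_or_eq.elim (ih m) fun e => e ▸ h n ih) n)

theorem exists_least (P : A.Num → Prop) [Ar A P] (h : ∃ n, P n) :
    ∃ n, P n ∧ ∀ m, m < n → ¬ P m := by
  by_contra! hcon
  obtain ⟨n, hn⟩ := h
  refine ar_strong_induction (fun n => ¬ P n) (fun n ih hn => ?_) n hn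
  obtain ⟨m, hm, h⟩ := hcon n hn
  exact ih m hm h

theorem exists_bound (P : A.Num → A.Num → Prop) [Ar A (fun p : A.Num × A.Num => P p.1 p.2)] (n : A.Num)
    (h : ∀ m, m < n → ∃ x, P m x) : ∃ b, ∀ m, m < n → ∃ x, x < b ∧ P m x := by
  have := fun {β : Type u} [Coded A β] (f g : β → A.Num) [hf : ArF A f] [hg : ArF A g] =>
    Ar.comp₂ (A := A) (fun x y => P x y) f g
  have := ar_induction (fun k => k ≤ n → ∃ b, ∀ m, m < k → ∃ x, x < b ∧ P m x)
    (fun _ => ⟨0, fun m h => (hA.out.not_lt_zero _ h).elim⟩) (fun k ih hk => by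
      obtain ⟨b, hb⟩ := ih ((num_lt_succ.2 le_rfl).le.trans hk)
      obtain ⟨x, hx⟩ := h k (num_succ_le.1 hk)
      refine ⟨b + x + 1, fun m hm => ?_⟩
      obtain hm | rfl := (num_lt_succ.1 hm).lt_or_eq
      · obtain ⟨y, hy, h⟩ := hb m hm
        exact ⟨y, hy.trans (num_lt_succ.2 le_self_add), h⟩
      · exact ⟨x, num_lt_succ.2 le_add_self, hx⟩) n
  exact this le_rfl

theorem exists_finCode (P : A.Num → Prop) [Ar A P] (k : A.Num) (hk : ∀ i, P i → i < k) :
    ∃ c, A.IsFinCode c ∧ ∀ i, A.FinMem i c ↔ P i := by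
  have := fun {β : Type u} [Coded A β] (f : β → A.Num) [hf : ArF A f] => Ar.comp (A := A) P f
  obtain ⟨c, hc⟩ := exists_code (Ar.setOf_mem P) k
  obtain ⟨c, hc, hm⟩ := exists_least (fun c => ∀ i, A.FinMem i c ↔ P i)
    ⟨c, fun i => (hc i).trans (and_iff_right_of_imp (hk i))⟩
  exact ⟨c, fun c' h h' => hm c' h fun i => (h' i).trans (hc i), hc⟩

theorem IsFinCode.ext {c c' : A.Num} (hc : A.IsFinCode c) (hc' : A.IsFinCode c')
    (h : ∀ i, A.FinMem i c ↔ A.FinMem i c') : c = c' := by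
  by_contra hne
  obtain h' | h' := lt_or_gt_of_ne hne
  · exact hc' _ h' h
  · exact hc _ h' fun i => (h i).symm

end

section

variable {A : L2Structure.{u}} [hA : Fact A.ModelsRCA0] [hJ : Fact A.OmegaJumpClosed]

/-! ### Computations -/

section ArComputes

variable {α δ : Type u} [Coded A α] [Coded A δ] {d r e x y : α → A.Num}
  [hd : ArF A d] [hr : ArF A r] [he : ArF A e] [hx : ArF A x] [hy : ArF A y]

instance Ar.claimBelow : Ar A (fun a => A.ClaimBelow (d a) (r a) (e a) (x a) (y a)) := by
  have h₁ := ArF.comp' (A := A) d (Prod.fst : α × A.Num → α)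
  have h₂ := ArF.comp' (A := A) r (Prod.fst : α × A.Num → α)
  have h₃ := ArF.comp' (A := A) e (Prod.fst : α × A.Num → α)
  have h₄ := ArF.comp' (A := A) x (Prod.fst : α × A.Num → α)
  have h₅ := ArF.comp' (A := A) y (Prod.fst : α × A.Num → α)
  unfold ClaimBelow
  infer_instance

theorem Ar.computes (X : δ → Set A.Num) [hX : Ar A (fun q : δ × A.Num => q.2 ∈ X q.1)]
    (i : α → δ) [hi : ArF A i] : Ar A (fun a => A.Computes (X (i a)) (e a) (x a) (y a)) := by
  have h := fun {β : Type u} [Coded A β] (i : β → δ) (f : β → A.Num) [ArF A i] [ArF A f] =>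
    Ar.comp₂ (A := A) (fun i x => x ∈ X i) i f
  have : Ar A (fun q : δ × A.Num => A.Valid (X q.1) q.2) := by
    unfold Valid Justified
    infer_instance
  have h' := fun {β : Type u} [Coded A β] (i : β → δ) (f : β → A.Num) [ArF A i] [ArF A f] =>
    Ar.comp₂ (A := A) (fun i x => A.Valid (X i) x) i f
  have : Ar A (fun q : ((δ × A.Num) × A.Num) × A.Num =>
      A.Computes (X q.1.1.1) q.1.1.2 q.1.2 q.2) := by
    simp only [computes_iff]
    infer_instance
  have h₁ := hi.prodMk (hg := he)
  have h₂ := h₁.prodMk (hg := hx)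
  have h₃ := h₂.prodMk (hg := hy)
  exact Ar.comp (fun q : ((δ × A.Num) × A.Num) × A.Num =>
      A.Computes (X q.1.1.1) q.1.1.2 q.1.2 q.2) (fun a => (((i a, e a), x a), y a))

instance Ar.computes_const (X : Set A.Num) [hX : Fact (X ∈ A.Sets)] :
    Ar A (fun a => A.Computes X (e a) (x a) (y a)) :=
  Ar.computes (fun _ : α => X) (fun a => a)

instance Ar.computes_sect (Z : Set A.Num) [hZ : Fact (Z ∈ A.Sets)] (i : α → A.Num) [ArF A i] :
    Ar A (fun a => A.Computes (A.sect Z (i a)) (e a) (x a) (y a)) :=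
  have : Ar A (fun q : A.Num × A.Num => q.2 ∈ A.sect Z q.1) :=
    inferInstanceAs (Ar A (fun q : A.Num × A.Num => A.pair q.1 q.2 ∈ Z))
  Ar.computes (fun n : A.Num => A.sect Z n) i

end ArComputes

variable {X : Set A.Num}

theorem Justified.mono {d d' r r' e x y : A.Num}
    (h : ∀ e x y, A.ClaimBelow d r e x y → A.ClaimBelow d' r' e x y)
    (hj : A.Justified X d r e x y) : A.Justified X d' r' e x y := by
  refine hj.imp id <| .imp id <| .imp id <| .imp id <| .imp id <| .imp id <| .imp ?_ <|
    .imp ?_ <| .imp ?_ ?_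
  · rintro ⟨f, g, rfl, p, q, h₁, h₂, rfl⟩
    exact ⟨f, g, rfl, p, q, h _ _ _ h₁, h _ _ _ h₂, rfl⟩
  · rintro ⟨f, g, rfl, p, h₁, h₂⟩
    exact ⟨f, g, rfl, p, h _ _ _ h₁, h _ _ _ h₂⟩
  · rintro ⟨f, g, rfl, ⟨b, rfl, h₁⟩ | ⟨b, n, p, rfl, h₁, h₂⟩⟩
    · exact ⟨f, g, rfl, .inl ⟨b, rfl, h _ _ _ h₁⟩⟩
    · exact ⟨f, g, rfl, .inr ⟨b, n, p, rfl, h _ _ _ h₁, h _ _ _ h₂⟩⟩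
  · rintro ⟨f, rfl, h₁, h₂⟩
    exact ⟨f, rfl, h _ _ _ h₁, fun z hz => let ⟨p, h₀, h₃⟩ := h₂ z hz; ⟨p, h₀, h _ _ _ h₃⟩⟩

theorem runsTo_mono {s t e x y : A.Num} (h : s ≤ t) (hr : A.RunsTo X s e x y) :
    A.RunsTo X t e x y :=
  let ⟨d, hd, h'⟩ := hr
  ⟨d, hd.trans_le h, h'⟩

/-- A claim that follows in one step from the results of all computations with codes below some
bound `b` is itself the result of a computation. -/
theorem computes_of_justified (hX : X ∈ A.Sets) {e x y : A.Num} (b : A.Num)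
    (h : ∀ d r, (∀ e' x' y', A.RunsTo X b e' x' y' → A.ClaimBelow d r e' x' y') →
      A.Justified X d r e x y) : A.Computes X e x y := by
  have := Fact.mk hX
  have hV : Ar A (fun d => A.Valid X d) := by unfold Valid Justified; infer_instance
  have hV' := fun {β : Type u} [Coded A β] (f : β → A.Num) [ArF A f] =>
    Ar.comp (A := A) (fun d => A.Valid X d) f
  -- the union of all computations with codes below `b`
  obtain ⟨d, -, hd⟩ := exists_finCode (fun i => ∃ d', d' < b ∧ A.Valid X d' ∧ A.FinMem i d') b
    (fun i ⟨d', hd', _, h⟩ => h.lt.trans hd')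
  have hlt : ∀ {r e x y}, A.FinMem (A.pair r (A.pair e (A.pair x y))) d → r < d :=
    fun h => (le_pair_left _ _).trans_lt h.lt
  have hsub : ∀ {d' i}, d' < b → A.Valid X d' → A.FinMem i d' → A.FinMem i d :=
    fun h₁ h₂ h₃ => (hd _).2 ⟨_, h₁, h₂, h₃⟩
  -- the new claim gets a rank above all ranks in the union
  obtain ⟨c, -, hc⟩ := exists_finCode
    (fun i => A.FinMem i d ∨ i = A.pair d (A.pair e (A.pair x y)))
    (d + A.pair d (A.pair e (A.pair x y)) + 1) (by
      rintro i (h | rfl)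
      · exact num_lt_succ.2 (h.lt.le.trans le_self_add)
      · exact num_lt_succ.2 le_add_self)
  refine computes_iff.2 ⟨c, fun r e' x' y' hr => ?_, d + 1, d, num_lt_succ.2 le_rfl,
    (hc _).2 (.inr rfl)⟩
  obtain hr | hr := (hc _).1 hr
  · obtain ⟨d', hd', hv, hm⟩ := (hd _).1 hr
    refine (hv _ _ _ _ hm).mono fun e x y ⟨r', hr', hm'⟩ => ⟨r', hr', (hc _).2 (.inl ?_)⟩
    exact hsub hd' hv hm'
  · simp only [pair_inj] at hr
    obtain ⟨rfl, rfl, rfl, rfl⟩ := hr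
    refine h c r fun e x y ⟨d', hd', hv, r', hm⟩ => ?_
    exact ⟨r', hlt (hsub hd' hv hm), (hc _).2 (.inl (hsub hd' hv hm))⟩

theorem computes_cst (hX : X ∈ A.Sets) (c x : A.Num) : A.Computes X (A.cst c) x c :=
  computes_of_justified hX 0 fun _ _ _ => justified_cst.2 rfl

theorem computes_idp (hX : X ∈ A.Sets) (x : A.Num) : A.Computes X A.idp x x :=
  computes_of_justified hX 0 fun _ _ _ => justified_idp.2 rfl

theorem computes_sucp (hX : X ∈ A.Sets) (x : A.Num) : A.Computes X A.sucp x (x + 1) :=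
  computes_of_justified hX 0 fun _ _ _ => justified_sucp.2 rfl

theorem computes_fstp (hX : X ∈ A.Sets) (x y : A.Num) : A.Computes X A.fstp (A.pair x y) x :=
  computes_of_justified hX 0 fun _ _ _ => justified_fstp.2 ⟨_, rfl⟩

theorem computes_sndp (hX : X ∈ A.Sets) (x y : A.Num) : A.Computes X A.sndp (A.pair x y) y :=
  computes_of_justified hX 0 fun _ _ _ => justified_sndp.2 ⟨_, rfl⟩

theorem computesSet_orc (hX : X ∈ A.Sets) : A.ComputesSet X A.orc X := fun x =>
  ⟨fun h => computes_of_justified hX 0 fun _ _ _ => justified_orc.2 (.inl ⟨h, rfl⟩),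
    fun h => computes_of_justified hX 0 fun _ _ _ => justified_orc.2 (.inr ⟨h, rfl⟩)⟩

section Rules

variable {f g x y p q n : A.Num}

theorem computes_prp (hX : X ∈ A.Sets) (hf : A.Computes X f x p) (hg : A.Computes X g x q) :
    A.Computes X (A.prp f g) x (A.pair p q) := by
  obtain ⟨s, hs⟩ := hf
  obtain ⟨t, ht⟩ := hg
  exact computes_of_justified hX (s + t) fun d r h => justified_prp.2
    ⟨p, q, h _ _ _ (runsTo_mono le_self_add hs), h _ _ _ (runsTo_mono le_add_self ht), rfl⟩

theorem computes_cmp (hX : X ∈ A.Sets) (hg : A.Computes X g x p) (hf : A.Computes X f p y) :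
    A.Computes X (A.cmp f g) x y := by
  obtain ⟨s, hs⟩ := hf
  obtain ⟨t, ht⟩ := hg
  exact computes_of_justified hX (s + t) fun d r h => justified_cmp.2
    ⟨p, h _ _ _ (runsTo_mono le_add_self ht), h _ _ _ (runsTo_mono le_self_add hs)⟩

theorem computes_prc_zero (hX : X ∈ A.Sets) (hf : A.Computes X f x y) :
    A.Computes X (A.prc f g) (A.pair x 0) y := by
  obtain ⟨s, hs⟩ := hf
  exact computes_of_justified hX s fun d r h => justified_prc.2 (.inl ⟨x, rfl, h _ _ _ hs⟩)

theorem computes_prc_succ (hX : X ∈ A.Sets) (hf : A.Computes X (A.prc f g) (A.pair x n) p)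
    (hg : A.Computes X g (A.pair x (A.pair n p)) y) :
    A.Computes X (A.prc f g) (A.pair x (n + 1)) y := by
  obtain ⟨s, hs⟩ := hf
  obtain ⟨t, ht⟩ := hg
  exact computes_of_justified hX (s + t) fun d r h => justified_prc.2 (.inr ⟨x, n, p, rfl,
    h _ _ _ (runsTo_mono le_self_add hs), h _ _ _ (runsTo_mono le_add_self ht)⟩)

theorem computes_mup (hX : X ∈ A.Sets) (h₀ : A.Computes X f (A.pair x y) 0)
    (h : ∀ z, z < y → ∃ p, p ≠ 0 ∧ A.Computes X f (A.pair x z) p) :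
    A.Computes X (A.mup f) x y := by
  have := Fact.mk hX
  have hV : Ar A (fun d => A.Valid X d) := by unfold Valid Justified; infer_instance
  have hV' := fun {β : Type u} [Coded A β] (f : β → A.Num) [ArF A f] =>
    Ar.comp (A := A) (fun d => A.Valid X d) f
  obtain ⟨b, hb⟩ := exists_bound (A := A) (fun z d => ∃ p : A.Num, p ≠ 0 ∧ A.Valid X d ∧
    ∃ r, A.FinMem (A.pair r (A.pair f (A.pair (A.pair x z) p))) d) y fun z hz => by
      obtain ⟨p, h0, s, d, hd, hv, r, h⟩ := h z hz
      exact ⟨d, p, h0, hv, r, h⟩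
  obtain ⟨s, hs⟩ := h₀
  refine computes_of_justified hX (s + b) fun d r h => justified_mup.2
    ⟨h _ _ _ (runsTo_mono le_self_add hs), fun z hz => ?_⟩
  obtain ⟨d', hd', p, h0, hv, r', h'⟩ := hb z hz
  exact ⟨p, h0, h _ _ _ (runsTo_mono le_add_self ⟨d', hd', hv, r', h'⟩)⟩

theorem exists_of_computes_cmp (h : A.Computes X (A.cmp f g) x y) :
    ∃ p, A.Computes X g x p ∧ A.Computes X f p y := by
  obtain ⟨d, hd, r, h⟩ := computes_iff.1 h
  obtain ⟨_, h₁⟩ := hd.justified h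
  obtain ⟨p, h₂, h₃⟩ := justified_cmp.1 h₁
  exact ⟨p, computes_iff.2 ⟨d, hd, _, h₂⟩, computes_iff.2 ⟨d, hd, _, h₃⟩⟩

theorem computes_zero_of_mup (h : A.Computes X (A.mup f) x y) : A.Computes X f (A.pair x y) 0 := by
  obtain ⟨d, hd, r, h⟩ := computes_iff.1 h
  obtain ⟨_, h₁⟩ := hd.justified h
  exact computes_iff.2 ⟨d, hd, _, (justified_mup.1 h₁).1⟩

theorem computes_unique {e y' : A.Num} (h : A.Computes X e x y) (h' : A.Computes X e x y') :
    y = y' := by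
  obtain ⟨d, hd, r, r₀, -, h⟩ := computes_iff.1 h
  obtain ⟨d', hd', r', r₀', hr', h'⟩ := computes_iff.1 h'
  refine ar_strong_induction (fun r => ∀ e x y r' y',
    A.FinMem (A.pair r (A.pair e (A.pair x y))) d →
    A.FinMem (A.pair r' (A.pair e (A.pair x y'))) d' → y = y') (fun r ih e x y r' y' h h' => ?_)
    r₀ e x y r₀' y' h h'
  have key : ∀ {e x y s y'}, A.ClaimBelow d r e x y → A.ClaimBelow d' s e x y' → y = y' :=
    fun ⟨r₁, h₁, h₂⟩ ⟨r₂, _, h₃⟩ => ih r₁ h₁ _ _ _ _ _ h₂ h₃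
  have hj := hd _ _ _ _ h
  have hj' := hd' _ _ _ _ h'
  obtain ⟨c, rfl, rfl⟩ | ⟨rfl, rfl⟩ | ⟨rfl, rfl⟩ | ⟨rfl, b, rfl⟩ | ⟨rfl, b, rfl⟩ | ⟨rfl, hb⟩ |
    ⟨f, g, rfl, p, q, h₁, h₂, rfl⟩ | ⟨f, g, rfl, p, h₁, h₂⟩ | ⟨f, g, rfl, h₁⟩ | ⟨f, rfl, h₁, h₂⟩ := hj
  · exact (justified_cst.1 hj').symm
  · exact (justified_idp.1 hj').symm
  · exact (justified_sucp.1 hj').symm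
  · obtain ⟨b', e⟩ := justified_fstp.1 hj'
    exact (pair_inj.1 e).1
  · obtain ⟨b', e⟩ := justified_sndp.1 hj'
    exact (pair_inj.1 e).2
  · obtain ⟨hb, rfl⟩ | ⟨hb, rfl⟩ := hb <;> obtain ⟨hb', rfl⟩ | ⟨hb', rfl⟩ := justified_orc.1 hj' <;>
      first | rfl | contradiction
  · obtain ⟨p', q', h₁', h₂', rfl⟩ := justified_prp.1 hj'
    rw [key h₁ h₁', key h₂ h₂']
  · obtain ⟨p', h₁', h₂'⟩ := justified_cmp.1 hj'
    obtain rfl := key h₁ h₁'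
    exact key h₂ h₂'
  · obtain ⟨b, rfl, h₁⟩ | ⟨b, n, p, rfl, h₁, h₂⟩ := h₁ <;>
      obtain ⟨b', e, h₁'⟩ | ⟨b', n', p', e, h₁', h₂'⟩ := justified_prc.1 hj' <;>
      obtain ⟨rfl, e'⟩ := pair_inj.1 e
    · exact key h₁ h₁'
    · exact (hA.out.add_one_ne_zero _ e'.symm).elim
    · exact (hA.out.add_one_ne_zero _ e').elim
    · obtain rfl := hA.out.add_one_inj _ _ e'
      obtain rfl := key h₁ h₁'
      exact key h₂ h₂'
  · obtain ⟨h₁', h₂'⟩ := justified_mup.1 hj'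
    obtain hlt | rfl | hlt := lt_trichotomy y y'
    · obtain ⟨p, hp, h₃⟩ := h₂' y hlt
      exact (hp (key h₁ h₃).symm).elim
    · rfl
    · obtain ⟨p, hp, h₃⟩ := h₂ y' hlt
      exact (hp (key h₃ h₁')).elim

end Rules

theorem ComputesSet.mem_iff {e : A.Num} {H : Set A.Num} (h : A.ComputesSet X e H) (x : A.Num) :
    x ∈ H ↔ A.Computes X e x 1 := by
  refine ⟨(h x).1, fun h₁ => by_contra fun hx => ?_⟩
  exact one_ne_zero (computes_unique h₁ ((h x).2 hx))

theorem ComputesSet.mem_sets (hX : X ∈ A.Sets) {e : A.Num} {H : Set A.Num}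
    (h : A.ComputesSet X e H) : H ∈ A.Sets := by
  have := Fact.mk hX
  have := Ar.setOf_mem (A := A) (fun x => A.Computes X e x 1)
  rwa [show H = {x | A.Computes X e x 1} from Set.ext h.mem_iff]

end

section

/-! ### Program templates -/

/-- Program templates: closed terms in the pairing function and the numerals, with holes for other
programs. They denote the same program in all structures at once. -/
inductive Tm : Type
  | hole (i : ℕ) : Tm
  | num (k : ℕ) : Tm
  | pair (s t : Tm) : Tm

namespace Tm

/-- The value of a template in `A`, where the holes are filled with the entries of `E`. -/
def eval (A : L2Structure.{u}) (E : ℕ → A.Num) : Tm → A.Num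
  | hole i => E i
  | num k => A.numeral k
  | pair s t => A.pair (s.eval A E) (t.eval A E)

/-- Substitution of templates for the holes of a template. -/
def bind (ts : ℕ → Tm) : Tm → Tm
  | hole i => ts i
  | num k => num k
  | pair s t => pair (s.bind ts) (t.bind ts)

theorem eval_bind (A : L2Structure.{u}) (E : ℕ → A.Num) (ts : ℕ → Tm) (t : Tm) :
    (t.bind ts).eval A E = t.eval A (fun i => (ts i).eval A E) := by
  induction t with
  | hole i => rfl
  | num k => rfl
  | pair s t hs ht => simp [bind, eval, hs, ht]

/-! The templates for the program constructors. -/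

def cst (c : Tm) : Tm := pair (num 0) c
def idp : Tm := pair (num 1) (num 0)
def sucp : Tm := pair (num 2) (num 0)
def fstp : Tm := pair (num 3) (num 0)
def sndp : Tm := pair (num 4) (num 0)
def orc : Tm := pair (num 5) (num 0)
def prp (f g : Tm) : Tm := pair (num 6) (pair f g)
def cmp (f g : Tm) : Tm := pair (num 7) (pair f g)
def prc (f g : Tm) : Tm := pair (num 8) (pair f g)
def mup (f : Tm) : Tm := pair (num 9) f

/-- `(a, b) ↦ a + b`. -/
def addp : Tm := prc idp (cmp sucp (cmp sndp sndp))
/-- `(a, b) ↦ a * b`. -/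
def mulp : Tm := prc (cst (num 0)) (cmp addp (prp (cmp sndp sndp) fstp))
/-- `(x, n) ↦ n - 1`. -/
def predp : Tm := prc (cst (num 0)) (cmp fstp sndp)
/-- `(a, b) ↦ a - b` (truncated subtraction). -/
def subp : Tm := prc idp (cmp (cmp predp (prp idp idp)) (cmp sndp sndp))
/-- `n ↦ 1` if `n = 0`, and `n ↦ 0` otherwise. -/
def iszp : Tm := cmp (prc (cst (num 1)) (cst (num 0))) (prp idp idp)
def notp (f : Tm) : Tm := cmp iszp f
def andp (f g : Tm) : Tm := cmp mulp (prp f g)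
/-- The characteristic function of `<`. -/
def ltp : Tm := notp (notp (cmp subp (prp sndp fstp)))
/-- The characteristic function of `=`. -/
def eqp : Tm := andp (notp ltp) (notp (cmp ltp (prp sndp fstp)))
/-- The entry with index `i` of an environment `(x₀, (x₁, (x₂, …)))`. -/
def varp : ℕ → Tm
  | 0 => fstp
  | i + 1 => cmp (varp i) sndp
/-- Given a program `f` on environments, `(w, n) ↦ 1` if `f` outputs `1` on `(x, w)` for all
`x < n`, and `(w, n) ↦ 0` otherwise. -/
def ballp (f : Tm) : Tm :=
  prc (cst (num 1)) (andp (cmp sndp sndp) (cmp f (prp (cmp fstp sndp) fstp)))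

end Tm

/-- The program that evaluates a term in an environment. -/
def _root_.L2Term.prog : L2Term → Tm
  | .var i => .varp i
  | .zero => .cst (.num 0)
  | .one => .cst (.num 1)
  | .add s t => .cmp .addp (.prp s.prog t.prog)
  | .mul s t => .cmp .mulp (.prp s.prog t.prog)

/-- The program that decides a bounded formula in an environment; the hole with index `i` stands for
a program that decides the set variable `i`. -/
def _root_.L2Bounded.prog : L2Bounded → Tm
  | .eq s t => .cmp .eqp (.prp s.prog t.prog)
  | .lt s t => .cmp .ltp (.prp s.prog t.prog)
  | .mem t i => .cmp (.hole i) t.prog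
  | .neg φ => .notp φ.prog
  | .and φ ψ => .andp φ.prog ψ.prog
  | .ball t φ => .cmp (.ballp φ.prog) (.prp .idp t.prog)

/-- A bound for the variables of a term. -/
def _root_.L2Term.bound : L2Term → ℕ
  | .var i => i + 1
  | .zero => 0
  | .one => 0
  | .add s t => max s.bound t.bound
  | .mul s t => max s.bound t.bound

/-- A bound for the free number variables of a formula. -/
def _root_.L2Bounded.bound : L2Bounded → ℕ
  | .eq s t => max s.bound t.bound
  | .lt s t => max s.bound t.bound
  | .mem t _ => t.bound
  | .neg φ => φ.bound
  | .and φ ψ => max φ.bound ψ.bound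
  | .ball t φ => max t.bound (φ.bound - 1)

/-- The number `w` codes the values of `v` at the first `k` variables. -/
def Env (A : L2Structure.{u}) : ℕ → A.Num → (ℕ → A.Num) → Prop
  | 0, _, _ => True
  | k + 1, w, v => ∃ w', w = A.pair (v 0) w' ∧ A.Env k w' (fun i => v (i + 1))

/-- The truth value of `p`, as a number of `A`. -/
noncomputable def bit (A : L2Structure.{u}) (p : Prop) : A.Num :=
  open Classical in if p then 1 else 0

theorem bit_true {A : L2Structure.{u}} {p : Prop} (h : p) : A.bit p = 1 := if_pos h

theorem bit_false {A : L2Structure.{u}} {p : Prop} (h : ¬ p) : A.bit p = 0 := if_neg h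

theorem bit_congr {A : L2Structure.{u}} {p q : Prop} (h : p ↔ q) : A.bit p = A.bit q := by
  rw [propext h]

theorem bit_eq_zero {A : L2Structure.{u}} [Fact A.ModelsRCA0] {p : Prop} : A.bit p = 0 ↔ ¬ p := by
  by_cases h : p <;> simp [h, bit_true, bit_false]

theorem computesSet_iff {A : L2Structure.{u}} {K H : Set A.Num} {e : A.Num} :
    A.ComputesSet K e H ↔ ∀ x, A.Computes K e x (A.bit (x ∈ H)) := by
  refine forall_congr' fun x => ?_
  by_cases h : x ∈ H <;> simp [h, bit_true, bit_false]

variable {A : L2Structure.{u}} [hA : Fact A.ModelsRCA0] [hJ : Fact A.OmegaJumpClosed]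
  {K : Set A.Num} {E : ℕ → A.Num}

/-- The program given by the template `t` outputs `y` on input `x`. -/
def Runs (A : L2Structure.{u}) (K : Set A.Num) (E : ℕ → A.Num) (t : Tm) (x y : A.Num) : Prop :=
  A.Computes K (t.eval A E) x y

section Programs

variable (hK : K ∈ A.Sets) {f g c : Tm} {x y p q n : A.Num}
include hK

theorem runs_cst : A.Runs K E (.cst c) x (c.eval A E) := computes_cst hK _ _

theorem runs_cst_zero : A.Runs K E (.cst (.num 0)) x 0 := computes_cst hK _ _

theorem runs_cst_one : A.Runs K E (.cst (.num 1)) x 1 := by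
  have : A.Runs K E (.cst (.num 1)) x (0 + 1) := computes_cst hK _ _
  rwa [zero_add] at this

theorem runs_idp : A.Runs K E .idp x x := computes_idp hK _

theorem runs_sucp : A.Runs K E .sucp x (x + 1) := computes_sucp hK _

theorem runs_fstp : A.Runs K E .fstp (A.pair x y) x := computes_fstp hK _ _

theorem runs_sndp : A.Runs K E .sndp (A.pair x y) y := computes_sndp hK _ _

theorem runs_prp (hf : A.Runs K E f x p) (hg : A.Runs K E g x q) :
    A.Runs K E (.prp f g) x (A.pair p q) := computes_prp hK hf hg

theorem runs_cmp (hg : A.Runs K E g x p) (hf : A.Runs K E f p y) :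
    A.Runs K E (.cmp f g) x y := computes_cmp hK hg hf

theorem runs_prc_zero (hf : A.Runs K E f x y) : A.Runs K E (.prc f g) (A.pair x 0) y :=
  computes_prc_zero hK hf

theorem runs_prc_succ (hf : A.Runs K E (.prc f g) (A.pair x n) p)
    (hg : A.Runs K E g (A.pair x (A.pair n p)) y) :
    A.Runs K E (.prc f g) (A.pair x (n + 1)) y :=
  computes_prc_succ hK hf hg

/-- A recursion whose step terminates on all inputs terminates on all inputs. -/
theorem exists_runs_prc (hf : ∃ y, A.Runs K E f x y)
    (hg : ∀ n p, ∃ y, A.Runs K E g (A.pair x (A.pair n p)) y) (n : A.Num) :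
    ∃ y, A.Runs K E (.prc f g) (A.pair x n) y := by
  have := Fact.mk hK
  unfold Runs at *
  refine ar_induction (fun n => ∃ y, A.Computes K ((Tm.prc f g).eval A E) (A.pair x n) y) ?_ ?_ n
  · exact hf.imp fun y h => runs_prc_zero hK h
  · rintro n ⟨p, h⟩
    exact (hg n p).imp fun y h' => runs_prc_succ hK h h'

theorem runs_addp : A.Runs K E .addp (A.pair x y) (x + y) := by
  have := Fact.mk hK
  refine ar_induction (fun y => A.Computes K (Tm.addp.eval A E) (A.pair x y) (x + y)) ?_ ?_ y
  · rw [add_zero]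
    exact runs_prc_zero hK (runs_idp hK)
  · intro n h
    rw [← add_assoc]
    exact runs_prc_succ hK h (runs_cmp hK (runs_cmp hK (runs_sndp hK) (runs_sndp hK)) (runs_sucp hK))

theorem runs_mulp : A.Runs K E .mulp (A.pair x y) (x * y) := by
  have := Fact.mk hK
  refine ar_induction (fun y => A.Computes K (Tm.mulp.eval A E) (A.pair x y) (x * y)) ?_ ?_ y
  · rw [mul_zero]
    exact runs_prc_zero hK (runs_cst_zero hK)
  · intro n h
    rw [mul_add, mul_one]
    exact runs_prc_succ hK h (runs_cmp hK (runs_prp hK (runs_cmp hK (runs_sndp hK) (runs_sndp hK))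
      (runs_fstp hK)) (runs_addp hK))

theorem runs_predp_zero : A.Runs K E .predp (A.pair x 0) 0 := runs_prc_zero hK (runs_cst_zero hK)

theorem runs_predp_succ : A.Runs K E .predp (A.pair x (n + 1)) n := by
  obtain ⟨p, hp⟩ := exists_runs_prc (A := A) (K := K) (E := E) (f := .cst (.num 0))
    (g := .cmp .fstp .sndp) (x := x) hK ⟨_, runs_cst hK⟩
    (fun n p => ⟨n, runs_cmp hK (runs_sndp hK) (runs_fstp hK)⟩) n
  exact runs_prc_succ hK hp (runs_cmp hK (runs_sndp hK) (runs_fstp hK))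

theorem runs_subp : ∃ z, A.Runs K E .subp (A.pair x y) z ∧ (x = y + z ∨ x < y ∧ z = 0) := by
  have := Fact.mk hK
  refine ar_induction (fun y => ∃ z, A.Computes K (Tm.subp.eval A E) (A.pair x y) z ∧
    (x = y + z ∨ x < y ∧ z = 0)) ?_ ?_ y
  · exact ⟨x, runs_prc_zero hK (runs_idp hK), .inl (zero_add _).symm⟩
  · rintro n ⟨z, h, h'⟩
    have step : ∀ {p}, A.Runs K E .predp (A.pair z z) p →
        A.Runs K E .subp (A.pair x (n + 1)) p := fun h₁ =>
      runs_prc_succ hK h (runs_cmp hK (runs_cmp hK (runs_sndp hK) (runs_sndp hK))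
        (runs_cmp hK (runs_prp hK (runs_idp hK) (runs_idp hK)) h₁))
    obtain rfl | ⟨z, rfl⟩ := eq_zero_or_succ z
    · refine ⟨0, step (runs_predp_zero hK), .inr ⟨?_, rfl⟩⟩
      obtain rfl | ⟨h', -⟩ := h'
      · exact num_lt_succ.2 (add_zero n).le
      · exact h'.trans (num_lt_succ.2 le_rfl)
    · refine ⟨z, step (runs_predp_succ hK), .inl ?_⟩
      obtain rfl | ⟨-, h'⟩ := h'
      · ring
      · exact (hA.out.add_one_ne_zero _ h').elim

theorem runs_iszp : A.Runs K E .iszp n (A.bit (n = 0)) := by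
  refine runs_cmp hK (runs_prp hK (runs_idp hK) (runs_idp hK)) ?_
  have h : ∀ x, ∃ y, A.Runs K E (.prc (.cst (.num 1)) (.cst (.num 0))) (A.pair n x) y :=
    exists_runs_prc hK ⟨_, runs_cst hK⟩ fun _ _ => ⟨_, runs_cst hK⟩
  obtain rfl | ⟨m, rfl⟩ := eq_zero_or_succ n
  · rw [bit_true rfl]
    exact runs_prc_zero hK (runs_cst_one hK)
  · rw [bit_false (hA.out.add_one_ne_zero m)]
    exact (h m).elim fun p hp => runs_prc_succ hK hp (runs_cst_zero hK)

theorem runs_notp {P : Prop} (h : A.Runs K E f x (A.bit P)) :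
    A.Runs K E (.notp f) x (A.bit (¬ P)) := by
  rw [← bit_congr (bit_eq_zero (A := A))]
  exact runs_cmp hK h (runs_iszp hK)

theorem runs_andp {P Q : Prop} (h : A.Runs K E f x (A.bit P)) (h' : A.Runs K E g x (A.bit Q)) :
    A.Runs K E (.andp f g) x (A.bit (P ∧ Q)) := by
  have e : A.bit (P ∧ Q) = A.bit P * A.bit Q := by
    by_cases hP : P <;> by_cases hQ : Q <;> simp [hP, hQ, bit_true, bit_false]
  rw [e]
  exact runs_cmp hK (runs_prp hK h h') (runs_mulp hK)

theorem runs_ltp : A.Runs K E .ltp (A.pair x y) (A.bit (x < y)) := by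
  obtain ⟨z, h, hz⟩ := runs_subp (x := y) (y := x) (E := E) hK
  have h₁ := runs_cmp (g := .prp .sndp .fstp) (x := A.pair x y) hK
    (runs_prp hK (runs_sndp hK) (runs_fstp hK)) h
  have e : x < y ↔ ¬ z = 0 := by
    obtain rfl | ⟨hlt, rfl⟩ := hz
    · simp [pos_iff_ne_zero]
    · simpa using hlt.le
  rw [bit_congr e]
  exact runs_notp hK (runs_cmp hK h₁ (runs_iszp hK))

theorem runs_eqp : A.Runs K E .eqp (A.pair x y) (A.bit (x = y)) := by
  have h := runs_andp hK (runs_notp hK (runs_ltp (x := x) (y := y) (E := E) hK))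
    (runs_notp hK (runs_cmp (g := .prp .sndp .fstp) (x := A.pair x y) hK
      (runs_prp hK (runs_sndp hK) (runs_fstp hK)) (runs_ltp hK)))
  rwa [bit_congr (show (¬ x < y ∧ ¬ y < x) ↔ x = y by
    rw [not_lt, not_lt, le_antisymm_iff, and_comm])] at h

theorem runs_ballp {w : A.Num} {P : A.Num → Prop}
    (h : ∀ x, A.Runs K E f (A.pair x w) (A.bit (P x))) :
    A.Runs K E (.ballp f) (A.pair w n) (A.bit (∀ x, x < n → P x)) := by
  have := Fact.mk hK
  have h₁ : ∀ {x}, P x ↔ A.Runs K E f (A.pair x w) 1 := by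
    intro x
    refine ⟨fun hx => by simpa [bit_true hx] using h x, fun hx => by_contra fun hP => ?_⟩
    have := h x
    rw [bit_false hP] at this
    exact one_ne_zero (computes_unique hx this)
  have := ar_induction (fun n =>
    (A.Computes K ((Tm.ballp f).eval A E) (A.pair w n) 1 ∧
      ∀ x, x < n → A.Computes K (f.eval A E) (A.pair x w) 1) ∨
    (A.Computes K ((Tm.ballp f).eval A E) (A.pair w n) 0 ∧
      ¬ ∀ x, x < n → A.Computes K (f.eval A E) (A.pair x w) 1)) ?_ ?_ n
  · by_cases hn : ∀ x, x < n → P x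
    · rw [bit_true hn]
      exact (this.resolve_right fun h => h.2 fun x hx => h₁.1 (hn x hx)).1
    · rw [bit_false hn]
      exact (this.resolve_left fun h => hn fun x hx => h₁.2 (h.2 x hx)).1
  · exact .inl ⟨runs_prc_zero hK (runs_cst_one hK), fun x hx => (hA.out.not_lt_zero _ hx).elim⟩
  · intro n ih
    have step : ∀ {Q}, A.Runs K E (.ballp f) (A.pair w n) (A.bit Q) →
        A.Runs K E (.ballp f) (A.pair w (n + 1)) (A.bit (Q ∧ P n)) := fun hq =>
      runs_prc_succ hK hq (runs_andp hK (runs_cmp hK (runs_sndp hK) (runs_sndp hK))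
        (runs_cmp hK (runs_prp hK (runs_cmp hK (runs_sndp hK) (runs_fstp hK)) (runs_fstp hK)) (h n)))
    have hsucc : (∀ x, x < n + 1 → A.Runs K E f (A.pair x w) 1) ↔
        (∀ x, x < n → A.Runs K E f (A.pair x w) 1) ∧ P n := by
      rw [h₁]
      refine ⟨fun h => ⟨fun x hx => h x (hx.trans (num_lt_succ.2 le_rfl)),
        h n (num_lt_succ.2 le_rfl)⟩, fun h x hx => ?_⟩
      obtain hx | rfl := (num_lt_succ.1 hx).lt_or_eq
      exacts [h.1 x hx, h.2]
    have := step (Q := ∀ x, x < n → A.Runs K E f (A.pair x w) 1) (by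
      obtain ⟨h, h'⟩ | ⟨h, h'⟩ := ih
      · exact (bit_true h').symm ▸ h
      · exact (bit_false h').symm ▸ h)
    rw [← hsucc] at this
    by_cases hn : ∀ x, x < n + 1 → A.Runs K E f (A.pair x w) 1
    · rw [bit_true hn] at this
      exact .inl ⟨this, hn⟩
    · rw [bit_false hn] at this
      exact .inr ⟨this, hn⟩

theorem runs_varp {k i : ℕ} (hi : i < k) {w : A.Num} {v : ℕ → A.Num} (h : A.Env k w v) :
    A.Runs K E (.varp i) w (v i) := by
  induction i generalizing k w v with
  | zero =>
    obtain ⟨k, rfl⟩ : ∃ l, k = l + 1 := ⟨k - 1, by omega⟩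
    obtain ⟨w', rfl, -⟩ := h
    exact runs_fstp hK
  | succ i ih =>
    obtain ⟨k, rfl⟩ : ∃ l, k = l + 1 := ⟨k - 1, by omega⟩
    obtain ⟨w', rfl, h⟩ := h
    exact runs_cmp hK (runs_sndp hK) (ih (v := fun i => v (i + 1)) (by omega) h)

theorem runs_term {k : ℕ} {w : A.Num} {v : ℕ → A.Num} (h : A.Env k w v) (t : L2Term)
    (ht : t.bound ≤ k) : A.Runs K E t.prog w (t.eval A v) := by
  induction t with
  | var i => exact runs_varp hK ht h
  | zero => exact runs_cst_zero hK
  | one => exact runs_cst_one hK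
  | add s t hs ht' =>
    obtain ⟨h₁, h₂⟩ := max_le_iff.1 ht
    exact runs_cmp hK (runs_prp hK (hs h₁) (ht' h₂)) (runs_addp hK)
  | mul s t hs ht' =>
    obtain ⟨h₁, h₂⟩ := max_le_iff.1 ht
    exact runs_cmp hK (runs_prp hK (hs h₁) (ht' h₂)) (runs_mulp hK)

theorem runs_formula {V : ℕ → Set A.Num} (hE : ∀ i, A.ComputesSet K (E i) (V i)) {k : ℕ}
    {w : A.Num} {v : ℕ → A.Num} (h : A.Env k w v) (φ : L2Bounded) (hφ : φ.bound ≤ k) :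
    A.Runs K E φ.prog w (A.bit (φ.Holds A V v)) := by
  induction φ generalizing k w v with
  | eq s t =>
    obtain ⟨h₁, h₂⟩ := max_le_iff.1 hφ
    exact runs_cmp hK (runs_prp hK (runs_term hK h s h₁) (runs_term hK h t h₂)) (runs_eqp hK)
  | lt s t =>
    obtain ⟨h₁, h₂⟩ := max_le_iff.1 hφ
    exact runs_cmp hK (runs_prp hK (runs_term hK h s h₁) (runs_term hK h t h₂)) (runs_ltp hK)
  | mem t i => exact runs_cmp hK (runs_term hK h t hφ) (computesSet_iff.1 (hE i) _)
  | neg φ ih => exact runs_notp hK (ih h hφ)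
  | and φ ψ ih₁ ih₂ =>
    obtain ⟨h₁, h₂⟩ := max_le_iff.1 hφ
    exact runs_andp hK (ih₁ h h₁) (ih₂ h h₂)
  | ball t φ ih =>
    obtain ⟨h₁, h₂⟩ := max_le_iff.1 hφ
    refine runs_cmp hK (runs_prp hK (runs_idp hK) (runs_term hK h t h₁)) (runs_ballp hK fun x => ?_)
    exact ih (k := k + 1) (v := pushVar x v) ⟨w, rfl, h⟩ (by omega)

end Programs

end

section

/-! ### Uniformly computable set operators -/

/-- An operator, defined in all structures at once, that turns a sequence of sets into a set. -/
def Op : Type (u + 1) := ∀ A : L2Structure.{u}, (ℕ → Set A.Num) → Set A.Num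

/-- The template `t` turns programs that compute the entries of `V` from a set `K 0` into a program
that computes `Φ V` from the `n`-th jump `K n` of `K 0`. -/
def HasTemplate (n : ℕ) (Φ : Op.{u}) (t : Tm) : Prop :=
  ∀ (A : L2Structure.{u}) [Fact A.ModelsRCA0] [Fact A.OmegaJumpClosed]
    (V K : ℕ → Set A.Num) (E : ℕ → A.Num), (∀ i, K i ∈ A.Sets) →
    (∀ i, A.IsJump (K i) (K (i + 1))) → (∀ i, A.ComputesSet (K 0) (E i) (V i)) →
    A.ComputesSet (K n) (t.eval A E) (Φ A V)

/-- The value of the operator `Φ` is uniformly computable from `n` jumps, by means of one template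
for all structures. -/
def UOp (n : ℕ) (Φ : Op.{u}) : Prop := ∃ t : Tm, HasTemplate n Φ t

section Program

variable {A : L2Structure.{u}} [hA : Fact A.ModelsRCA0] [hJ : Fact A.OmegaJumpClosed]
  {K : Set A.Num} {E : ℕ → A.Num} {V : ℕ → Set A.Num}

/-- A program for a formula that copies its input `(b, x)` to a sufficiently long environment. -/
theorem exists_tm_formula (P : ∀ A : L2Structure.{u}, (ℕ → Set A.Num) → A.Num → A.Num → Prop)
    [hP : D0 (fun A V v => P A V (v 1) (v 0))] :
    ∃ t : Tm, ∀ (A : L2Structure.{u}) [Fact A.ModelsRCA0] [Fact A.OmegaJumpClosed]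
      (V : ℕ → Set A.Num) (K : Set A.Num) (E : ℕ → A.Num), K ∈ A.Sets →
      (∀ i, A.ComputesSet K (E i) (V i)) → ∀ x b, A.Runs K E t (A.pair x b) (A.bit (P A V x b)) := by
  obtain ⟨θ, hθ⟩ := hP
  -- an environment that codes `b, x, 0, 0, …`, as many entries as `θ` has variables
  have henv : ∀ k : ℕ, ∃ t : Tm, ∀ (A : L2Structure.{u}) [Fact A.ModelsRCA0]
      [Fact A.OmegaJumpClosed] (K : Set A.Num) (E : ℕ → A.Num), K ∈ A.Sets →
      ∀ z, ∃ w, A.Runs K E t z w ∧ A.Env k w (fun _ => 0) := by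
    intro k
    induction k with
    | zero => exact ⟨.idp, fun A _ _ K E hK z => ⟨z, runs_idp hK, trivial⟩⟩
    | succ k ih =>
      obtain ⟨t, ht⟩ := ih
      refine ⟨.prp (.cst (.num 0)) t, fun A _ _ K E hK z => ?_⟩
      obtain ⟨w, h, hw⟩ := ht A K E hK z
      exact ⟨_, runs_prp hK (runs_cst_zero hK) h, w, rfl, hw⟩
  obtain ⟨t, ht⟩ := henv θ.bound
  refine ⟨.cmp θ.prog (.prp .sndp (.prp .fstp t)), fun A _ _ V K E hK hE x b => ?_⟩
  obtain ⟨w, h, hw⟩ := ht A K E hK (A.pair x b)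
  refine runs_cmp hK (runs_prp hK (runs_sndp hK) (runs_prp hK (runs_fstp hK) h)) ?_
  obtain ⟨v, hv₀, hv₁, hv⟩ : ∃ v : ℕ → A.Num, v 0 = b ∧ v 1 = x ∧
      (fun i => v (i + 1 + 1)) = fun _ => 0 := ⟨pushVar b (pushVar x fun _ => 0), rfl, rfl, rfl⟩
  have e := hθ A V v
  rw [hv₀, hv₁] at e
  have hw' : A.Env (θ.bound + 1 + 1) (A.pair b (A.pair x w)) v :=
    ⟨_, by rw [hv₀], w, by rw [← hv₁], hv ▸ hw⟩
  rw [bit_congr e]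
  exact runs_formula hK hE hw' θ (by omega)

end Program

namespace UOp

variable {n : ℕ} {Φ : Op.{u}} {Ψ : ℕ → Op.{u}}

/-- The tuple of the values of the operators `Ψ i`. -/
def tuple (Ψ : ℕ → Op.{u}) (A : L2Structure.{u}) (V : ℕ → Set A.Num) : ℕ → Set A.Num :=
  fun i => Ψ i A V

theorem proj (i : ℕ) : UOp.{u} 0 (fun _ V => V i) :=
  ⟨.hole i, fun _ _ _ _ _ _ _ _ hE => hE i⟩

/-- A relation `Σ⁰₁` in the values of the `Ψ i` costs one jump. -/
theorem jump (hΨ : ∀ i, UOp n (Ψ i))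
    (P : ∀ A : L2Structure.{u}, (ℕ → Set A.Num) → A.Num → A.Num → Prop)
    [hP : D0 (fun A V v => P A V (v 1) (v 0))] :
    UOp (n + 1) (fun A V => {x | ∃ s, P A (tuple Ψ A V) x s}) := by
  choose ts hts using hΨ
  obtain ⟨t, ht⟩ := exists_tm_formula P
  -- from `x` to the program that searches for a witness `s`
  refine ⟨.cmp .orc (.prp (.cst (.num 7)) (.prp (.cst (.mup (.notp (t.bind ts))))
    (.prp (.cst (.num 0)) .idp))), fun A _ _ V K E hK hKJ hE => computesSet_iff.2 fun x => ?_⟩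
  have hV := fun i => hts i A V K E hK hKJ hE
  have ht' := ht A (tuple Ψ A V) (K n) _ (hK n) hV
  have hr : ∀ x s, A.Runs (K n) E (t.bind ts) (A.pair x s) (A.bit (P A (tuple Ψ A V) x s)) := by
    intro x s
    unfold Runs
    rw [Tm.eval_bind]
    exact ht' x s
  have hn := fun x s => runs_notp (hK n) (hr x s)
  set e := (Tm.mup (.notp (t.bind ts))).eval A E with he
  have key : A.cmp e (A.cst x) ∈ K (n + 1) ↔ x ∈ {x | ∃ s, P A (tuple Ψ A V) x s} := by
    rw [hKJ n]
    constructor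
    · rintro ⟨y, h⟩
      obtain ⟨p, h₁, h₂⟩ := exists_of_computes_cmp h
      obtain rfl := computes_unique h₁ (computes_cst (hK n) x 0)
      refine ⟨y, ?_⟩
      have := computes_unique (computes_zero_of_mup h₂) (hn p y)
      simpa using bit_eq_zero.1 this.symm
    · rintro hs
      have := Fact.mk (hK n)
      have hs' : ∃ s, A.Computes (K n) ((Tm.notp (t.bind ts)).eval A E) (A.pair x s) 0 :=
        hs.imp fun s h => bit_false (not_not.2 h) ▸ hn x s
      obtain ⟨s, h₁, h₂⟩ := exists_least (A := A) (fun s =>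
        A.Computes (K n) ((Tm.notp (t.bind ts)).eval A E) (A.pair x s) 0) hs'
      refine ⟨s, computes_cmp (hK n) (computes_cst (hK n) x 0) (computes_mup (hK n) h₁
        fun z hz => ⟨_, fun h => h₂ z hz ?_, hn x z⟩)⟩
      have := hn x z
      rwa [h] at this
  rw [← bit_congr key]
  have h7 : A.Runs (K (n + 1)) E (.cst (.num 7)) x (A.numeral 7) := runs_cst (hK _)
  have h0 : A.Runs (K (n + 1)) E (.cst (.num 0)) x (A.numeral 0) := runs_cst (hK _)
  have h1 : A.Runs (K (n + 1)) E (.cst (.mup (.notp (t.bind ts)))) x e := runs_cst (hK _)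
  exact runs_cmp (hK _) (runs_prp (hK _) h7 (runs_prp (hK _) h1 (runs_prp (hK _) h0
    (runs_idp (hK _))))) (computesSet_iff.1 (computesSet_orc (hK (n + 1))) _)

/-- A set is decided by searching for a number `b` with `ρ x b` and then testing `θ x b`. -/
theorem search (hΨ : ∀ i, UOp n (Ψ i))
    (ρ θ : ∀ A : L2Structure.{u}, (ℕ → Set A.Num) → A.Num → A.Num → Prop)
    [hρ : D0 (fun A V v => ρ A V (v 1) (v 0))] [hθ : D0 (fun A V v => θ A V (v 1) (v 0))]
    (h : ∀ (A : L2Structure.{u}) [Fact A.ModelsRCA0] [Fact A.OmegaJumpClosed] (V : ℕ → Set A.Num),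
      (∀ i, V i ∈ A.Sets) → (∀ i, tuple Ψ A V i ∈ A.Sets) → ∀ x,
      (∃ b, ρ A (tuple Ψ A V) x b) ∧
        ∀ b, ρ A (tuple Ψ A V) x b → (x ∈ Φ A V ↔ θ A (tuple Ψ A V) x b)) :
    UOp n Φ := by
  choose ts hts using hΨ
  obtain ⟨t, ht⟩ := exists_tm_formula ρ
  obtain ⟨t', ht'⟩ := exists_tm_formula θ
  refine ⟨.cmp (t'.bind ts) (.prp .idp (.mup (.notp (t.bind ts)))),
    fun A _ _ V K E hK hKJ hE => computesSet_iff.2 fun x => ?_⟩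
  have hV := fun i => hts i A V K E hK hKJ hE
  have hr : ∀ x s, A.Runs (K n) E (t.bind ts) (A.pair x s) (A.bit (ρ A (tuple Ψ A V) x s)) := by
    intro x s
    unfold Runs
    rw [Tm.eval_bind]
    exact ht A (tuple Ψ A V) (K n) _ (hK n) hV x s
  have hr' : ∀ x s, A.Runs (K n) E (t'.bind ts) (A.pair x s) (A.bit (θ A (tuple Ψ A V) x s)) := by
    intro x s
    unfold Runs
    rw [Tm.eval_bind]
    exact ht' A (tuple Ψ A V) (K n) _ (hK n) hV x s
  have hn := fun x s => runs_notp (hK n) (hr x s)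
  obtain ⟨hb, hx⟩ := h A V (fun i => (hE i).mem_sets (hK 0)) (fun i => (hV i).mem_sets (hK n)) x
  have := Fact.mk (hK n)
  obtain ⟨b, h₁, h₂⟩ := exists_least (A := A) (fun s =>
    A.Computes (K n) ((Tm.notp (t.bind ts)).eval A E) (A.pair x s) 0)
    (hb.imp fun s h => bit_false (not_not.2 h) ▸ hn x s)
  have hm : A.Runs (K n) E (.mup (.notp (t.bind ts))) x b :=
    computes_mup (hK n) h₁ fun z hz => ⟨_, fun h => h₂ z hz (h ▸ hn x z), hn x z⟩
  have hρb : ρ A (tuple Ψ A V) x b := by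
    simpa using bit_eq_zero.1 (computes_unique h₁ (hn x b)).symm
  rw [bit_congr (hx b hρb)]
  exact runs_cmp (hK n) (runs_prp (hK n) (runs_idp (hK n)) hm) (hr' x b)

/-- A relation given by a bounded formula in the values of the `Ψ i` costs no jump. -/
theorem bounded (hΨ : ∀ i, UOp n (Ψ i))
    (P : ∀ A : L2Structure.{u}, (ℕ → Set A.Num) → A.Num → Prop)
    [hP : D0 (fun A V v => P A V (v 1))] :
    UOp n (fun A V => {x | P A (tuple Ψ A V) x}) :=
  search hΨ (fun A V x b => b = b) (fun A V x b => P A V x)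
    fun A _ _ V _ _ x => ⟨⟨0, rfl⟩, fun _ _ => Iff.rfl⟩

theorem succ (h : UOp n Φ) : UOp (n + 1) Φ := by
  have := jump (Ψ := fun _ => Φ) (fun _ => h) (fun A V x s => x ∈ V 0)
  simpa [tuple] using this

end UOp

end

section

/-! ### Course-of-values recursion -/

instance D0.finMem (i j : ℕ) : D0.{u} (fun A V v => A.FinMem (v i) (v j)) :=
  D0.congr (Q := fun A V v => ∃ k, k < v j + 1 ∧ ∃ m, m < v j + 1 ∧ ∃ n, n < v j + 1 ∧
    v j = A.pair k (A.pair m n) ∧ v i < k ∧ ∃ q, q < n + 1 ∧ n = (m * (v i + 1) + 1) * q) (by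
    intro A _ V v
    constructor
    · rintro ⟨k, m, n, h, hi, q, hq⟩
      refine ⟨k, ?_, m, ?_, n, ?_, h, hi, q, ?_, hq⟩
      · rw [h]; exact num_lt_succ.2 (le_pair_left _ _)
      · rw [h]; exact num_lt_succ.2 ((le_pair_left _ _).trans (le_pair_right _ _))
      · rw [h]; exact num_lt_succ.2 ((le_pair_right _ _).trans (le_pair_right _ _))
      · rw [hq]; exact num_lt_succ.2 (num_le_iff.2 ⟨m * (v i + 1) * q, by ring⟩)
    · rintro ⟨k, -, m, -, n, -, h, hi, q, -, hq⟩
      exact ⟨k, m, n, h, hi, q, hq⟩)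

instance D0.isFinCode (i : ℕ) : D0.{u} (fun A V v => A.IsFinCode (v i)) :=
  D0.congr (Q := fun A V v => ∀ c, c < v i → ¬ ∀ k, k < v i → (A.FinMem k c ↔ A.FinMem k (v i))) (by
    intro A _ V v
    refine forall₂_congr fun c hc => not_congr ⟨fun h k _ => h k, fun h k => ?_⟩
    by_cases hk : k < v i
    · exact h k hk
    · exact iff_of_false (fun h' => hk (h'.lt.trans hc)) (fun h' => hk h'.lt))

/-- The set defined by course-of-values recursion from `G`: a number `t` belongs to it if and only
if `(w, t) ∈ G`, where `w` codes the set of its elements below `t`. -/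
def cvSet (A : L2Structure.{u}) (G : Set A.Num) : Set A.Num :=
  {t | ∃ w, A.FinMem t w ∧ ∀ i, i < t + 1 → (A.FinMem i w ↔ A.pair w i ∈ G)}

/-- Whether `(w, t)` belongs to `G` depends on the elements of `D_w` below `t` only. -/
def Extensional (A : L2Structure.{u}) (G : Set A.Num) : Prop :=
  ∀ w w' t, (∀ i, i < t → (A.FinMem i w ↔ A.FinMem i w')) → (A.pair w t ∈ G ↔ A.pair w' t ∈ G)

section CourseOfValues

variable {A : L2Structure.{u}} [hA : Fact A.ModelsRCA0] [hJ : Fact A.OmegaJumpClosed]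
  {G : Set A.Num}

theorem exists_cv_code (hG : G ∈ A.Sets) (he : A.Extensional G) (n : A.Num) :
    ∃ w, ∀ i, i < n → (A.FinMem i w ↔ A.pair w i ∈ G) := by
  have := Fact.mk hG
  refine ar_induction (fun n => ∃ w, ∀ i, i < n → (A.FinMem i w ↔ A.pair w i ∈ G))
    ⟨0, fun i hi => (hA.out.not_lt_zero _ hi).elim⟩ (fun n ⟨w, hw⟩ => ?_) n
  obtain ⟨w', -, hw'⟩ := exists_finCode (A := A)
    (fun i => i < n ∧ A.FinMem i w ∨ i = n ∧ A.pair w n ∈ G) (n + 1) (by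
      rintro i (⟨h, -⟩ | ⟨rfl, -⟩)
      · exact h.trans (num_lt_succ.2 le_rfl)
      · exact num_lt_succ.2 le_rfl)
  have hag : ∀ i, i < n → (A.FinMem i w ↔ A.FinMem i w') := fun i hi => by
    rw [hw' i]
    simp [hi, hi.ne]
  refine ⟨w', fun i hi => ?_⟩
  obtain hi | rfl := (num_lt_succ.1 hi).lt_or_eq
  · rw [← hag i hi, hw i hi]
    exact he w w' i fun j hj => hag j (hj.trans hi)
  · rw [hw', ← he w w' i hag]
    simp

theorem cv_code_unique (he : A.Extensional G) {w w' n : A.Num}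
    (hw : ∀ i, i < n → (A.FinMem i w ↔ A.pair w i ∈ G))
    (hw' : ∀ i, i < n → (A.FinMem i w' ↔ A.pair w' i ∈ G)) (i : A.Num) (hi : i < n) :
    A.FinMem i w ↔ A.FinMem i w' := by
  refine ar_strong_induction (fun i => i < n → (A.FinMem i w ↔ A.FinMem i w'))
    (fun i ih hi => ?_) i hi
  rw [hw i hi, hw' i hi]
  exact he w w' i fun j hj => ih j hj (hj.trans hi)

theorem mem_cvSet_iff (he : A.Extensional G) {w t : A.Num}
    (hw : ∀ i, i < t + 1 → (A.FinMem i w ↔ A.pair w i ∈ G)) : t ∈ A.cvSet G ↔ A.FinMem t w := by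
  refine ⟨fun ⟨w', h, hw'⟩ => ?_, fun h => ⟨w, h, hw⟩⟩
  exact (cv_code_unique he hw hw' t (num_lt_succ.2 le_rfl)).2 h

theorem mem_cvSet (hG : G ∈ A.Sets) (he : A.Extensional G) {w t : A.Num}
    (hw : ∀ i, i < t → (A.FinMem i w ↔ i ∈ A.cvSet G)) : t ∈ A.cvSet G ↔ A.pair w t ∈ G := by
  obtain ⟨w', hw'⟩ := exists_cv_code hG he (t + 1)
  rw [mem_cvSet_iff he hw', hw' t (num_lt_succ.2 le_rfl)]
  refine he w' w t fun i hi => ?_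
  rw [hw i hi]
  exact (mem_cvSet_iff he fun j hj => hw' j
    (hj.trans_le ((num_succ_le.2 hi).trans (num_lt_succ.2 le_rfl).le))).symm

theorem cvSet_mem (hG : G ∈ A.Sets) : A.cvSet G ∈ A.Sets := by
  have := Fact.mk hG
  exact Ar.setOf_mem (A := A) (fun t => ∃ w, A.FinMem t w ∧ ∀ i, i < t + 1 →
    (A.FinMem i w ↔ A.pair w i ∈ G))

end CourseOfValues

theorem UOp.cvSet {n : ℕ} {Φ : Op.{u}} (hΦ : UOp n Φ)
    (he : ∀ (A : L2Structure.{u}) [Fact A.ModelsRCA0] (V : ℕ → Set A.Num), A.Extensional (Φ A V)) :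
    UOp n (fun A V => A.cvSet (Φ A V)) := by
  refine UOp.search (Ψ := fun _ => Φ) (fun _ => hΦ)
    (fun A V t w => ∀ i, i < t + 1 → (A.FinMem i w ↔ A.pair w i ∈ V 0))
    (fun A V t w => A.FinMem t w) fun A _ _ V _ hV t => ⟨?_, fun w hw => ?_⟩
  · exact exists_cv_code (hV 0) (he A V) (t + 1)
  · exact mem_cvSet_iff (he A V) hw

/-! ### The prehomogeneous step -/

section Step

variable (A : L2Structure.{u})

/-- `D_c` is obtained from `D_s` by adjoining `t`. -/
def IsInsert (s t c : A.Num) : Prop := ∀ i, A.FinMem i c ↔ A.FinMem i s ∨ i = t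

/-- The coloring in a coded pair (coloring, domain). -/
def colorOf (Z : Set A.Num) : Set A.Num := {x | x + x ∈ Z}

/-- The domain in a coded pair (coloring, domain). -/
def domOf (Z : Set A.Num) : Set A.Num := {x | x + x + 1 ∈ Z}

/-- The set of the pairs `(s, t)` such that `D_s ∪ {t}` has the first color. -/
def extSet (C : Set A.Num) : Set A.Num :=
  {z | ∃ s t c, z = A.pair s t ∧ A.IsFinCode c ∧ A.IsInsert s t c ∧ c ∈ C}

/-- The number `t ∈ U` gives to `s` the first color, and to the numbers `s' < s` the colors
prescribed by `w`. -/
def Follows (R U : Set A.Num) (w s t : A.Num) : Prop :=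
  t ∈ U ∧ A.pair s t ∈ R ∧ ∀ s', s' < s → (A.pair s' t ∈ R ↔ A.FinMem s' w)

/-- The set of the `((w, s), b)` such that some `t > b` gives to `s` the first color, and to the
numbers below `s` the colors prescribed by `w`. -/
def followSet (R U : Set A.Num) : Set A.Num :=
  {z | ∃ t w s b, z = A.pair (A.pair w s) b ∧ b < t ∧ A.Follows R U w s t}

/-- The limit coloring: the number `s` gets the first color if infinitely many `t ∈ U` that respect
the limit coloring below `s` give it the first color. -/
def limitColor (Z : Set A.Num) : Set A.Num :=
  A.cvSet {z | ∀ b, A.pair z b ∈ A.followSet (A.extSet (A.colorOf Z)) (A.domOf Z)}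

/-- The set of the `(x, b)` such that some subset of `{0, …, x - 1}` has a canonical code that is at
least `b`. -/
def largeCodes : Set A.Num :=
  {z | ∃ c x b, z = A.pair x b ∧ b < c + 1 ∧ A.IsFinCode c ∧ ∀ i, A.FinMem i c → i < x}

/-- The number `t ∈ U` gives the color prescribed by `L` to every finite set each of whose elements
is bounded by some `l ∈ D_w`, `l < t`. -/
def Thin (R U L : Set A.Num) (w t : A.Num) : Prop :=
  t ∈ U ∧ ∀ s, A.IsFinCode s → (∀ i, A.FinMem i s → ∃ l, A.FinMem l w ∧ l < t ∧ i < l + 1) →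
    (A.pair s t ∈ R ↔ s ∈ L)

/-- A subset of `U` on which the color of `D_s ∪ {t}` is, for all `t` beyond some element of the
subset that bounds `D_s`, the limit color of `D_s`. -/
def thinSet (Z : Set A.Num) : Set A.Num :=
  A.cvSet {z | ∃ w t, z = A.pair w t ∧
    A.Thin (A.extSet (A.colorOf Z)) (A.domOf Z) (A.limitColor Z) w t}

/-- One step of the construction of a homogeneous set: the pair (limit coloring, thin domain). -/
def step (Z : Set A.Num) : Set A.Num := A.join (A.limitColor Z) (A.thinSet Z)

end Step

section StepSpec

variable {A : L2Structure.{u}} [hA : Fact A.ModelsRCA0]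

theorem pair_mem_followSet {R U : Set A.Num} {w s b : A.Num} :
    A.pair (A.pair w s) b ∈ A.followSet R U ↔ ∃ t, b < t ∧ A.Follows R U w s t := by
  constructor
  · rintro ⟨t, w, s, b, e, h⟩
    simp only [pair_inj] at e
    obtain ⟨⟨rfl, rfl⟩, rfl⟩ := e
    exact ⟨t, h⟩
  · rintro ⟨t, h⟩
    exact ⟨t, w, s, b, rfl, h⟩

theorem extensional_follow (R U : Set A.Num) :
    A.Extensional {z | ∀ b, A.pair z b ∈ A.followSet R U} := by
  intro w w' t h
  simp only [Set.mem_ofPred_eq, pair_mem_followSet]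
  refine forall_congr' fun b => exists_congr fun t' => and_congr_right fun _ =>
    and_congr_right fun _ => and_congr_right fun _ => forall₂_congr fun s hs => ?_
  rw [h s hs]

theorem pair_mem_thin {R U L : Set A.Num} {w t : A.Num} :
    A.pair w t ∈ {z | ∃ w t, z = A.pair w t ∧ A.Thin R U L w t} ↔ A.Thin R U L w t := by
  constructor
  · rintro ⟨w, t, e, h⟩
    obtain ⟨rfl, rfl⟩ := pair_inj.1 e
    exact h
  · exact fun h => ⟨w, t, rfl, h⟩

theorem extensional_thin (R U L : Set A.Num) :
    A.Extensional {z | ∃ w t, z = A.pair w t ∧ A.Thin R U L w t} := by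
  intro w w' t h
  rw [pair_mem_thin, pair_mem_thin]
  refine and_congr_right fun _ => forall₂_congr fun s _ => imp_congr_left ?_
  refine forall₂_congr fun i _ => exists_congr fun l => ?_
  constructor
  · rintro ⟨h₁, h₂, h₃⟩
    exact ⟨(h l h₂).1 h₁, h₂, h₃⟩
  · rintro ⟨h₁, h₂, h₃⟩
    exact ⟨(h l h₂).2 h₁, h₂, h₃⟩

variable [hJ : Fact A.OmegaJumpClosed]

theorem exists_insert (s t : A.Num) : ∃ c, A.IsFinCode c ∧ A.IsInsert s t c := by
  refine exists_finCode (fun i => A.FinMem i s ∨ i = t) (s + t + 1) ?_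
  rintro i (h | rfl)
  · exact num_lt_succ.2 (h.lt.le.trans le_self_add)
  · exact num_lt_succ.2 le_add_self

theorem pair_mem_extSet {C : Set A.Num} {s t c : A.Num} (hc : A.IsFinCode c)
    (h : A.IsInsert s t c) : A.pair s t ∈ A.extSet C ↔ c ∈ C := by
  constructor
  · rintro ⟨s, t, c', e, hc', h', hC⟩
    obtain ⟨rfl, rfl⟩ := pair_inj.1 e
    rwa [hc.ext hc' fun i => (h i).trans (h' i).symm]
  · exact fun hC => ⟨s, t, c, rfl, hc, h, hC⟩

/-- The canonical codes of the subsets of `{0, …, x - 1}` are bounded. -/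
theorem exists_code_bound (x : A.Num) :
    ∃ b, ∀ c, A.IsFinCode c → (∀ i, A.FinMem i c → i < x) → c < b := by
  refine ar_induction (fun x => ∃ b, ∀ c, A.IsFinCode c → (∀ i, A.FinMem i c → i < x) → c < b)
    ?_ ?_ x
  · obtain ⟨c₀, h₀, h⟩ := exists_finCode (A := A) (fun i => i < 0) 0 (fun i h => h)
    refine ⟨c₀ + 1, fun c hc hx => num_lt_succ.2 (le_of_eq (hc.ext h₀ fun i => ?_))⟩
    rw [h]
    exact ⟨hx i, fun h => (hA.out.not_lt_zero _ h).elim⟩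
  · rintro x ⟨b, hb⟩
    obtain ⟨b', hb'⟩ := exists_bound (A := A) (fun s c => A.IsFinCode c ∧
      ∀ i, A.FinMem i c ↔ A.FinMem i s ∨ i = x) b fun s _ => exists_insert s x
    refine ⟨b + b', fun c hc hx => ?_⟩
    by_cases hxc : A.FinMem x c
    · obtain ⟨s, hs, h⟩ := exists_finCode (A := A) (fun i => A.FinMem i c ∧ i < x) x (fun i h => h.2)
      obtain ⟨c', hc'b, hc', h'⟩ := hb' s (hb s hs fun i hi => ((h i).1 hi).2)
      obtain rfl : c = c' := hc.ext hc' fun i => by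
        rw [h', h]
        constructor
        · intro hi
          exact (num_lt_succ.1 (hx i hi)).lt_or_eq.imp (fun h => ⟨hi, h⟩) fun h => h
        · rintro (h | rfl)
          exacts [h.1, hxc]
      exact hc'b.trans_le le_add_self
    · refine (hb c hc fun i hi => ?_).trans_le le_self_add
      exact (num_lt_succ.1 (hx i hi)).lt_of_ne fun e => hxc (e ▸ hi)

variable {Z : Set A.Num}

theorem colorOf_mem (hZ : Z ∈ A.Sets) : A.colorOf Z ∈ A.Sets :=
  have := Fact.mk hZ
  Ar.setOf_mem (A := A) (fun x => x + x ∈ Z)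

theorem domOf_mem (hZ : Z ∈ A.Sets) : A.domOf Z ∈ A.Sets :=
  have := Fact.mk hZ
  Ar.setOf_mem (A := A) (fun x => x + x + 1 ∈ Z)

theorem extSet_mem {C : Set A.Num} (hC : C ∈ A.Sets) : A.extSet C ∈ A.Sets := by
  have := Fact.mk hC
  exact Ar.setOf_mem (A := A) (fun z => ∃ s t c, z = A.pair s t ∧ A.IsFinCode c ∧
    (∀ i, A.FinMem i c ↔ A.FinMem i s ∨ i = t) ∧ c ∈ C)

theorem follow_mem {R U : Set A.Num} (hR : R ∈ A.Sets) (hU : U ∈ A.Sets) :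
    {z | ∀ b, A.pair z b ∈ A.followSet R U} ∈ A.Sets := by
  have := Fact.mk hR
  have := Fact.mk hU
  exact Ar.setOf_mem (A := A) (fun z => ∀ b', ∃ t w s b, A.pair z b' = A.pair (A.pair w s) b ∧
    b < t ∧ t ∈ U ∧ A.pair s t ∈ R ∧ ∀ s', s' < s → (A.pair s' t ∈ R ↔ A.FinMem s' w))

theorem limitColor_mem (hZ : Z ∈ A.Sets) : A.limitColor Z ∈ A.Sets :=
  cvSet_mem (follow_mem (extSet_mem (colorOf_mem hZ)) (domOf_mem hZ))

theorem thin_mem {R U L : Set A.Num} (hR : R ∈ A.Sets) (hU : U ∈ A.Sets) (hL : L ∈ A.Sets) :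
    {z | ∃ w t, z = A.pair w t ∧ A.Thin R U L w t} ∈ A.Sets := by
  have := Fact.mk hR
  have := Fact.mk hU
  have := Fact.mk hL
  exact Ar.setOf_mem (A := A) (fun z => ∃ w t, z = A.pair w t ∧ t ∈ U ∧ ∀ s, A.IsFinCode s →
    (∀ i, A.FinMem i s → ∃ l, A.FinMem l w ∧ l < t ∧ i < l + 1) → (A.pair s t ∈ R ↔ s ∈ L))

theorem thinSet_mem (hZ : Z ∈ A.Sets) : A.thinSet Z ∈ A.Sets :=
  cvSet_mem (thin_mem (extSet_mem (colorOf_mem hZ)) (domOf_mem hZ) (limitColor_mem hZ))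

/-- Infinitely many elements of the domain respect the limit coloring below any given bound. -/
theorem exists_respects (hZ : Z ∈ A.Sets) (hinf : A.IsInfinite (A.domOf Z)) (c b : A.Num) :
    ∃ t, b < t ∧ t ∈ A.domOf Z ∧
      ∀ s, s < c → (A.pair s t ∈ A.extSet (A.colorOf Z) ↔ s ∈ A.limitColor Z) := by
  have hU := domOf_mem hZ
  have hR := extSet_mem (colorOf_mem hZ)
  have hL := limitColor_mem hZ
  have hc : ∀ w t, (∀ i, i < t → (A.FinMem i w ↔ i ∈ A.limitColor Z)) → _ := fun w t hw =>
    mem_cvSet (follow_mem hR hU) (extensional_follow _ _) hw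
  change ∀ w t, (∀ i, i < t → (A.FinMem i w ↔ i ∈ A.limitColor Z)) →
    (t ∈ A.limitColor Z ↔ _) at hc
  generalize A.domOf Z = U at *
  generalize A.extSet (A.colorOf Z) = R at *
  generalize A.limitColor Z = L at *
  have := Fact.mk hR
  have := Fact.mk hU
  have := Fact.mk hL
  refine ar_induction (fun c => ∀ b, ∃ t, b < t ∧ t ∈ U ∧ ∀ s, s < c → (A.pair s t ∈ R ↔ s ∈ L))
    (fun b => ?_) (fun c ih b => ?_) c b
  · obtain ⟨t, ht, hb⟩ := hinf b
    exact ⟨t, hb, ht, fun s hs => (hA.out.not_lt_zero _ hs).elim⟩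
  · have hsucc : ∀ {t}, (∀ s, s < c → (A.pair s t ∈ R ↔ s ∈ L)) → (A.pair c t ∈ R ↔ c ∈ L) →
        ∀ s, s < c + 1 → (A.pair s t ∈ R ↔ s ∈ L) := by
      intro t h₁ h₂ s hs
      obtain hs | rfl := (num_lt_succ.1 hs).lt_or_eq
      exacts [h₁ s hs, h₂]
    obtain ⟨w, -, hw⟩ := exists_finCode (A := A) (fun i => i ∈ L ∧ i < c) c (fun i h => h.2)
    have hw' : ∀ i, i < c → (A.FinMem i w ↔ i ∈ L) := fun i hi => by simp [hw i, hi]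
    have hcw := hc w c hw'
    simp only [Set.mem_ofPred_eq, pair_mem_followSet] at hcw
    by_cases hcL : c ∈ L
    · obtain ⟨t, hb, htU, htR, ht⟩ := hcw.1 hcL b
      exact ⟨t, hb, htU, hsucc (fun s hs => (ht s hs).trans (hw' s hs)) (iff_of_true htR hcL)⟩
    · obtain ⟨b', hb'⟩ := not_forall.1 (mt hcw.2 hcL)
      obtain ⟨t, hb, htU, ht⟩ := ih (b + b')
      refine ⟨t, (le_self_add).trans_lt hb, htU, hsucc ht (iff_of_false (fun htR => hb' ?_) hcL)⟩
      exact ⟨t, (le_add_self).trans_lt hb, htU, htR, fun s hs => (ht s hs).trans (hw' s hs).symm⟩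

theorem mem_thinSet (hZ : Z ∈ A.Sets) (t : A.Num) : t ∈ A.thinSet Z ↔ t ∈ A.domOf Z ∧
    ∀ s, A.IsFinCode s → (∀ i, A.FinMem i s → ∃ l ∈ A.thinSet Z, l < t ∧ i ≤ l) →
      (A.pair s t ∈ A.extSet (A.colorOf Z) ↔ s ∈ A.limitColor Z) := by
  have := Fact.mk (thinSet_mem hZ)
  obtain ⟨w, -, hw⟩ := exists_finCode (A := A) (fun i => i ∈ A.thinSet Z ∧ i < t) t (fun i h => h.2)
  have hw' : ∀ i, i < t → (A.FinMem i w ↔ i ∈ A.thinSet Z) := fun i hi => by simp [hw i, hi]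
  rw [thinSet, mem_cvSet (thin_mem (extSet_mem (colorOf_mem hZ)) (domOf_mem hZ) (limitColor_mem hZ))
    (extensional_thin _ _ _) hw', pair_mem_thin]
  refine and_congr_right fun _ => forall₂_congr fun s _ => imp_congr_left ?_
  refine forall₂_congr fun i _ => exists_congr fun l => ?_
  rw [num_lt_succ, hw l]
  exact ⟨fun h => ⟨h.1.1, h.2⟩, fun h => ⟨⟨h.1, h.2.1⟩, h.2⟩⟩

theorem thinSet_subset (hZ : Z ∈ A.Sets) : A.thinSet Z ⊆ A.domOf Z :=
  fun t ht => ((mem_thinSet hZ t).1 ht).1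

theorem isInfinite_thinSet (hZ : Z ∈ A.Sets) (hinf : A.IsInfinite (A.domOf Z)) :
    A.IsInfinite (A.thinSet Z) := by
  intro n
  by_contra! hn
  obtain ⟨b, hb⟩ := exists_code_bound (n + 1)
  obtain ⟨t, hnt, htU, ht⟩ := exists_respects hZ hinf b n
  refine (hn t ((mem_thinSet hZ t).2 ⟨htU, fun s hs hi => ht s (hb s hs fun i hi' => ?_)⟩)).not_gt hnt
  obtain ⟨l, hl, -, hil⟩ := hi i hi'
  exact num_lt_succ.2 (hil.trans (hn l hl))

theorem mem_limitColor_iff (hZ : Z ∈ A.Sets) {s t c : A.Num} (hs : A.IsFinCode s)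
    (ht : t ∈ A.thinSet Z) (hi : ∀ i, A.FinMem i s → ∃ l ∈ A.thinSet Z, l < t ∧ i ≤ l)
    (hc : A.IsFinCode c) (hins : A.IsInsert s t c) : c ∈ A.colorOf Z ↔ s ∈ A.limitColor Z := by
  rw [← ((mem_thinSet hZ t).1 ht).2 s hs hi, pair_mem_extSet hc hins]

end StepSpec

end

section

/-! ### The step is uniformly computable from two jumps -/

namespace UOp

theorem congr {n : ℕ} {Φ Φ' : Op.{u}} (hΦ : UOp n Φ)
    (h : ∀ (A : L2Structure.{u}) [Fact A.ModelsRCA0] (V : ℕ → Set A.Num), Φ A V = Φ' A V) :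
    UOp n Φ' := by
  obtain ⟨t, ht⟩ := hΦ
  exact ⟨t, fun A _ _ V K E h₁ h₂ h₃ => h A V ▸ ht A V K E h₁ h₂ h₃⟩

theorem forall_pushVar {n : ℕ} {Φ : Op.{u}} {Ψ : ℕ → Op.{u}} (hΦ : UOp n Φ) (hΨ : ∀ i, UOp n (Ψ i)) :
    ∀ i, UOp n (pushVar Φ Ψ i)
  | 0 => hΦ
  | i + 1 => hΨ i

theorem colorOf : UOp.{u} 0 (fun A V => A.colorOf (V 0)) :=
  bounded proj (fun A V x => x + x ∈ V 0)

theorem domOf : UOp.{u} 0 (fun A V => A.domOf (V 0)) :=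
  bounded proj (fun A V x => x + x + 1 ∈ V 0)

theorem extSet : UOp.{u} 0 (fun A V => A.extSet (A.colorOf (V 0))) :=
  search (Ψ := fun _ A V => A.colorOf (V 0)) (fun _ => colorOf)
    (fun A V z c => ∀ s, s < z + 1 → ∀ t, t < z + 1 → z = A.pair s t → A.IsFinCode c ∧
      (∀ i, i < c + 1 → A.FinMem i c → A.FinMem i s ∨ i = t) ∧
      (∀ i, i < s + 1 → A.FinMem i s → A.FinMem i c) ∧ A.FinMem t c)
    (fun A V z c => ∃ s, s < z + 1 ∧ ∃ t, t < z + 1 ∧ z = A.pair s t ∧ c ∈ V 0) (by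
      intro A _ _ V _ _ z
      by_cases hz : ∃ s t, z = A.pair s t
      · obtain ⟨s, t, rfl⟩ := hz
        have hs : s < A.pair s t + 1 := num_lt_succ.2 (le_pair_left _ _)
        have ht : t < A.pair s t + 1 := num_lt_succ.2 (le_pair_right _ _)
        constructor
        · obtain ⟨c, hc, h⟩ := exists_insert s t
          refine ⟨c, fun s' _ t' _ e => ?_⟩
          obtain ⟨rfl, rfl⟩ := pair_inj.1 e
          exact ⟨hc, fun i _ => (h i).1, fun i _ hi => (h i).2 (.inl hi), (h t).2 (.inr rfl)⟩
        · intro c hc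
          obtain ⟨hc, h₁, h₂, h₃⟩ := hc s hs t ht rfl
          have hins : A.IsInsert s t c := fun i =>
            ⟨fun hi => h₁ i (num_lt_succ.2 hi.lt.le) hi, fun hi => hi.elim
              (fun hi => h₂ i (num_lt_succ.2 hi.lt.le) hi) fun e => e ▸ h₃⟩
          refine (pair_mem_extSet hc hins).trans
            ⟨fun h => ⟨s, hs, t, ht, rfl, h⟩, fun ⟨_, _, _, _, _, h⟩ => h⟩
      · constructor
        · exact ⟨0, fun s _ t _ e => (hz ⟨s, t, e⟩).elim⟩
        · refine fun c _ => iff_of_false ?_ ?_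
          · rintro ⟨s, t, _, e, -⟩
            exact hz ⟨s, t, e⟩
          · rintro ⟨s, -, t, -, e, -⟩
            exact hz ⟨s, t, e⟩)

theorem followSet :
    UOp.{u} 1 (fun A V => A.followSet (A.extSet (A.colorOf (V 0))) (A.domOf (V 0))) :=
  (jump (forall_pushVar extSet fun _ => domOf)
    (fun A V z t => ∃ w, w < z + 1 ∧ ∃ s, s < z + 1 ∧ ∃ b, b < z + 1 ∧ z = A.pair (A.pair w s) b ∧
      b < t ∧ t ∈ V 1 ∧ A.pair s t ∈ V 0 ∧ ∀ s', s' < s → (A.pair s' t ∈ V 0 ↔ A.FinMem s' w))).congr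
    (by
      intro A _ V
      ext z
      refine exists_congr fun t => ⟨?_, ?_⟩
      · rintro ⟨w, -, s, -, b, -, e, h⟩
        exact ⟨w, s, b, e, h⟩
      · rintro ⟨w, s, b, rfl, h⟩
        exact ⟨w, num_lt_succ.2 ((le_pair_left _ _).trans (le_pair_left _ _)),
          s, num_lt_succ.2 ((le_pair_right _ _).trans (le_pair_left _ _)),
          b, num_lt_succ.2 (le_pair_right _ _), rfl, h⟩)

theorem limitColor : UOp.{u} 2 (fun A V => A.limitColor (V 0)) := by
  have h₁ := jump (fun _ => followSet.{u}) (fun A V z b => ¬ A.pair z b ∈ V 0)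
  have h₂ := (bounded (fun _ => h₁) (fun A V z => ¬ z ∈ V 0)).congr
    (Φ' := fun A V => {z | ∀ b, A.pair z b ∈
      A.followSet (A.extSet (A.colorOf (V 0))) (A.domOf (V 0))}) (by
    intro A _ V
    ext z
    simp [tuple])
  exact h₂.cvSet fun A _ V => extensional_follow _ _

theorem largeCodes : UOp.{u} 1 (fun A V => A.largeCodes) :=
  (jump (Ψ := fun i A V => V i) proj
    (fun A V z c => ∃ x, x < z + 1 ∧ ∃ b, b < z + 1 ∧ z = A.pair x b ∧ b < c + 1 ∧ A.IsFinCode c ∧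
      ∀ i, i < c + 1 → A.FinMem i c → i < x)).congr
    (by
      intro A _ V
      ext z
      refine exists_congr fun c => ⟨?_, ?_⟩
      · rintro ⟨x, -, b, -, e, h, hc, hi⟩
        exact ⟨x, b, e, h, hc, fun i h => hi i (num_lt_succ.2 h.lt.le) h⟩
      · rintro ⟨x, b, rfl, h, hc, hi⟩
        exact ⟨x, num_lt_succ.2 (le_pair_left _ _), b, num_lt_succ.2 (le_pair_right _ _), rfl, h, hc,
          fun i _ h => hi i h⟩)

theorem thinSet : UOp.{u} 2 (fun A V => A.thinSet (V 0)) := by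
  have h₁ : UOp.{u} 2 (fun A V => {z | ∃ w t, z = A.pair w t ∧
      A.Thin (A.extSet (A.colorOf (V 0))) (A.domOf (V 0)) (A.limitColor (V 0)) w t}) :=
    search (forall_pushVar extSet.succ.succ (forall_pushVar domOf.succ.succ
      (forall_pushVar limitColor fun _ => largeCodes.succ)))
      (fun A V z b => ∀ w, w < z + 1 → ∀ t, t < z + 1 → z = A.pair w t → ¬ A.pair t b ∈ V 3)
      (fun A V z b => ∃ w, w < z + 1 ∧ ∃ t, t < z + 1 ∧ z = A.pair w t ∧ t ∈ V 1 ∧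
        ∀ s, s < b → A.IsFinCode s → (∀ i, i < s → A.FinMem i s →
          ∃ l, l < w ∧ A.FinMem l w ∧ l < t ∧ i < l + 1) → (A.pair s t ∈ V 0 ↔ s ∈ V 2)) (by
      intro A _ _ V _ _ z
      by_cases hz : ∃ w t, z = A.pair w t
      · obtain ⟨w, t, rfl⟩ := hz
        have hw : w < A.pair w t + 1 := num_lt_succ.2 (le_pair_left _ _)
        have ht : t < A.pair w t + 1 := num_lt_succ.2 (le_pair_right _ _)
        constructor
        · obtain ⟨b, hb⟩ := exists_code_bound t
          refine ⟨b, fun w' _ t' _ e => ?_⟩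
          obtain ⟨rfl, rfl⟩ := pair_inj.1 e
          rintro ⟨c, x, b', e, hbc, hc, hx⟩
          obtain ⟨rfl, rfl⟩ := pair_inj.1 e
          exact (num_lt_succ.1 hbc).not_gt (hb c hc hx)
        · intro b hb
          have hb : A.pair t b ∉ A.largeCodes := hb w hw t ht rfl
          refine pair_mem_thin.trans ?_
          constructor
          · rintro ⟨h, h'⟩
            refine ⟨w, hw, t, ht, rfl, h, fun s _ hs hi => h' s hs fun i his => ?_⟩
            obtain ⟨l, -, h⟩ := hi i his.lt his
            exact ⟨l, h⟩
          · rintro ⟨w', -, t', -, e, h, h'⟩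
            obtain ⟨rfl, rfl⟩ := pair_inj.1 e
            refine ⟨h, fun s hs hi => h' s ?_ hs fun i _ his => ?_⟩
            · by_contra hlt
              refine hb ⟨s, t, b, rfl, num_lt_succ.2 (not_lt.1 hlt), hs, fun i his => ?_⟩
              obtain ⟨l, -, hl, hil⟩ := hi i his
              exact (num_lt_succ.1 hil).trans_lt hl
            · obtain ⟨l, hl, h⟩ := hi i his
              exact ⟨l, hl.lt, hl, h⟩
      · constructor
        · exact ⟨0, fun w _ t _ e => (hz ⟨w, t, e⟩).elim⟩
        · refine fun c _ => iff_of_false ?_ ?_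
          · rintro ⟨w, t, e, -⟩
            exact hz ⟨w, t, e⟩
          · rintro ⟨w, -, t, -, e, -⟩
            exact hz ⟨w, t, e⟩)
  exact h₁.cvSet fun A _ V => extensional_thin _ _ _

theorem step : UOp.{u} 2 (fun A V => A.step (V 0)) :=
  (bounded (forall_pushVar limitColor fun _ => thinSet)
    (fun A V z => (∃ x, x < z + 1 ∧ x ∈ V 0 ∧ z = x + x) ∨
      ∃ x, x < z + 1 ∧ x ∈ V 1 ∧ z = x + x + 1)).congr
    (by
      intro A _ V
      ext z
      refine or_congr ⟨fun ⟨x, _, h⟩ => ⟨x, h⟩, ?_⟩ ⟨fun ⟨x, _, h⟩ => ⟨x, h⟩, ?_⟩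
      · rintro ⟨x, h, rfl⟩
        exact ⟨x, num_lt_succ.2 le_self_add, h, rfl⟩
      · rintro ⟨x, h, rfl⟩
        exact ⟨x, num_lt_succ.2 (le_self_add.trans le_self_add), h, rfl⟩)

end UOp

end

section

/-! ### Iterated templates and iterated jumps -/

namespace Tm

/-- A template that, on input `x`, outputs the value of `t` with `x` in all holes. -/
def quote : Tm → Tm
  | hole _ => idp
  | num k => cst (num k)
  | pair s t => prp s.quote t.quote

/-- The standard number that a template denotes when `0` is put in its holes. -/
def value : Tm → ℕ
  | hole _ => 0
  | num k => k
  | pair s t => (s.value + t.value) * (s.value + t.value) + s.value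

/-- The program that, on input `(b, i)`, outputs the result of `i` iterations of the template `t`,
starting from the oracle program. -/
def iterp (t : Tm) : Tm := prc (cst orc) (cmp t.quote (cmp sndp sndp))

end Tm

section Jumps

variable {A : L2Structure.{u}} [hA : Fact A.ModelsRCA0]

theorem numeral_value (t : Tm) : A.numeral t.value = t.eval A fun _ => 0 := by
  induction t with
  | hole i => rfl
  | num k => rfl
  | pair s t hs ht =>
    simp only [numeral_eq_cast] at hs ht
    simp [Tm.value, Tm.eval, L2Structure.pair, numeral_eq_cast, ← hs, ← ht]

variable [hJ : Fact A.OmegaJumpClosed]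

theorem runs_quote {K : Set A.Num} {E : ℕ → A.Num} (hK : K ∈ A.Sets) (t : Tm) (x : A.Num) :
    A.Runs K E t.quote x (t.eval A fun _ => x) := by
  induction t with
  | hole i => exact runs_idp hK
  | num k => exact runs_cst hK
  | pair s t hs ht => exact runs_prp hK hs ht

theorem empty_mem : (∅ : Set A.Num) ∈ A.Sets := by
  simpa using Ar.setOf_mem (A := A) (fun n => ¬ n = n)

/-- The iteration of a program template along the numbers of `A`. -/
theorem exists_iterate (t : Tm) : ∃ e : A.Num → A.Num, ArF A e ∧ e 0 = A.orc ∧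
    (∀ i, e (i + 1) = t.eval A fun _ => e i) ∧
    ∀ i, A.Runs ∅ (fun _ => 0) t.iterp (A.pair 0 i) (e i) := by
  have h0 := empty_mem (A := A)
  have := Fact.mk h0
  have htot := exists_runs_prc (x := 0) (f := .cst .orc) (g := .cmp t.quote (.cmp .sndp .sndp))
    (E := fun _ => 0) h0 ⟨_, runs_cst h0⟩ fun n p =>
      ⟨_, runs_cmp h0 (runs_cmp h0 (runs_sndp h0) (runs_sndp h0)) (runs_quote h0 t p)⟩
  choose e he using htot
  refine ⟨e, .of_graph (Ar.congr (Q := fun q : A.Num × A.Num =>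
    A.Computes ∅ (t.iterp.eval A fun _ => 0) (A.pair 0 q.1) q.2) fun q =>
      ⟨fun h => h ▸ he q.1, fun h => computes_unique h (he q.1)⟩), ?_, fun i => ?_, he⟩
  · exact computes_unique (he 0) (runs_prc_zero h0 (runs_cst h0))
  · exact computes_unique (he (i + 1)) (runs_prc_succ h0 (he i)
      (runs_cmp h0 (runs_cmp h0 (runs_sndp h0) (runs_sndp h0)) (runs_quote h0 t _)))

theorem IsJump.unique {X Y Y' : Set A.Num} (h : A.IsJump X Y) (h' : A.IsJump X Y') : Y = Y' :=
  Set.ext fun e => (h e).trans (h' e).symm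

theorem IsOmegaJump.sect_zero {X Y : Set A.Num} (h : A.IsOmegaJump X Y) : A.sect Y 0 = X := by
  obtain ⟨Z, -, h₀, -, h₁⟩ := h.2 0
  rw [← h₁, h₀]

theorem IsOmegaJump.isJump_sect {X Y : Set A.Num} (h : A.IsOmegaJump X Y) (n : A.Num) :
    A.IsJump (A.sect Y n) (A.sect Y (n + 1)) := by
  obtain ⟨Z, hZ, h₀, hs, h₁⟩ := h.2 n
  obtain ⟨Z', hZ', h₀', hs', h₁'⟩ := h.2 (n + 1)
  have := Fact.mk hZ
  have := Fact.mk hZ'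
  have key := ar_induction (fun i => i ≤ n → ∀ j, A.pair i j ∈ Z ↔ A.pair i j ∈ Z')
    (fun _ j => Set.ext_iff.1 (h₀.trans h₀'.symm) j) (fun i ih hi j => by
      have hlt : i < n := num_succ_le.1 hi
      have e : A.sect Z i = A.sect Z' i := Set.ext (ih hlt.le)
      have h' := hs' i (hlt.trans (num_lt_succ.2 le_rfl))
      rw [← e] at h'
      exact Set.ext_iff.1 ((hs i hlt).unique h') j) n le_rfl
  rw [← h₁, ← h₁', show A.sect Z n = A.sect Z' n from Set.ext key]
  exact hs' n (num_lt_succ.2 le_rfl)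

end Jumps

/-! ### Iteration of the step -/

section Iterate

variable {A : L2Structure.{u}} [hA : Fact A.ModelsRCA0]

theorem add_self_inj {x y : A.Num} : x + x = y + y ↔ x = y := by
  refine ⟨fun h => ?_, fun h => h ▸ rfl⟩
  obtain h' | h' | h' := lt_trichotomy x y
  · exact ((add_lt_add h' h').ne h).elim
  · exact h'
  · exact ((add_lt_add h' h').ne h.symm).elim

theorem add_self_ne_succ (x y : A.Num) : x + x ≠ y + y + 1 := by
  intro h
  obtain h' | h' := le_or_gt x y
  · exact ((add_le_add h' h').trans_lt (num_lt_succ.2 le_rfl)).ne h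
  · refine (lt_of_lt_of_le ?_ (add_le_add (num_succ_le.2 h') (num_succ_le.2 h'))).ne h.symm
    rw [show y + 1 + (y + 1) = y + y + 1 + 1 by ring]
    exact num_lt_succ.2 le_rfl

theorem colorOf_join (C U : Set A.Num) : A.colorOf (A.join C U) = C := by
  ext x
  constructor
  · rintro (⟨y, hy, e⟩ | ⟨y, hy, e⟩)
    · exact add_self_inj.1 e ▸ hy
    · exact (add_self_ne_succ _ _ e).elim
  · exact fun h => .inl ⟨x, h, rfl⟩

theorem domOf_join (C U : Set A.Num) : A.domOf (A.join C U) = U := by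
  ext x
  constructor
  · rintro (⟨y, hy, e⟩ | ⟨y, hy, e⟩)
    · exact (add_self_ne_succ _ _ e.symm).elim
    · exact add_self_inj.1 (hA.out.add_one_inj _ _ e) ▸ hy
  · exact fun h => .inr ⟨x, h, rfl⟩

variable [hJ : Fact A.OmegaJumpClosed]

theorem join_mem {C U : Set A.Num} (hC : C ∈ A.Sets) (hU : U ∈ A.Sets) : A.join C U ∈ A.Sets := by
  have := Fact.mk hC
  have := Fact.mk hU
  exact Ar.setOf_mem (A := A) (fun z => (∃ x, x ∈ C ∧ z = x + x) ∨ ∃ y, y ∈ U ∧ z = y + y + 1)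

/-- The sections of `S` arise from `Z` by iteration of the step. -/
structure IsStepSeq (A : L2Structure.{u}) (Z S : Set A.Num) : Prop where
  mem : S ∈ A.Sets
  zero : A.sect S 0 = Z
  succ : ∀ i, A.sect S (i + 1) = A.step (A.sect S i)

/-- A template for an operator computable from `n` jumps, applied to a program that computes a set
from a section of an `ω`-jump. -/
theorem IsOmegaJump.computesSet {X Y V : Set A.Num} (h : A.IsOmegaJump X Y) (hY : Y ∈ A.Sets)
    {n : ℕ} {Φ : Op.{u}} {t : Tm} (ht : HasTemplate n Φ t)
    {m e : A.Num} (he : A.ComputesSet (A.sect Y m) e V) :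
    A.ComputesSet (A.sect Y (m + n)) (t.eval A fun _ => e) (Φ A fun _ => V) := by
  refine ht A (fun _ => V) (fun k => A.sect Y (m + k)) (fun _ => e) (fun k => sect_mem hY _)
    (fun k => ?_) fun _ => ?_
  · have := h.isJump_sect (m + k)
    rwa [add_assoc, ← Nat.cast_succ] at this
  · simpa using he

/-- The step can be iterated along the numbers of `A`, because the programs for the iterates are
computable from the number of iterations. -/
theorem exists_isStepSeq {Z Y : Set A.Num} (hY : Y ∈ A.Sets) (h : A.IsOmegaJump Z Y) {t : Tm}
    (ht : HasTemplate.{u} 2 (fun A V => A.step (V 0)) t)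
    {e : A.Num → A.Num} (hAr : ArF A e) (he₀ : e 0 = A.orc)
    (he : ∀ i, e (i + 1) = t.eval A fun _ => e i) :
    ∃ S, A.IsStepSeq Z S ∧ ∀ i, A.ComputesSet (A.sect Y (i + i)) (e i) (A.sect S i) := by
  have := Fact.mk hY
  have := fun {β : Type u} [Coded A β] (f : β → A.Num) [ArF A f] => ArF.comp' (A := A) e f
  have hS := Ar.setOf_mem (A := A) (fun z => ∃ i x, z = A.pair i x ∧
    A.Computes (A.sect Y (i + i)) (e i) x 1)
  set S := {z | ∃ i x, z = A.pair i x ∧ A.Computes (A.sect Y (i + i)) (e i) x 1} with hSdef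
  have hmem : ∀ i x, x ∈ A.sect S i ↔ A.Computes (A.sect Y (i + i)) (e i) x 1 := by
    intro i x
    constructor
    · rintro ⟨i, x, e, h⟩
      obtain ⟨rfl, rfl⟩ := pair_inj.1 e
      exact h
    · exact fun h => ⟨i, x, rfl, h⟩
  have heq : ∀ {i W}, A.ComputesSet (A.sect Y (i + i)) (e i) W → A.sect S i = W :=
    fun h => Set.ext fun x => (hmem _ x).trans (h.mem_iff x).symm
  have htwo : ∀ i : A.Num, i + 1 + (i + 1) = i + i + (2 : ℕ) := fun i => by push_cast; ring
  have hstep : ∀ {i}, A.ComputesSet (A.sect Y (i + i)) (e i) (A.sect S i) →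
      A.ComputesSet (A.sect Y (i + 1 + (i + 1))) (e (i + 1)) (A.step (A.sect S i)) := by
    intro i hi
    rw [he, htwo]
    exact h.computesSet hY (Φ := fun A V => A.step (V 0)) ht hi
  have hzero : A.ComputesSet (A.sect Y (0 + 0)) (e 0) Z := by
    rw [he₀, add_zero, h.sect_zero]
    exact computesSet_orc (h.sect_zero ▸ sect_mem hY 0)
  have htot : ∀ i, A.ComputesSet (A.sect Y (i + i)) (e i) (A.sect S i) := by
    have hdec : ∀ {i W}, A.ComputesSet (A.sect Y (i + i)) (e i) W → ∀ x,
        A.Computes (A.sect Y (i + i)) (e i) x 1 ∨ A.Computes (A.sect Y (i + i)) (e i) x 0 :=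
      fun {i W} h x => (em (x ∈ W)).imp (h x).1 (h x).2
    have hset : ∀ i, (∀ x, A.Computes (A.sect Y (i + i)) (e i) x 1 ∨
        A.Computes (A.sect Y (i + i)) (e i) x 0) →
        A.ComputesSet (A.sect Y (i + i)) (e i) (A.sect S i) := fun i h x =>
      ⟨(hmem i x).1, fun hx => (h x).resolve_left (mt (hmem i x).2 hx)⟩
    intro i
    exact hset i (ar_induction (fun i => ∀ x, A.Computes (A.sect Y (i + i)) (e i) x 1 ∨
        A.Computes (A.sect Y (i + i)) (e i) x 0) (hdec hzero)
        (fun i ih => hdec (hstep (hset i ih))) i)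
  exact ⟨S, ⟨hS, heq hzero, fun i => heq (hstep (htot i))⟩, htot⟩

namespace IsStepSeq

variable {Z S : Set A.Num} (h : A.IsStepSeq Z S)
include h

theorem colorOf_succ (i : A.Num) : A.colorOf (A.sect S (i + 1)) = A.limitColor (A.sect S i) := by
  rw [h.succ, step, colorOf_join]

theorem domOf_succ (i : A.Num) : A.domOf (A.sect S (i + 1)) = A.thinSet (A.sect S i) := by
  rw [h.succ, step, domOf_join]

theorem isInfinite_domOf (hinf : A.IsInfinite (A.domOf Z)) (i : A.Num) :
    A.IsInfinite (A.domOf (A.sect S i)) := by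
  have := Fact.mk h.mem
  refine ar_induction (fun i => ∀ n, ∃ m, A.pair i (m + m + 1) ∈ S ∧ n < m) ?_ (fun i ih => ?_) i
  · rw [← h.zero] at hinf
    exact hinf
  · have := isInfinite_thinSet (sect_mem h.mem i) ih
    rw [← h.domOf_succ] at this
    exact this

theorem domOf_subset {i j : A.Num} (hij : i ≤ j) :
    A.domOf (A.sect S j) ⊆ A.domOf (A.sect S i) := by
  have := Fact.mk h.mem
  obtain ⟨k, rfl⟩ := num_le_iff.1 hij
  intro x hx
  refine ar_induction (fun k => A.pair (i + k) (x + x + 1) ∈ S → A.pair i (x + x + 1) ∈ S)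
    (fun h => by rwa [add_zero] at h) (fun k ih hk => ih ?_) k hx
  have : x ∈ A.domOf (A.sect S (i + k + 1)) := by rw [add_assoc]; exact hk
  rw [h.domOf_succ] at this
  exact thinSet_subset (sect_mem h.mem _) this

/-- The recursion for the colors: an element `t` of the next domain that lies sufficiently far above
`D_s` can be removed from `D_s ∪ {t}`. -/
theorem mem_colorOf_iff {j s t c : A.Num} (hs : A.IsFinCode s)
    (ht : t ∈ A.domOf (A.sect S (j + 1)))
    (hi : ∀ i, A.FinMem i s → ∃ l ∈ A.domOf (A.sect S (j + 1)), l < t ∧ i ≤ l)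
    (hc : A.IsFinCode c) (hins : A.IsInsert s t c) :
    c ∈ A.colorOf (A.sect S j) ↔ s ∈ A.colorOf (A.sect S (j + 1)) := by
  rw [h.domOf_succ] at ht hi
  rw [h.colorOf_succ]
  exact mem_limitColor_iff (sect_mem h.mem j) hs ht hi hc hins

end IsStepSeq

end Iterate

/-! ### Finite cardinalities -/

section Card

variable {A : L2Structure.{u}} [hA : Fact A.ModelsRCA0] {c s t m : A.Num}

theorem HasCard.not_finMem (h : A.HasCard c 0) (i : A.Num) : ¬ A.FinMem i c := by
  obtain ⟨f, h₁, -, h₃⟩ := h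
  intro hi
  obtain ⟨j, hj, -⟩ := h₃ i hi
  exact hA.out.not_lt_zero _ (h₁ _ _ hj).1

theorem HasCard.exists_finMem (h : A.HasCard c (m + 1)) : ∃ i, A.FinMem i c := by
  obtain ⟨f, h₁, h₂, -⟩ := h
  obtain ⟨j, hj, -⟩ := h₂ m (num_lt_succ.2 le_rfl)
  exact ⟨j, (h₁ _ _ hj).2⟩

variable [hJ : Fact A.OmegaJumpClosed]

theorem exists_max (h : ∃ i, A.FinMem i c) :
    ∃ t, A.FinMem t c ∧ ∀ i, A.FinMem i c → i ≤ t := by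
  obtain ⟨b, hb, hmin⟩ := exists_least (A := A) (fun b => ∀ i, A.FinMem i c → i < b + 1)
    ⟨c, fun i hi => num_lt_succ.2 hi.lt.le⟩
  refine ⟨b, by_contra fun hbc => ?_, fun i hi => num_lt_succ.1 (hb i hi)⟩
  have hlt : ∀ i, A.FinMem i c → i < b := fun i hi =>
    (num_lt_succ.1 (hb i hi)).lt_of_ne fun e => hbc (e ▸ hi)
  obtain rfl | ⟨b, rfl⟩ := eq_zero_or_succ b
  · obtain ⟨i, hi⟩ := h
    exact hA.out.not_lt_zero _ (hlt i hi)
  · exact hmin b (num_lt_succ.2 le_rfl) hlt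

theorem exists_erase (c t : A.Num) :
    ∃ s, A.IsFinCode s ∧ ∀ i, A.FinMem i s ↔ A.FinMem i c ∧ i ≠ t :=
  exists_finCode (A := A) (fun i => A.FinMem i c ∧ ¬ i = t) c fun _ h => h.1.lt

theorem isInsert_of_erase (hs : ∀ i, A.FinMem i s ↔ A.FinMem i c ∧ i ≠ t) (ht : A.FinMem t c) :
    A.IsInsert s t c := by
  intro i
  by_cases e : i = t
  · simp [e, ht]
  · simp [e, hs]

theorem HasCard.erase (h : A.HasCard c (m + 1)) (ht : A.FinMem t c)
    (hs : ∀ i, A.FinMem i s ↔ A.FinMem i c ∧ i ≠ t) : A.HasCard s m := by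
  obtain ⟨f, h₁, h₂, h₃⟩ := h
  obtain ⟨k, hk, hku⟩ := h₃ t ht
  have hfun : ∀ {i j j'}, A.FinMem (A.pair i j) f → A.FinMem (A.pair i j') f → j = j' :=
    fun h h' => (h₂ _ (h₁ _ _ h).1).unique h h'
  have hinj : ∀ {i i' j}, A.FinMem (A.pair i j) f → A.FinMem (A.pair i' j) f → i = i' :=
    fun h h' => (h₃ _ (h₁ _ _ h).2).unique h h'
  -- the new enumeration takes at the index of `t` the last value of the old one
  obtain ⟨g, -, hg⟩ := exists_finCode (A := A) (fun z => ∃ i j, z = A.pair i j ∧ i < m ∧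
    A.FinMem j s ∧ ((¬ i = k ∧ A.FinMem (A.pair i j) f) ∨ (i = k ∧ A.FinMem (A.pair m j) f)))
    (A.pair m s + 1) (by
      rintro _ ⟨i, j, rfl, hi, hj, -⟩
      exact num_lt_succ.2 (pair_le_pair hi.le hj.lt.le))
  have hg' : ∀ i j, A.FinMem (A.pair i j) g ↔ i < m ∧ A.FinMem j s ∧
      ((¬ i = k ∧ A.FinMem (A.pair i j) f) ∨ (i = k ∧ A.FinMem (A.pair m j) f)) := by
    intro i j
    rw [hg]
    constructor
    · rintro ⟨i, j, e, h⟩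
      obtain ⟨rfl, rfl⟩ := pair_inj.1 e
      exact h
    · exact fun h => ⟨i, j, rfl, h⟩
  refine ⟨g, fun i j h => ⟨((hg' i j).1 h).1, ((hg' i j).1 h).2.1⟩, fun i hi => ?_, fun j hj => ?_⟩
  · by_cases hik : i = k
    · obtain ⟨j, hj, -⟩ := h₂ m (num_lt_succ.2 le_rfl)
      refine ⟨j, (hg' i j).2 ⟨hi, (hs j).2 ⟨(h₁ _ _ hj).2, ?_⟩, .inr ⟨hik, hj⟩⟩, fun j' hj' => ?_⟩
      · rintro rfl
        exact hi.ne (hik.trans (hinj hk hj))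
      · obtain ⟨-, -, ⟨h, -⟩ | ⟨-, h⟩⟩ := (hg' i j').1 hj'
        exacts [(h hik).elim, hfun h hj]
    · obtain ⟨j, hj, -⟩ := h₂ i (hi.trans (num_lt_succ.2 le_rfl))
      refine ⟨j, (hg' i j).2 ⟨hi, (hs j).2 ⟨(h₁ _ _ hj).2, ?_⟩, .inl ⟨hik, hj⟩⟩, fun j' hj' => ?_⟩
      · rintro rfl
        exact hik (hinj hj hk)
      · obtain ⟨-, -, ⟨-, h⟩ | ⟨h, -⟩⟩ := (hg' i j').1 hj'
        exacts [hfun h hj, (hik h).elim]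
  · obtain ⟨hjc, hjt⟩ := (hs j).1 hj
    obtain ⟨i, hi, -⟩ := h₃ j hjc
    have hik : i ≠ k := by
      rintro rfl
      exact hjt (hfun hi hk)
    obtain him | rfl := (num_lt_succ.1 (h₁ _ _ hi).1).lt_or_eq
    · refine ⟨i, (hg' i j).2 ⟨him, hj, .inl ⟨hik, hi⟩⟩, fun i' hi' => ?_⟩
      obtain ⟨-, -, ⟨-, h⟩ | ⟨-, h⟩⟩ := (hg' i' j).1 hi'
      · exact hinj h hi
      · exact (him.ne (hinj hi h)).elim
    · have hkm := (num_lt_succ.1 (h₁ _ _ hk).1).lt_of_ne hik.symm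
      refine ⟨k, (hg' k j).2 ⟨hkm, hj, .inr ⟨rfl, hi⟩⟩, fun i' hi' => ?_⟩
      obtain ⟨h', -, ⟨-, h⟩ | ⟨h, -⟩⟩ := (hg' i' j).1 hi'
      · exact (h'.ne (hinj h hi)).elim
      · exact h

end Card

end

section

/-! ### Homogeneous sets -/

section Homogeneous

variable {A : L2Structure.{u}} [hA : Fact A.ModelsRCA0] [hJ : Fact A.OmegaJumpClosed]
  {Z S : Set A.Num} (h : A.IsStepSeq Z S)
include h

namespace IsStepSeq

/-- After `a` steps, the color of an `a`-element subset of the domain has been reduced to the color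
of the empty set. -/
theorem isHomogeneous_card (a : A.Num) :
    A.IsHomogeneous (fun c => A.HasCard c a) (A.colorOf Z) (A.domOf (A.sect S a)) := by
  have := Fact.mk h.mem
  obtain ⟨c₀, hc₀, he⟩ := exists_finCode (A := A) (fun i => ¬ i = i) 0 fun i h => (h rfl).elim
  have key := ar_induction (fun k => ∀ j, j + k = a → ∀ c, A.IsFinCode c → A.HasCard c k →
    (∀ i, A.FinMem i c → A.pair a (i + i + 1) ∈ S) →
    (A.pair j (c + c) ∈ S ↔ A.pair a (c₀ + c₀) ∈ S)) ?_ ?_ a 0 (zero_add a)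
  · have e : A.colorOf Z = A.colorOf (A.sect S 0) := by rw [h.zero]
    rw [e]
    by_cases hC : A.pair a (c₀ + c₀) ∈ S
    · exact .inl fun c hc hcard hsub => (key c hc hcard hsub).2 hC
    · exact .inr fun c hc hcard hsub hcC => hC ((key c hc hcard hsub).1 hcC)
  · intro j hj c hc hcard _
    rw [hc.ext hc₀ fun i => iff_of_false (hcard.not_finMem i) fun hi => (he i).1 hi rfl,
      ← hj, add_zero]
  · intro k ih j hj c hc hcard hsub
    obtain ⟨t, ht, hmax⟩ := exists_max hcard.exists_finMem
    obtain ⟨s, hs, hsc⟩ := exists_erase c t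
    have hj' : j + 1 + k = a := by rw [← hj]; ring
    have hD : ∀ i, A.FinMem i c → i ∈ A.domOf (A.sect S (j + 1)) := fun i hi =>
      h.domOf_subset (num_le_iff.2 ⟨k, hj'.symm⟩) (hsub i hi)
    refine (h.mem_colorOf_iff hs (hD t ht) (fun i hi => ?_) hc (isInsert_of_erase hsc ht)).trans
      (ih (j + 1) hj' s hs (hcard.erase ht hsc) fun i hi => hsub i ((hsc i).1 hi).1)
    obtain ⟨hic, hit⟩ := (hsc i).1 hi
    exact ⟨i, hD i hic, (hmax i hic).lt_of_ne hit, le_rfl⟩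

/-- The diagonal set of the sequence: for `j` up to some smaller element of the set, its elements
can be removed from the finite subsets of which they are the maximum in passing from the `j`-th to
the `(j + 1)`-st coloring. -/
theorem exists_diagonal (hinf : A.IsInfinite (A.domOf Z)) :
    ∃ L ∈ A.Sets, L ⊆ A.domOf Z ∧ A.IsInfinite L ∧ ∀ t ∈ L, ∀ l ∈ L, l < t → ∀ j ≤ l, ∀ s c,
      A.IsFinCode s → A.IsFinCode c → (∀ i, A.FinMem i s → i ∈ L ∧ i < t) → A.IsInsert s t c →
      (c ∈ A.colorOf (A.sect S j) ↔ s ∈ A.colorOf (A.sect S (j + 1))) := by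
  have := Fact.mk h.mem
  have hM : A.domOf Z ∈ A.Sets := domOf_mem (h.zero ▸ sect_mem h.mem 0)
  set M := A.domOf Z with hMdef
  have := Fact.mk hM
  let P : A.Num → A.Num → Prop := fun w t => t ∈ M ∧ ∀ l, A.FinMem l w → l < t → ∀ j, j < l + 1 →
    ∀ s c, A.IsFinCode s → A.IsFinCode c → (∀ i, A.FinMem i s → A.FinMem i w ∧ i < t) →
    (∀ i, A.FinMem i c ↔ A.FinMem i s ∨ i = t) →
    (A.pair j (c + c) ∈ S ↔ A.pair (j + 1) (s + s) ∈ S)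
  have hG : {z | ∃ w t, z = A.pair w t ∧ P w t} ∈ A.Sets :=
    Ar.setOf_mem (A := A) (fun z => ∃ w t, z = A.pair w t ∧ t ∈ M ∧ ∀ l, A.FinMem l w → l < t →
      ∀ j, j < l + 1 → ∀ s c, A.IsFinCode s → A.IsFinCode c →
      (∀ i, A.FinMem i s → A.FinMem i w ∧ i < t) → (∀ i, A.FinMem i c ↔ A.FinMem i s ∨ i = t) →
      (A.pair j (c + c) ∈ S ↔ A.pair (j + 1) (s + s) ∈ S))
  set G := {z | ∃ w t, z = A.pair w t ∧ P w t}
  have hPG : ∀ w t, A.pair w t ∈ G ↔ P w t := by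
    refine fun w t => ⟨?_, fun h => ⟨w, t, rfl, h⟩⟩
    rintro ⟨w, t, e, h⟩
    obtain ⟨rfl, rfl⟩ := pair_inj.1 e
    exact h
  have hmono : ∀ w w' t, (∀ i, i < t → (A.FinMem i w ↔ A.FinMem i w')) → P w t → P w' t :=
    fun w w' t hww h => ⟨h.1, fun l hl hlt j hj s c hs hc hsw hins =>
      h.2 l ((hww l hlt).2 hl) hlt j hj s c hs hc
        (fun i hi => ⟨(hww i (hsw i hi).2).2 (hsw i hi).1, (hsw i hi).2⟩) hins⟩
  have hext : A.Extensional G := fun w w' t hww => by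
    rw [hPG, hPG]
    exact ⟨hmono w w' t hww, hmono w' w t fun i hi => (hww i hi).symm⟩
  have hL := cvSet_mem hG
  have := Fact.mk hL
  have hmem : ∀ t, t ∈ A.cvSet G ↔ t ∈ M ∧ ∀ l ∈ A.cvSet G, l < t → ∀ j ≤ l, ∀ s c,
      A.IsFinCode s → A.IsFinCode c → (∀ i, A.FinMem i s → i ∈ A.cvSet G ∧ i < t) →
      A.IsInsert s t c →
      (c ∈ A.colorOf (A.sect S j) ↔ s ∈ A.colorOf (A.sect S (j + 1))) := by
    intro t
    obtain ⟨w, -, hw⟩ := exists_finCode (A := A) (fun i => i ∈ A.cvSet G ∧ i < t) t fun i h => h.2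
    rw [mem_cvSet hG hext (w := w) fun i hi => by simp [hw i, hi], hPG]
    refine and_congr_right fun _ => ⟨fun h l hl hlt j hj s c hs hc hsw hins => ?_,
      fun h l hl hlt j hj s c hs hc hsw hins => ?_⟩
    · exact h l ((hw l).2 ⟨hl, hlt⟩) hlt j (num_lt_succ.2 hj) s c hs hc
        (fun i hi => ⟨(hw i).2 (hsw i hi), (hsw i hi).2⟩) hins
    · exact h l ((hw l).1 hl).1 hlt j (num_lt_succ.1 hj) s c hs hc
        (fun i hi => (hw i).1 (hsw i hi).1) hins
  refine ⟨A.cvSet G, hL, fun t ht => ((hmem t).1 ht).1, fun n => ?_, fun t ht => ((hmem t).1 ht).2⟩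
  -- if no element of the set is larger than `n`, then any element of the `(n + 1)`-st domain that
  -- lies above another one above `n` belongs to the set
  by_contra! hn
  obtain ⟨l, hl, hnl⟩ := h.isInfinite_domOf hinf (n + 1) n
  obtain ⟨t, ht, hlt⟩ := h.isInfinite_domOf hinf (n + 1) l
  refine (hn t ((hmem t).2 ⟨?_, fun l' hl' _ j hj s c hs hc hsw hins => ?_⟩)).not_gt
    (hnl.trans hlt)
  · have := h.domOf_subset (zero_le : 0 ≤ n + 1) ht
    rwa [h.zero, ← hMdef] at this
  · have hD := h.domOf_subset (add_le_add_left (hj.trans (hn l' hl')) 1)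
    exact h.mem_colorOf_iff hs (hD ht) (fun i hi => ⟨l, hD hl, hlt,
      (hn i (hsw i hi).1).trans hnl.le⟩) hc hins

/-- On the diagonal set, the color of an exactly large set with minimum `a` is the color of `{a}`
after `a` steps. -/
theorem mem_colorOf_iff_singleton {L : Set A.Num}
    (hdiag : ∀ t ∈ L, ∀ l ∈ L, l < t → ∀ j ≤ l, ∀ s c,
      A.IsFinCode s → A.IsFinCode c → (∀ i, A.FinMem i s → i ∈ L ∧ i < t) → A.IsInsert s t c →
      (c ∈ A.colorOf (A.sect S j) ↔ s ∈ A.colorOf (A.sect S (j + 1))))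
    (hL : L ∈ A.Sets) {a b c : A.Num} (hb : A.IsFinCode b) (hba : ∀ i, A.FinMem i b ↔ i = a)
    (hc : A.IsFinCode c) (hcL : ∀ i, A.FinMem i c → i ∈ L) (ha : A.FinMem a c)
    (hmin : ∀ i, A.FinMem i c → a ≤ i) (hcard : A.HasCard c (a + 1)) :
    c ∈ A.colorOf Z ↔ b ∈ A.colorOf (A.sect S a) := by
  have := Fact.mk h.mem
  have := Fact.mk hL
  have key := ar_induction (fun k => ∀ j, j + k = a → ∀ c, A.IsFinCode c →
    (∀ i, A.FinMem i c → i ∈ L) → A.FinMem a c → (∀ i, A.FinMem i c → a ≤ i) →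
    A.HasCard c (k + 1) → (A.pair j (c + c) ∈ S ↔ A.pair a (b + b) ∈ S)) ?_ ?_ a 0 (zero_add a)
    c hc hcL ha hmin hcard
  · rw [← h.zero]
    exact key
  · intro j hj c hc _ ha _ hcard
    obtain ⟨s, hs, hsc⟩ := exists_erase c a
    rw [hc.ext hb fun i => ?_, ← hj, add_zero]
    rw [isInsert_of_erase hsc ha i, hba]
    exact or_iff_right ((hcard.erase ha hsc).not_finMem i)
  · intro k ih j hj c hc hcL ha hmin hcard
    obtain ⟨t, ht, hmax⟩ := exists_max hcard.exists_finMem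
    obtain ⟨s, hs, hsc⟩ := exists_erase c t
    have hscard := hcard.erase ht hsc
    have hat : a ≠ t := by
      rintro rfl
      obtain ⟨i, hi⟩ := hscard.exists_finMem
      obtain ⟨hi, hne⟩ := (hsc i).1 hi
      exact hne ((hmax i hi).antisymm (hmin i hi))
    have hj' : j + 1 + k = a := by rw [← hj]; ring
    refine (hdiag t (hcL t ht) a (hcL a ha) ((hmax a ha).lt_of_ne hat) j
      (hj ▸ le_self_add) s c hs hc (fun i hi => ?_) (isInsert_of_erase hsc ht)).trans
      (ih (j + 1) hj' s hs (fun i hi => hcL i ((hsc i).1 hi).1) ((hsc a).2 ⟨ha, hat⟩)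
        (fun i hi => hmin i ((hsc i).1 hi).1) hscard)
    obtain ⟨hic, hit⟩ := (hsc i).1 hi
    exact ⟨hcL i hic, (hmax i hic).lt_of_ne hit⟩

theorem exists_isHomogeneous_exactlyLarge (hinf : A.IsInfinite (A.domOf Z)) :
    ∃ L ∈ A.Sets, L ⊆ A.domOf Z ∧ A.IsInfinite L ∧
      A.IsHomogeneous A.ExactlyLarge (A.colorOf Z) L := by
  have := Fact.mk h.mem
  obtain ⟨L, hL, hLM, hLinf, hdiag⟩ := h.exists_diagonal hinf
  have := Fact.mk hL
  have hsing : ∀ a : A.Num, ∃ b, A.IsFinCode b ∧ ∀ i, A.FinMem i b ↔ i = a := fun a =>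
    exists_finCode (fun i => i = a) (a + 1) fun i hi => num_lt_succ.2 hi.le
  have hT := Ar.setOf_mem (A := A) (fun a => a ∈ L ∧
    ∃ b, A.IsFinCode b ∧ (∀ i, A.FinMem i b ↔ i = a) ∧ A.pair a (b + b) ∈ S)
  have hT' := Ar.setOf_mem (A := A) (fun a => a ∈ L ∧
    ¬ ∃ b, A.IsFinCode b ∧ (∀ i, A.FinMem i b ↔ i = a) ∧ A.pair a (b + b) ∈ S)
  by_cases hTinf : A.IsInfinite {a | a ∈ L ∧
    ∃ b, A.IsFinCode b ∧ (∀ i, A.FinMem i b ↔ i = a) ∧ A.pair a (b + b) ∈ S}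
  · refine ⟨_, hT, fun a ha => hLM ha.1, hTinf, .inl fun c hc ⟨a, ha, hmin, hcard⟩ hsub => ?_⟩
    obtain ⟨b, hb, hba, hbS⟩ := (hsub a ha).2
    exact (h.mem_colorOf_iff_singleton hdiag hL hb hba hc (fun i hi => (hsub i hi).1) ha
      (fun i hi => le_iff_lt_or_eq.2 (hmin i hi)) hcard).2 hbS
  · refine ⟨_, hT', fun a ha => hLM ha.1, fun n => ?_,
      .inr fun c hc ⟨a, ha, hmin, hcard⟩ hsub hcZ => (hsub a ha).2 ?_⟩
    · obtain ⟨m, hm⟩ := not_forall.1 hTinf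
      obtain ⟨a, ha, hlt⟩ := hLinf (n + m)
      exact ⟨a, ⟨ha, fun hb => hm ⟨a, ⟨ha, hb⟩, le_add_self.trans_lt hlt⟩⟩,
        le_self_add.trans_lt hlt⟩
    · obtain ⟨b, hb, hba⟩ := hsing a
      exact ⟨b, hb, hba, (h.mem_colorOf_iff_singleton hdiag hL hb hba hc
        (fun i hi => (hsub i hi).1) ha (fun i hi => le_iff_lt_or_eq.2 (hmin i hi)) hcard).1 hcZ⟩

end IsStepSeq

end Homogeneous

theorem rtExactlyLarge (A : L2Structure.{u}) [hA : Fact A.ModelsRCA0]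
    [hJ : Fact A.OmegaJumpClosed] : A.RTExactlyLarge := by
  intro M hM C hC hinf
  obtain ⟨t, ht⟩ := UOp.step.{u}
  obtain ⟨e, hAr, he₀, he, -⟩ := exists_iterate (A := A) t
  obtain ⟨Y, hY, hω⟩ := hJ.out _ (join_mem hC hM)
  obtain ⟨S, hS, -⟩ := exists_isStepSeq hY hω ht hAr he₀ he
  have := hS.exists_isHomogeneous_exactlyLarge (by rwa [domOf_join])
  rwa [domOf_join, colorOf_join] at this

theorem exists_uniformHomogeneous :
    ∃ p : ℕ, ∀ (A : L2Structure.{u}) [Fact A.ModelsRCA0] [Fact A.OmegaJumpClosed],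
      A.UniformHomogeneous (A.numeral p) := by
  obtain ⟨t, ht⟩ := UOp.step.{u}
  obtain ⟨d, hd⟩ := UOp.domOf.{u}
  -- from `a` to the template `d` applied to the `a`-th iterate of `t`
  refine ⟨(Tm.cmp d.quote (.cmp t.iterp (.prp (.cst (.num 0)) .idp))).value,
    fun A hA hJ a _ => ?_⟩
  have h0 := empty_mem (A := A)
  obtain ⟨e, hAr, he₀, he, hrun⟩ := exists_iterate (A := A) t
  refine ⟨d.eval A fun _ => e a, ?_, fun U hU C hC hinf => ?_⟩
  · rw [numeral_value]
    exact runs_cmp h0 (runs_cmp h0 (runs_prp h0 (runs_cst_zero h0) (runs_idp h0)) (hrun a))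
      (runs_quote h0 d _)
  · obtain ⟨Y, hY, hω⟩ := hJ.out _ (join_mem hC hU)
    obtain ⟨S, hS, hcomp⟩ := exists_isStepSeq hY hω ht hAr he₀ he
    have hDinf : A.IsInfinite (A.domOf (A.join C U)) := by rwa [domOf_join]
    refine ⟨A.sect Y (a + a), sect_mem hY _, hω.2 _, A.domOf (A.sect S a),
      domOf_mem (sect_mem hS.mem a), ?_, hS.isInfinite_domOf hDinf a, ?_, ?_⟩
    · have := hS.domOf_subset (zero_le : 0 ≤ a)
      rwa [hS.zero, domOf_join] at this
    · have := hS.isHomogeneous_card a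
      rwa [colorOf_join] at this
    · simpa using hω.computesSet hY (Φ := fun A V => A.domOf (V 0)) hd (hcomp a)

end

end L2Structure

theorem mainTheorem4 :
    (∀ A : L2Structure.{u}, A.ModelsRCA0 → A.OmegaJumpClosed → A.RTExactlyLarge) ∧
    (∃ p : ℕ, ∀ A : L2Structure.{u}, A.ModelsRCA0 → A.OmegaJumpClosed →
      A.UniformHomogeneous (A.numeral p)) := by
  refine ⟨fun A hA hJ => ?_, ?_⟩
  · have := Fact.mk hA
    have := Fact.mk hJ
    exact A.rtExactlyLarge
  · obtain ⟨p, hp⟩ := L2Structure.exists_uniformHomogeneous.{u}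
    refine ⟨p, fun A hA hJ => ?_⟩
    have := Fact.mk hA
    have := Fact.mk hJ
    exact hp A
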